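/- Let $P\subset\mathbb R^2$ be a polygonal domain (bounded, open, connected, with boundary a simple closed polygonal curve) of perimeter one, and let $f$ be a contracting reflection law: a $C^2$ embedding of $[-\pi/2,\pi/2]$ into itself with $f(0)=0$, $f'>0$ on $(-\pi/2,\pi/2)$ and $\lambda(f)=\sup_{(-\pi/2,\pi/2)}|f'|<1$. Let $M=S^1\times[-\pi/2,\pi/2]$ be the set of unit vectors $x=(s,\theta)$ attached to $\partial P$, where $s\in S^1=\mathbb R/\mathbb Z$ is the arclength parameter of the base point along the positively oriented boundary and $\theta$ is the angle from the inner normal towards the tangent. Let $N^+=V\cup S\cup\partial M$, where $V$ is the set of $(s,\theta)$ based at a vertex with $|\theta|<\pi/2$, and $S$ is the set of vectors whose trajectory hits a vertex of $P$ at its first collision with $\partial P$. Let $\Phi=\Phi_{f,P}\colon M\setminus N^+\to M$, $\Phi(x)=(\bar s_1,f(\bar\theta_1))$, where $(\bar s_1,\bar\theta_1)$ is the image of $x$ under the billiard map of $P$ with specular reflection. For $n\ge1$ put $N_n^+=N^+\cup\Phi^{-1}(N^+)\cup\dots\cup\Phi^{-n+1}(N^+)$. Suppose that $P$ has no parallel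 sides facing each other, i.e. the endpoints of every straight segment that is contained inside $P$ and joins orthogonally two sides of $P$ are vertices of $P$. Then for every $\vartheta<\pi/2$ there is $n_0$ such that for every $n\ge n_0$ $$\liminf_{\delta\to0^+}\ \sup_{\Gamma\in\mathcal H_\vartheta(\delta)}\ \sum_{\gamma\in\pi_0(\Gamma\setminus N_n^+)}\frac1{a_n(\gamma)}<1,\qquad a_n(\gamma)=\inf_{x\in\gamma}\|D_x\Phi^n(1,0)\|,$$ where $\mathcal H_\vartheta(\delta)$ is the set of horizontal open segments (segments with $\theta$ constant) of $M$ that have length at most $\delta$ and lie in the strip $|\theta|\le\vartheta$, and $\pi_0$ denotes the set of connected components. In particular (take $\vartheta=\lambda(f)\pi/2$), for all sufficiently large $n$ the map $\Phi$ satisfies the $n$-step expansion condition for the horizontal segments contained in the strip $|\theta|\le\lambda(f)\pi/2$, which contains the image of $\Phi$. -/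

import Mathlib

open Set Filter Topology

noncomputable section

/-- A polygonal domain of the plane `ℂ = ℝ²` with `d` sides and perimeter one, whose boundary is a
simple closed curve, together with the positively oriented arclength parametrization of its
boundary. The arclength parameter is a real number read modulo `1`; the vertices are at the
parameters `0 = corner 0 < ⋯ < corner (d - 1) < 1`, and `corner d = 1` is the first vertex again. -/
structure PolygonalTable (d : ℕ) where
  /-- the polygonal domain itself -/
  domain : Set ℂ
  /-- arclength parametrization of its boundary -/
  bdry : ℝ → ℂ
  /-- arclength parameters of the vertices -/
  corner : Fin (d + 1) → ℝ
  /-- unit tangent vectors of the sides -/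
  dir : Fin d → ℂ
  isOpen_domain : IsOpen domain
  isConnected_domain : IsConnected domain
  isBounded_domain : Bornology.IsBounded domain
  frontier_domain : frontier domain = range bdry
  corner_zero : corner 0 = 0
  corner_last : corner (Fin.last d) = 1
  corner_strictMono : StrictMono corner
  bdry_periodic : Function.Periodic bdry 1
  bdry_injOn : InjOn bdry (Ico 0 1)
  norm_dir : ∀ i, ‖dir i‖ = 1
  /-- the `i`-th side is a straight segment, parametrized by arclength -/
  bdry_side : ∀ i : Fin d, ∀ s ∈ Icc (corner i.castSucc) (corner i.succ),
    bdry s = bdry (corner i.castSucc) + ((s - corner i.castSucc : ℝ) : ℂ) * dir i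
  /-- two consecutive sides are not collinear -/
  dir_ne : ∀ i j : Fin d, bdry (corner i.succ) = bdry (corner j.castSucc) → dir i ≠ dir j
  /-- positive orientation: the domain lies on the left of each side -/
  left_mem : ∀ i : Fin d, ∀ s ∈ Ioo (corner i.castSucc) (corner i.succ),
    ∀ᶠ t : ℝ in 𝓝[>] 0, bdry s + (t : ℂ) * (Complex.I * dir i) ∈ domain

namespace PolygonalTable

variable {d : ℕ} (P : PolygonalTable d)

/-- The vertices of the polygon. -/
def vertices : Set ℂ := range fun i => P.bdry (P.corner i)

/-- The `i`-th (closed) side of the polygon. -/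
def side (i : Fin d) : Set ℂ := P.bdry '' Icc (P.corner i.castSucc) (P.corner i.succ)

/-- The endpoints of every straight segment contained inside the polygon and joining orthogonally
two of its sides are vertices. -/
def NoParallelSidesFacing : Prop :=
  ∀ i j : Fin d, ∀ a ∈ P.side i, ∀ b ∈ P.side j, a ≠ b → openSegment ℝ a b ⊆ P.domain →
    inner ℝ (b - a) (P.dir i) = 0 → inner ℝ (b - a) (P.dir j) = 0 →
      a ∈ P.vertices ∧ b ∈ P.vertices

/- Points of the phase space `M = S¹ × [-π/2, π/2]` are written `(s, θ)` with `s` a real number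
read modulo `1`: the subsets of `M` below are given as subsets of `ℝ × ℝ` that are `1`-periodic
in `s`, and the billiard map returns its arclength coordinate in `[0, 1)`. -/

/-- The unit vector at the boundary point of parameter `s` that makes the angle `θ` with the inner
normal, measured towards the positively oriented tangent. -/
def velocity (x : ℝ × ℝ) : ℂ :=
  ((Real.sin x.2 : ℂ) + (Real.cos x.2 : ℂ) * Complex.I) * deriv P.bdry x.1

/-- The length of the free flight until the first collision with the boundary. -/
def flightTime (x : ℝ × ℝ) : ℝ :=
  sInf {t : ℝ | 0 < t ∧ P.bdry x.1 + (t : ℂ) * P.velocity x ∈ frontier P.domain}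

/-- The point of the first collision. -/
def hitPoint (x : ℝ × ℝ) : ℂ := P.bdry x.1 + (P.flightTime x : ℂ) * P.velocity x

/-- The arclength parameter in `[0, 1)` of the point of the first collision. -/
def hitParam (x : ℝ × ℝ) : ℝ := Function.invFunOn P.bdry (Ico 0 1) (P.hitPoint x)

/-- The billiard map with the specular reflection law. Specular reflection preserves the
component of the velocity along the tangent at the collision point, and this component is the
sine of the angle that the outgoing vector makes with the inner normal. -/
def specularMap (x : ℝ × ℝ) : ℝ × ℝ :=
  (P.hitParam x, Real.arcsin (inner ℝ (P.velocity x) (deriv P.bdry (P.hitParam x))))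

/-- The billiard map with the reflection law `f`. Only its values outside `singularSet`
are meaningful. -/
def billiardMap (f : ℝ → ℝ) (x : ℝ × ℝ) : ℝ × ℝ :=
  ((P.specularMap x).1, f (P.specularMap x).2)

/-- The set `V` of the vectors based at a vertex. -/
def vertexSet : Set (ℝ × ℝ) :=
  {x | P.bdry x.1 ∈ P.vertices ∧ x.2 ∈ Ioo (-(Real.pi / 2)) (Real.pi / 2)}

/-- The set `S` of the vectors whose trajectory hits a vertex at the first collision (those based
at a vertex belong to `V`, the tangent ones to `∂M`). -/
def hitVertexSet : Set (ℝ × ℝ) :=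
  {x | P.bdry x.1 ∉ P.vertices ∧ x.2 ∈ Ioo (-(Real.pi / 2)) (Real.pi / 2) ∧
    P.hitPoint x ∈ P.vertices}

/-- The boundary `∂M` of the phase space. -/
def phaseBoundary : Set (ℝ × ℝ) := {x | x.2 = -(Real.pi / 2) ∨ x.2 = Real.pi / 2}

/-- The singular set `N⁺ = V ∪ S ∪ ∂M` of the billiard map. -/
def singularSet : Set (ℝ × ℝ) := P.vertexSet ∪ P.hitVertexSet ∪ phaseBoundary

/-- The set `N⁺ₙ = N⁺ ∪ Φ⁻¹(N⁺) ∪ ⋯ ∪ Φ⁻ⁿ⁺¹(N⁺)`. The values of the map on the singular set are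
irrelevant here: the points at which an iterate is undefined lie in an earlier member. -/
def singularSetIter (f : ℝ → ℝ) (n : ℕ) : Set (ℝ × ℝ) :=
  ⋃ k < n, (P.billiardMap f)^[k] ⁻¹' P.singularSet

/-- The expansion coefficient `‖D_x Φⁿ (1, 0)‖` along the horizontal direction, in the
Euclidean norm. -/
def expansion (f : ℝ → ℝ) (n : ℕ) (x : ℝ × ℝ) : ENNReal :=
  ‖WithLp.toLp 2 (fderiv ℝ (P.billiardMap f)^[n] x (1, 0))‖ₑ

/-- The least expansion coefficient of `Φⁿ` along the horizontal direction on a set. -/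
def leastExpansion (f : ℝ → ℝ) (n : ℕ) (γ : Set (ℝ × ℝ)) : ENNReal :=
  ⨅ x ∈ γ, P.expansion f n x

end PolygonalTable

/-- The set of the connected components of a subset `A` of a topological space. -/
def componentsOf {X : Type*} [TopologicalSpace X] (A : Set X) : Set (Set X) :=
  connectedComponentIn A '' A

/-- The horizontal open segments of length at most `δ` in the strip `|θ| ≤ ϑ`
of the phase space. -/
def hCurves (ϑ δ : ℝ) : Set (Set (ℝ × ℝ)) :=
  {Γ | ∃ a b θ : ℝ, a < b ∧ b - a ≤ δ ∧ |θ| ≤ ϑ ∧ Γ = Ioo a b ×ˢ {θ}}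

/-- The quantity `β(Φ)` of the `n`-step expansion condition, for the `h`-curves in the strip
`|θ| ≤ ϑ`. -/
def PolygonalTable.stepExpansion {d : ℕ} (P : PolygonalTable d) (f : ℝ → ℝ) (ϑ : ℝ) (n : ℕ) :
    ENNReal :=
  liminf (fun δ : ℝ => ⨆ Γ ∈ hCurves ϑ δ,
    ∑' γ : componentsOf (Γ \ P.singularSetIter f n), (P.leastExpansion f n γ)⁻¹) (𝓝[>] 0)

/-- Contracting reflection laws: `C²` embeddings of `[-π/2, π/2]` into itself with `f 0 = 0`,
positive derivative on the open interval, and `λ(f) = sup |f'| < 1`. -/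
structure IsContractingLaw (f : ℝ → ℝ) : Prop where
  mapsTo : MapsTo f (Icc (-(Real.pi / 2)) (Real.pi / 2)) (Icc (-(Real.pi / 2)) (Real.pi / 2))
  contDiffOn : ContDiffOn ℝ 2 f (Icc (-(Real.pi / 2)) (Real.pi / 2))
  injOn : InjOn f (Icc (-(Real.pi / 2)) (Real.pi / 2))
  derivWithin_ne_zero : ∀ θ ∈ Icc (-(Real.pi / 2)) (Real.pi / 2),
    derivWithin f (Icc (-(Real.pi / 2)) (Real.pi / 2)) θ ≠ 0
  contracting : sSup ((fun θ => |deriv f θ|) '' Ioo (-(Real.pi / 2)) (Real.pi / 2)) < 1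
  map_zero : f 0 = 0
  deriv_pos : ∀ θ ∈ Ioo (-(Real.pi / 2)) (Real.pi / 2), 0 < deriv f θ

end

/-!
Along a trajectory of `n` collisions a horizontal vector is expanded by the product of the factors
`cos (f θ) / cos θ`, where `θ` is the specular angle of each collision. Since `f` contracts, every
factor is at least one, and it is bounded away from one unless the collision is almost orthogonal.
A flight that leaves and arrives almost orthogonally joins parallel sides. When no parallel sides
face each other, one of any three consecutive collisions is not almost orthogonal: near an
orthogonal vector, either the forward or the backward trajectory diverges from the orthogonal one.
Hence the expansion grows exponentially in `n`.

The cuts of a short segment grow only linearly. A singularity none of whose collisions is grazing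
(almost tangent) lies on the side of a reference trajectory where rays have not yet crossed it, and
parallel rays of that kind hit the same side; so, at each order, the number of such cuts near
any vector is at most `d`, uniformly in the order, and a Lebesgue number makes the neighbourhood
uniform over the strip. The remaining components contain only vectors with a grazing collision.
Their number is bounded for fixed `n`, and their expansion can be made arbitrarily large by lowering
the grazing threshold. A linear bound divided by an exponential one is eventually less than one.
-/

open scoped Real

noncomputable section

/-! ### Discs slit along radii -/

lemma subset_of_isPreconnected_of_disjoint_frontier {X : Type*} [TopologicalSpace X] {D S : Set X}
    (hD : IsOpen D) (hS : IsPreconnected S) (hdisj : Disjoint S (frontier D))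
    (hne : (S ∩ D).Nonempty) : S ⊆ D := by
  refine hS.subset_of_closure_inter_subset hD hne fun q ⟨hq, hqS⟩ => ?_
  by_contra h
  exact disjoint_left.1 hdisj hqS (hD.frontier_eq ▸ ⟨hq, h⟩)

lemma dense_slitPlane : Dense Complex.slitPlane :=
  ((dense_compl_singleton (0 : ℝ)).preimage Complex.isOpenMap_im).mono fun _ hz => Or.inr hz

/-- The disc of center `v` and radius `r` without the radius in the direction of `b`. -/
def slitDisc (v b : ℂ) (r : ℝ) : Set ℂ :=
  Metric.ball v r \ {q | ∃ t : ℝ, 0 ≤ t ∧ q = v + t * b}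

lemma slitDisc_eq {v b : ℂ} (hb : b ≠ 0) (r : ℝ) :
    slitDisc v b r = Metric.ball v r ∩ {q | (v - q) / b ∈ Complex.slitPlane} := by
  refine congrArg (Metric.ball v r ∩ ·) (Set.ext fun q => ?_)
  change (¬ ∃ t : ℝ, 0 ≤ t ∧ q = v + t * b) ↔ (v - q) / b ∈ Complex.slitPlane
  rw [Complex.mem_slitPlane_iff_not_le_zero, not_iff_not]
  constructor
  · rintro ⟨t, ht, rfl⟩
    rw [sub_add_cancel_left, neg_div, mul_div_cancel_right₀ _ hb, ← Complex.ofReal_neg]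
    exact_mod_cast neg_nonpos.2 ht
  · intro h
    refine ⟨-((v - q) / b).re, neg_nonneg.2 (Complex.le_def.1 h).1, ?_⟩
    have hre : (((v - q) / b).re : ℂ) = (v - q) / b :=
      Complex.ext rfl (by simpa using (Complex.le_def.1 h).2.symm)
    rw [Complex.ofReal_neg, hre]
    field_simp
    ring

lemma isPreconnected_slitDisc {v b : ℂ} (hb : b ≠ 0) {r : ℝ} (hr : 0 < r) :
    IsPreconnected (slitDisc v b r) := by
  set x : ℂ := v - ((r / (2 * ‖b‖) : ℝ) : ℂ) * b with hx
  have : 0 < ‖b‖ := norm_pos_iff.2 hb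
  have hxb : (v - x) / b = ((r / (2 * ‖b‖) : ℝ) : ℂ) := by rw [hx]; field_simp; ring
  have hxr : x ∈ Metric.ball v r := by
    rw [Metric.mem_ball, dist_eq_norm, hx, sub_sub_cancel_left, norm_neg, norm_mul,
      Complex.norm_real, Real.norm_of_nonneg (by positivity)]
    field_simp
    linarith
  have hstar : StarConvex ℝ x {q | (v - q) / b ∈ Complex.slitPlane} := by
    intro y hy α β hα hβ hαβ
    have hcomb : (v - (α • x + β • y)) / b = α • ((v - x) / b) + β • ((v - y) / b) := by
      obtain rfl : α = 1 - β := by linarith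
      simp only [Complex.real_smul]
      push_cast
      ring
    rw [mem_ofPred_eq, hcomb, hxb]
    exact Complex.starConvex_ofReal_slitPlane (by positivity) hy hα hβ hαβ
  rw [slitDisc_eq hb]
  refine ((((convex_ball v r).starConvex hxr).inter hstar).isPathConnected
    ⟨hxr, ?_⟩).isConnected.isPreconnected
  rw [mem_ofPred_eq, hxb]
  exact Or.inl (by rw [Complex.ofReal_re]; positivity)

lemma ball_subset_closure_slitDisc {v b : ℂ} (hb : b ≠ 0) (r : ℝ) :
    Metric.ball v r ⊆ closure (slitDisc v b r) := by
  rw [slitDisc_eq hb]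
  have hopen : IsOpenMap fun q => (v - q) / b := by
    simp only [div_eq_mul_inv]
    exact ((Homeomorph.subLeft v).trans (Homeomorph.mulRight₀ b⁻¹ (inv_ne_zero hb))).isOpenMap
  exact (dense_slitPlane.preimage hopen).open_subset_closure_inter Metric.isOpen_ball

/-- Removing the second radius from the disc leaves a connected dense set. -/
lemma mem_interior_closure_of_two_radii {D : Set ℂ} {v a b : ℂ} {r : ℝ} (hr : 0 < r)
    (ha : ‖a‖ = 1) (hb : ‖b‖ = 1) (hab : a ≠ b)
    (hfr : ∀ q ∈ Metric.ball v r, q ∈ frontier D →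
      ∃ t : ℝ, 0 ≤ t ∧ (q = v + t * a ∨ q = v + t * b))
    (hint : ∀ t ∈ Ioo 0 r, v + (t : ℂ) * a ∈ interior (closure D)) :
    v ∈ interior (closure D) := by
  have hb0 : b ≠ 0 := norm_ne_zero_iff.1 (by simp [hb])
  have hdist (t : ℝ) : dist (v + t * a) v = |t| := by simp [dist_eq_norm, ha]
  have hmem : v + ((r / 2 : ℝ) : ℂ) * a ∈ slitDisc v b r := by
    refine ⟨by rw [Metric.mem_ball, hdist, abs_of_pos (half_pos hr)]; exact half_lt_self hr, ?_⟩
    rintro ⟨t, ht, h⟩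
    have h' := add_left_cancel h
    have hnorm := congrArg norm h'
    simp only [norm_mul, ha, hb, mul_one, Complex.norm_real, Real.norm_of_nonneg ht,
      Real.norm_of_nonneg (half_pos hr).le] at hnorm
    rw [← hnorm] at h'
    exact hab (mul_left_cancel₀ (Complex.ofReal_ne_zero.2 (half_pos hr).ne') h')
  have hsub : slitDisc v b r ⊆ interior (closure D) := by
    refine (isPreconnected_slitDisc hb0 hr).subset_of_closure_inter_subset isOpen_interior
      ⟨_, hmem, hint _ ⟨half_pos hr, half_lt_self hr⟩⟩ ?_
    rintro q ⟨hq, hqr, hqb⟩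
    have hqc : q ∈ closure D := closure_minimal interior_subset isClosed_closure hq
    by_cases hqi : q ∈ interior D
    · exact interior_mono subset_closure hqi
    obtain ⟨t, ht, rfl | h⟩ := hfr q hqr ⟨hqc, hqi⟩
    · have ht0 : t ≠ 0 := by rintro rfl; exact hqb ⟨0, le_rfl, by simp⟩
      rw [Metric.mem_ball, hdist, abs_of_nonneg ht] at hqr
      exact hint t ⟨ht.lt_of_ne' ht0, hqr⟩
    · exact absurd ⟨t, ht, h⟩ hqb
  exact mem_interior.2 ⟨_, (ball_subset_closure_slitDisc hb0 r).trans
    (closure_minimal (hsub.trans interior_subset) isClosed_closure), Metric.isOpen_ball,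
    Metric.mem_ball_self hr⟩

/-! ### The boundary of a polygonal domain -/

namespace PolygonalTable

variable {d : ℕ} (P : PolygonalTable d)

/-- Parameters of the interior points of the `i`-th side. -/
def openSide (i : Fin d) : Set ℝ := Ioo (P.corner i.castSucc) (P.corner i.succ)

/-- The arclength parametrization of the line that carries the `i`-th side. -/
def sidePoint (i : Fin d) (s : ℝ) : ℂ :=
  P.bdry (P.corner i.castSucc) + ((s - P.corner i.castSucc : ℝ) : ℂ) * P.dir i

/-- The complex coordinate of the plane in which the `i`-th side lies on the real axis and the
coordinate of its points is the arclength parameter. -/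
def frame (i : Fin d) (q : ℂ) : ℂ :=
  P.corner i.castSucc + (starRingEnd ℂ) (P.dir i) * (q - P.bdry (P.corner i.castSucc))

lemma conj_dir_mul_dir (i : Fin d) : (starRingEnd ℂ) (P.dir i) * P.dir i = 1 := by
  rw [Complex.conj_mul', P.norm_dir]
  norm_num

lemma corner_castSucc_lt_succ (i : Fin d) : P.corner i.castSucc < P.corner i.succ :=
  P.corner_strictMono Fin.castSucc_lt_succ

lemma corner_nonneg (k : Fin (d + 1)) : 0 ≤ P.corner k :=
  P.corner_zero.symm.trans_le (P.corner_strictMono.monotone (Fin.zero_le k))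

lemma corner_le_one (k : Fin (d + 1)) : P.corner k ≤ 1 :=
  (P.corner_strictMono.monotone (Fin.le_last k)).trans_eq P.corner_last

lemma corner_castSucc_mem (i : Fin d) : P.corner i.castSucc ∈ Ico (0 : ℝ) 1 :=
  ⟨P.corner_nonneg _, (P.corner_castSucc_lt_succ i).trans_le (P.corner_le_one _)⟩

lemma corner_succ_mem (i : Fin d) : P.corner i.succ ∈ Ioc (0 : ℝ) 1 :=
  ⟨(P.corner_nonneg _).trans_lt (P.corner_castSucc_lt_succ i), P.corner_le_one _⟩

lemma openSide_subset (i : Fin d) : P.openSide i ⊆ Ioo (0 : ℝ) 1 := fun _ hs =>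
  ⟨(P.corner_nonneg _).trans_lt hs.1, hs.2.trans_le (P.corner_le_one _)⟩

lemma openSide_subset_Ico (i : Fin d) : P.openSide i ⊆ Ico (0 : ℝ) 1 :=
  (P.openSide_subset i).trans Ioo_subset_Ico_self

lemma bdry_eq_sidePoint {i : Fin d} {s : ℝ}
    (hs : s ∈ Icc (P.corner i.castSucc) (P.corner i.succ)) : P.bdry s = P.sidePoint i s :=
  P.bdry_side i s hs

lemma bdry_eq_of_mem_openSide {i : Fin d} {s : ℝ} (hs : s ∈ P.openSide i) :
    P.bdry s = P.sidePoint i s :=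
  P.bdry_eq_sidePoint (Ioo_subset_Icc_self hs)

lemma exists_mem_Ico {s : ℝ} (hs : s ∈ Ico (0 : ℝ) 1) :
    ∃ i : Fin d, s ∈ Ico (P.corner i.castSucc) (P.corner i.succ) := by
  suffices key : ∀ k : Fin (d + 1), s < P.corner k →
      ∃ i : Fin d, s ∈ Ico (P.corner i.castSucc) (P.corner i.succ) from
    key (Fin.last d) (hs.2.trans_eq P.corner_last.symm)
  intro k
  induction k using Fin.induction with
  | zero => exact fun h => absurd hs.1 (h.trans_eq P.corner_zero).not_ge
  | succ i ih =>
    intro h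
    by_cases h' : s < P.corner i.castSucc
    · exact ih h'
    · exact ⟨i, not_lt.1 h', h⟩

lemma openSide_unique {i j : Fin d} {s : ℝ} (hi : s ∈ P.openSide i) (hj : s ∈ P.openSide j) :
    i = j := by
  by_contra hne
  rcases lt_or_gt_of_ne hne with h | h
  · have := P.corner_strictMono.monotone (Fin.succ_le_castSucc_iff.2 h)
    linarith [hi.2, hj.1]
  · have := P.corner_strictMono.monotone (Fin.succ_le_castSucc_iff.2 h)
    linarith [hj.2, hi.1]

lemma corner_notMem_openSide (k : Fin (d + 1)) (i : Fin d) : P.corner k ∉ P.openSide i := fun h =>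
  absurd (Fin.castSucc_lt_iff_succ_le.1 (P.corner_strictMono.lt_iff_lt.1 h.1))
    (P.corner_strictMono.lt_iff_lt.1 h.2).not_ge

lemma bdry_one : P.bdry 1 = P.bdry 0 := by
  simpa using P.bdry_periodic 0

lemma bdry_fract (s : ℝ) : P.bdry (Int.fract s) = P.bdry s := by
  simpa using P.bdry_periodic.sub_int_mul_eq ⌊s⌋ (x := s)

lemma neZero {d : ℕ} (P : PolygonalTable d) : NeZero d := by
  refine ⟨?_⟩
  rintro rfl
  exact zero_ne_one (P.corner_zero.symm.trans P.corner_last)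

lemma exists_eq_corner_of_mem_vertices {q : ℂ} (hq : q ∈ P.vertices) :
    ∃ k : Fin d, q = P.bdry (P.corner k.castSucc) := by
  obtain ⟨k, rfl⟩ := hq
  induction k using Fin.lastCases with
  | last =>
    have := P.neZero
    exact ⟨0, by simp only [P.corner_last, Fin.castSucc_zero', P.corner_zero, P.bdry_one]⟩
  | cast k => exact ⟨k, rfl⟩

lemma bdry_notMem_vertices {i : Fin d} {s : ℝ} (hs : s ∈ P.openSide i) :
    P.bdry s ∉ P.vertices := by
  intro h
  obtain ⟨k, hk⟩ := P.exists_eq_corner_of_mem_vertices h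
  have := P.bdry_injOn (P.openSide_subset_Ico i hs) (P.corner_castSucc_mem k) hk
  exact P.corner_notMem_openSide _ i (this ▸ hs)

lemma sidePoint_notMem_vertices {i : Fin d} {s : ℝ} (hs : s ∈ P.openSide i) :
    P.sidePoint i s ∉ P.vertices :=
  P.bdry_eq_of_mem_openSide hs ▸ P.bdry_notMem_vertices hs

lemma bdry_injOn_Ioc : InjOn P.bdry (Ioc 0 1) := by
  intro s hs t ht h
  have hinj {u v : ℝ} (hu : u ∈ Ioo (0 : ℝ) 1) (hv : v ∈ Ico (0 : ℝ) 1)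
      (huv : P.bdry u = P.bdry v) : u = v :=
    P.bdry_injOn (Ioo_subset_Ico_self hu) hv huv
  rcases hs.2.eq_or_lt with rfl | hs1 <;> rcases ht.2.eq_or_lt with rfl | ht1
  · rfl
  · exact absurd (hinj ⟨ht.1, ht1⟩ ⟨le_rfl, one_pos⟩ (h.symm.trans P.bdry_one)) ht.1.ne'
  · exact absurd (hinj ⟨hs.1, hs1⟩ ⟨le_rfl, one_pos⟩ (h.trans P.bdry_one)) hs.1.ne'
  · exact hinj ⟨hs.1, hs1⟩ ⟨ht.1.le, ht1⟩ h

lemma sidePoint_mem_frontier {i : Fin d} {s : ℝ}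
    (hs : s ∈ Icc (P.corner i.castSucc) (P.corner i.succ)) :
    P.sidePoint i s ∈ frontier P.domain := by
  rw [P.frontier_domain, ← P.bdry_eq_sidePoint hs]
  exact mem_range_self _

lemma mem_frontier_cases {q : ℂ} (hq : q ∈ frontier P.domain) :
    q ∈ P.vertices ∨ ∃ j, ∃ s ∈ P.openSide j, q = P.sidePoint j s := by
  rw [P.frontier_domain] at hq
  obtain ⟨s, rfl⟩ := hq
  rw [← P.bdry_fract]
  obtain ⟨i, hi⟩ := P.exists_mem_Ico ⟨Int.fract_nonneg s, Int.fract_lt_one s⟩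
  rcases hi.1.eq_or_lt with h | h
  · exact Or.inl (h ▸ mem_range_self i.castSucc)
  · exact Or.inr ⟨i, _, ⟨h, hi.2⟩, P.bdry_eq_of_mem_openSide ⟨h, hi.2⟩⟩

lemma vertices_subset_frontier : P.vertices ⊆ frontier P.domain := by
  rintro _ ⟨k, rfl⟩
  rw [P.frontier_domain]
  exact mem_range_self _

lemma finite_vertices : P.vertices.Finite := finite_range _

lemma notMem_domain_of_mem_frontier {q : ℂ} (hq : q ∈ frontier P.domain) : q ∉ P.domain :=
  fun h => (P.isOpen_domain.frontier_eq ▸ hq).2 h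

lemma sidePoint_unique {i j : Fin d} {s t : ℝ} (hs : s ∈ P.openSide i) (ht : t ∈ P.openSide j)
    (h : P.sidePoint i s = P.sidePoint j t) : i = j ∧ s = t := by
  rw [← P.bdry_eq_of_mem_openSide hs, ← P.bdry_eq_of_mem_openSide ht] at h
  have hst := P.bdry_injOn (P.openSide_subset_Ico i hs) (P.openSide_subset_Ico j ht) h
  exact ⟨P.openSide_unique hs (hst ▸ ht), hst⟩

lemma frame_sidePoint_add (i : Fin d) (s : ℝ) (w : ℂ) :
    P.frame i (P.sidePoint i s + w * P.dir i) = s + w := by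
  simp only [frame, sidePoint]
  push_cast
  linear_combination (((s : ℂ) - P.corner i.castSucc) + w) * P.conj_dir_mul_dir i

@[simp]
lemma frame_sidePoint (i : Fin d) (s : ℝ) : P.frame i (P.sidePoint i s) = s := by
  simpa using P.frame_sidePoint_add i s 0

lemma eq_sidePoint_add (i : Fin d) (s : ℝ) (q : ℂ) :
    q = P.sidePoint i s + (P.frame i q - s) * P.dir i := by
  simp only [frame, sidePoint]
  push_cast
  linear_combination (-(q - P.bdry (P.corner i.castSucc))) * P.conj_dir_mul_dir i

lemma eq_sidePoint_of_im_eq_zero {i : Fin d} {q : ℂ} (h : (P.frame i q).im = 0) :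
    q = P.sidePoint i (P.frame i q).re := by
  have hre : P.frame i q - ((P.frame i q).re : ℂ) = 0 := Complex.ext (by simp) (by simp [h])
  simpa [hre] using P.eq_sidePoint_add i (P.frame i q).re q

lemma norm_frame_sub (i : Fin d) (p q : ℂ) : ‖P.frame i p - P.frame i q‖ = ‖p - q‖ := by
  have : P.frame i p - P.frame i q = (starRingEnd ℂ) (P.dir i) * (p - q) := by
    simp only [frame]
    ring
  rw [this, norm_mul, RCLike.norm_conj, P.norm_dir, one_mul]

lemma continuous_sidePoint (i : Fin d) : Continuous (P.sidePoint i) := by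
  unfold sidePoint
  fun_prop

lemma continuous_frame (i : Fin d) : Continuous (P.frame i) := by
  unfold frame
  fun_prop

lemma convex_preimage_frame (i : Fin d) {S : Set ℂ} (hS : Convex ℝ S) :
    Convex ℝ (P.frame i ⁻¹' S) := by
  change Convex ℝ ((fun q => P.corner i.castSucc + (starRingEnd ℂ) (P.dir i) *
    (q - P.bdry (P.corner i.castSucc))) ⁻¹' S)
  simp only [sub_eq_add_neg]
  exact ((hS.translate_preimage_right _).linear_preimage
    (LinearMap.mulLeft ℝ ((starRingEnd ℂ) (P.dir i)))).translate_preimage_left _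

lemma isClosed_side (i : Fin d) : IsClosed (P.side i) := by
  have : P.side i = P.sidePoint i '' Icc (P.corner i.castSucc) (P.corner i.succ) :=
    image_congr fun s hs => P.bdry_eq_sidePoint hs
  rw [this]
  exact (isCompact_Icc.image (P.continuous_sidePoint i)).isClosed

lemma exists_mem_side {q : ℂ} (hq : q ∈ frontier P.domain) : ∃ i, q ∈ P.side i := by
  rw [P.frontier_domain] at hq
  obtain ⟨s, rfl⟩ := hq
  rw [← P.bdry_fract]
  obtain ⟨i, hi⟩ := P.exists_mem_Ico ⟨Int.fract_nonneg s, Int.fract_lt_one s⟩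
  exact ⟨i, _, Ico_subset_Icc_self hi, rfl⟩

lemma mem_side_cases {q : ℂ} {i : Fin d} (hq : q ∈ P.side i) :
    q = P.bdry (P.corner i.castSucc) ∨ q = P.bdry (P.corner i.succ) ∨
      ∃ s ∈ P.openSide i, q = P.sidePoint i s := by
  obtain ⟨s, hs, rfl⟩ := hq
  rcases hs.1.eq_or_lt with rfl | h
  · exact Or.inl rfl
  rcases hs.2.eq_or_lt with rfl | h'
  · exact Or.inr (Or.inl rfl)
  · exact Or.inr (Or.inr ⟨s, ⟨h, h'⟩, P.bdry_eq_sidePoint hs⟩)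

lemma eventually_mem_side_of_forall_mem_side {v : ℂ} {I : Set (Fin d)}
    (hv : ∀ k, v ∈ P.side k → k ∈ I) :
    ∀ᶠ q in 𝓝 v, q ∈ frontier P.domain → ∃ k ∈ I, q ∈ P.side k := by
  have hK : IsClosed (⋃ k ∈ Iᶜ, P.side k) :=
    (Set.toFinite _).isClosed_biUnion fun k _ => P.isClosed_side k
  have hvK : v ∈ (⋃ k ∈ Iᶜ, P.side k)ᶜ := by
    simpa using fun k => not_imp_not.2 (hv k)
  filter_upwards [hK.isOpen_compl.mem_nhds hvK] with q hq hqf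
  obtain ⟨k, hk⟩ := P.exists_mem_side hqf
  exact ⟨k, by_contra fun hkI => hq (mem_biUnion hkI hk), hk⟩

lemma eq_of_sidePoint_mem_side {i k : Fin d} {s : ℝ} (hs : s ∈ P.openSide i)
    (hk : P.sidePoint i s ∈ P.side k) : k = i := by
  rcases P.mem_side_cases hk with h | h | ⟨t, ht, h⟩
  · exact absurd (h ▸ mem_range_self _) (P.sidePoint_notMem_vertices hs)
  · exact absurd (h ▸ mem_range_self _) (P.sidePoint_notMem_vertices hs)
  · exact (P.sidePoint_unique hs ht h).1.symm

lemma exists_ball_mem_frontier_iff {i : Fin d} {s : ℝ} (hs : s ∈ P.openSide i) :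
    ∃ r > 0, ∀ q ∈ Metric.ball (P.sidePoint i s) r,
      (q ∈ frontier P.domain ↔ (P.frame i q).im = 0) := by
  have hside := P.eventually_mem_side_of_forall_mem_side (I := {i})
    fun k hk => P.eq_of_sidePoint_mem_side hs hk
  have hre : ∀ᶠ q in 𝓝 (P.sidePoint i s), (P.frame i q).re ∈ P.openSide i :=
    (Complex.continuous_re.comp (P.continuous_frame i)).continuousAt.eventually_mem
      (isOpen_Ioo.mem_nhds (by simpa using! hs))
  obtain ⟨r, hr, h⟩ := Metric.eventually_nhds_iff_ball.1 (hside.and hre)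
  refine ⟨r, hr, fun q hq => ⟨fun hqf => ?_, fun him => ?_⟩⟩
  · obtain ⟨k, rfl, t, ht, rfl⟩ := (h q hq).1 hqf
    rw [P.bdry_eq_sidePoint ht, frame_sidePoint, Complex.ofReal_im]
  · rw [P.eq_sidePoint_of_im_eq_zero him]
    exact P.sidePoint_mem_frontier (Ioo_subset_Icc_self (h q hq).2)

lemma subset_domain_of_isPreconnected {S : Set ℂ} (hS : IsPreconnected S)
    (hd : ∀ q ∈ S, q ∉ frontier P.domain) {q : ℂ} (hq : q ∈ S) (hq' : q ∈ P.domain) :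
    S ⊆ P.domain :=
  subset_of_isPreconnected_of_disjoint_frontier P.isOpen_domain hS (disjoint_left.2 hd)
    ⟨q, hq, hq'⟩

lemma sidePoint_mem_closure_im_neg (i : Fin d) (s : ℝ) :
    P.sidePoint i s ∈ closure {q | (P.frame i q).im < 0} := by
  have hcont : Continuous fun t : ℝ => P.sidePoint i s + (-t * Complex.I) * P.dir i := by fun_prop
  have hlim := (hcont.tendsto' 0 (P.sidePoint i s) (by simp)).mono_left
    (nhdsWithin_le_nhds (s := Ioi 0))
  refine mem_closure_of_tendsto hlim ?_
  filter_upwards [self_mem_nhdsWithin] with t ht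
  rw [P.frame_sidePoint_add]
  simpa using ht

lemma exists_ball_left_subset_domain {i : Fin d} {s : ℝ} (hs : s ∈ P.openSide i) :
    ∃ r > 0, (∀ q ∈ Metric.ball (P.sidePoint i s) r,
        (q ∈ frontier P.domain ↔ (P.frame i q).im = 0)) ∧
      ∀ q ∈ Metric.ball (P.sidePoint i s) r, 0 < (P.frame i q).im → q ∈ P.domain := by
  obtain ⟨r, hr, hfr⟩ := P.exists_ball_mem_frontier_iff hs
  refine ⟨r, hr, hfr, fun q hq him => ?_⟩
  obtain ⟨t, htd, ht0, htr⟩ := ((P.left_mem i s hs).and (Ioo_mem_nhdsGT hr)).exists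
  rw [P.bdry_eq_of_mem_openSide hs, ← mul_assoc] at htd
  refine P.subset_domain_of_isPreconnected ((convex_ball (P.sidePoint i s) r).inter
    (P.convex_preimage_frame i (convex_halfSpace_im_gt 0))).isPreconnected
    (fun p hp => (hfr p hp.1).not.2 (ne_of_gt hp.2)) ⟨?_, ?_⟩ htd ⟨hq, him⟩
  · simpa [P.norm_dir, abs_of_pos ht0] using htr
  · simpa [P.frame_sidePoint_add] using ht0

/-- The right half of a small disc centered on a side does not meet the boundary, so it lies either
inside or outside the domain. -/
lemma exists_ball_left_or_subset_closure {i : Fin d} {s : ℝ} (hs : s ∈ P.openSide i) :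
    ∃ r > 0, (∀ q ∈ Metric.ball (P.sidePoint i s) r, (q ∈ P.domain ↔ 0 < (P.frame i q).im)) ∨
      Metric.ball (P.sidePoint i s) r ⊆ closure P.domain := by
  obtain ⟨r, hr, hfr, hleft⟩ := P.exists_ball_left_subset_domain hs
  refine ⟨r, hr, or_iff_not_imp_left.2 fun hnot q hq => ?_⟩
  push Not at hnot
  obtain ⟨p, hp, ⟨hpd, him⟩ | ⟨hpd, him⟩⟩ := hnot
  · have hp0 : (P.frame i p).im < 0 := him.lt_of_ne fun h =>
      P.notMem_domain_of_mem_frontier ((hfr p hp).2 h) hpd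
    have hright := P.subset_domain_of_isPreconnected ((convex_ball (P.sidePoint i s) r).inter
      (P.convex_preimage_frame i (convex_halfSpace_im_lt 0))).isPreconnected
      (fun q hq => (hfr q hq.1).not.2 (ne_of_lt hq.2)) ⟨hp, hp0⟩ hpd
    rcases lt_trichotomy (P.frame i q).im 0 with h | h | h
    · exact subset_closure (hright ⟨hq, h⟩)
    · exact frontier_subset_closure ((hfr q hq).2 h)
    · exact subset_closure (hleft q hq h)
  · exact absurd (hleft p hp him) hpd

lemma sidePoint_notMem_interior_closure {i : Fin d} {p : ℂ} {r t : ℝ}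
    (hball : ∀ q ∈ Metric.ball p r, (q ∈ P.domain ↔ 0 < (P.frame i q).im))
    (ht : P.sidePoint i t ∈ Metric.ball p r) :
    P.sidePoint i t ∉ interior (closure P.domain) := by
  intro hint
  obtain ⟨q, ⟨hqr, hqi⟩, hq⟩ := mem_closure_iff.1 (P.sidePoint_mem_closure_im_neg i t) _
    (Metric.isOpen_ball.inter isOpen_interior) ⟨ht, hint⟩
  have hright : IsOpen {q | (P.frame i q).im < 0} :=
    isOpen_lt (Complex.continuous_im.comp (P.continuous_frame i)) continuous_const
  obtain ⟨q', ⟨hq'r, hq'⟩, hq'd⟩ := mem_closure_iff.1 (interior_subset hqi) _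
    (Metric.isOpen_ball.inter hright) ⟨hqr, hq⟩
  exact lt_asymm ((hball q' hq'r).1 hq'd) hq'

/-- The closure of the domain is a neighborhood of the interior points of the `i`-th side; this is
what has to be excluded in order to know that the domain lies only on the left of the side. -/
def TwoSided (i : Fin d) : Prop :=
  ∀ s ∈ P.openSide i, P.sidePoint i s ∈ interior (closure P.domain)

lemma twoSided_of_mem {i : Fin d} {s : ℝ} (hs : s ∈ P.openSide i)
    (h : P.sidePoint i s ∈ interior (closure P.domain)) : P.TwoSided i := by
  refine isPreconnected_Ioo.subset_of_closure_inter_subset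
    (isOpen_interior.preimage (P.continuous_sidePoint i)) ⟨s, hs, h⟩ ?_
  rintro t ⟨htc, ht⟩
  obtain ⟨r, hr, hleft | hsub⟩ := P.exists_ball_left_or_subset_closure ht
  · obtain ⟨t', ht'r, ht'⟩ := mem_closure_iff.1 htc _
      (Metric.isOpen_ball.preimage (P.continuous_sidePoint i)) (Metric.mem_ball_self hr)
    exact absurd ht' (P.sidePoint_notMem_interior_closure hleft ht'r)
  · exact mem_interior.2 ⟨_, hsub, Metric.isOpen_ball, Metric.mem_ball_self hr⟩

lemma exists_prev (j : Fin d) :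
    ∃ i : Fin d, P.bdry (P.corner i.succ) = P.bdry (P.corner j.castSucc) := by
  obtain ⟨_ | j, hj⟩ := j
  · refine ⟨⟨d - 1, by omega⟩, ?_⟩
    have hlast : (Fin.succ ⟨d - 1, by omega⟩ : Fin (d + 1)) = Fin.last d :=
      Fin.ext (Nat.sub_add_cancel hj)
    have hzero : (Fin.castSucc ⟨0, hj⟩ : Fin (d + 1)) = 0 := rfl
    rw [hlast, hzero, P.corner_last, P.corner_zero, P.bdry_one]
  · exact ⟨⟨j, by omega⟩, rfl⟩

lemma sidePoint_succ_sub (i : Fin d) (t : ℝ) :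
    P.sidePoint i (P.corner i.succ - t) = P.bdry (P.corner i.succ) + t * -P.dir i := by
  rw [P.bdry_eq_sidePoint ⟨(P.corner_castSucc_lt_succ i).le, le_rfl⟩]
  simp only [sidePoint]
  push_cast
  ring

lemma sidePoint_castSucc_add (i : Fin d) (t : ℝ) :
    P.sidePoint i (P.corner i.castSucc + t) = P.bdry (P.corner i.castSucc) + t * P.dir i := by
  simp only [sidePoint]
  push_cast
  ring

lemma eq_or_eq_of_corner_mem_side {i j k : Fin d}
    (h : P.bdry (P.corner i.succ) = P.bdry (P.corner j.castSucc))
    (hk : P.bdry (P.corner i.succ) ∈ P.side k) : k = i ∨ k = j := by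
  rcases P.mem_side_cases hk with hv | hv | ⟨s, hs, hv⟩
  · have := P.bdry_injOn (P.corner_castSucc_mem _) (P.corner_castSucc_mem _) (h.symm.trans hv)
    exact Or.inr (Fin.castSucc_injective _ (P.corner_strictMono.injective this)).symm
  · have := P.bdry_injOn_Ioc (P.corner_succ_mem _) (P.corner_succ_mem _) hv
    exact Or.inl (Fin.succ_injective _ (P.corner_strictMono.injective this)).symm
  · exact absurd (hv ▸ mem_range_self _) (P.sidePoint_notMem_vertices hs)

section Corner

variable {i j : Fin d}

lemma exists_ball_frontier_corner
    (h : P.bdry (P.corner i.succ) = P.bdry (P.corner j.castSucc)) :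
    ∃ r > 0, r ≤ P.corner i.succ - P.corner i.castSucc ∧
      r ≤ P.corner j.succ - P.corner j.castSucc ∧
      ∀ q ∈ Metric.ball (P.bdry (P.corner i.succ)) r, q ∈ frontier P.domain →
        ∃ t : ℝ, 0 ≤ t ∧ (q = P.bdry (P.corner i.succ) + t * -P.dir i ∨
          q = P.bdry (P.corner i.succ) + t * P.dir j) := by
  obtain ⟨r, hr, hball⟩ := Metric.eventually_nhds_iff_ball.1
    (P.eventually_mem_side_of_forall_mem_side (I := {i, j})
      fun k hk => P.eq_or_eq_of_corner_mem_side h hk)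
  have hi := sub_pos.2 (P.corner_castSucc_lt_succ i)
  have hj := sub_pos.2 (P.corner_castSucc_lt_succ j)
  refine ⟨_, lt_min hr (lt_min hi hj), (min_le_right _ _).trans (min_le_left _ _),
    (min_le_right _ _).trans (min_le_right _ _), fun q hq hqf => ?_⟩
  obtain ⟨k, hk, s, hs, rfl⟩ := hball q (Metric.ball_subset_ball (min_le_left _ _) hq) hqf
  rw [P.bdry_eq_sidePoint hs]
  rcases hk with rfl | rfl
  · refine ⟨P.corner k.succ - s, sub_nonneg.2 hs.2, Or.inl ?_⟩
    rw [← sidePoint_succ_sub, sub_sub_cancel]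
  · refine ⟨s - P.corner k.castSucc, sub_nonneg.2 hs.1, Or.inr ?_⟩
    rw [h, ← sidePoint_castSucc_add, add_sub_cancel]

lemma neg_dir_ne_dir (h : P.bdry (P.corner i.succ) = P.bdry (P.corner j.castSucc)) :
    -P.dir i ≠ P.dir j := by
  intro hd
  obtain ⟨r, hr, hri, hrj, -⟩ := P.exists_ball_frontier_corner h
  have hparam (t : ℝ) (ht : t ∈ Ioo 0 r) : P.corner i.succ - t = P.corner j.castSucc + t := by
    refine (P.sidePoint_unique (i := i) (j := j) ⟨by linarith [ht.2], by linarith [ht.1]⟩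
      ⟨by linarith [ht.1], by linarith [ht.2]⟩ ?_).2
    rw [sidePoint_succ_sub, sidePoint_castSucc_add, h, hd]
  linarith [hparam (r / 2) ⟨by linarith, by linarith⟩, hparam (r / 3) ⟨by linarith, by linarith⟩]

lemma corner_mem_interior_closure_of_twoSided
    (h : P.bdry (P.corner i.succ) = P.bdry (P.corner j.castSucc))
    (hij : P.TwoSided i ∨ P.TwoSided j) :
    P.bdry (P.corner i.succ) ∈ interior (closure P.domain) := by
  obtain ⟨r, hr, hri, hrj, hfr⟩ := P.exists_ball_frontier_corner h
  have hni : ‖-P.dir i‖ = 1 := by rw [norm_neg, P.norm_dir]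
  rcases hij with hT | hT
  · refine mem_interior_closure_of_two_radii hr hni (P.norm_dir j) (P.neg_dir_ne_dir h) hfr
      fun t ht => ?_
    rw [← sidePoint_succ_sub]
    exact hT _ ⟨by linarith [ht.2], by linarith [ht.1]⟩
  · refine mem_interior_closure_of_two_radii hr (P.norm_dir j) hni (P.neg_dir_ne_dir h).symm
      (fun q hq hqf => (hfr q hq hqf).imp fun t ht => ht.imp_right Or.symm) fun t ht => ?_
    rw [h, ← sidePoint_castSucc_add]
    exact hT _ ⟨by linarith [ht.1], by linarith [ht.2]⟩

lemma twoSided_iff_of_adjacent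
    (h : P.bdry (P.corner i.succ) = P.bdry (P.corner j.castSucc)) :
    P.TwoSided i ↔ P.TwoSided j := by
  obtain ⟨r, hr, hri, hrj, -⟩ := P.exists_ball_frontier_corner h
  have hnear (w : ℂ) (hv : P.bdry (P.corner i.succ) ∈ interior (closure P.domain)) :
      ∃ t ∈ Ioo 0 r, P.bdry (P.corner i.succ) + (t : ℂ) * w ∈ interior (closure P.domain) := by
    have hcont : Continuous fun t : ℝ => P.bdry (P.corner i.succ) + (t : ℂ) * w := by fun_prop
    have hev := ((hcont.tendsto' 0 _ (by simp)).eventually_mem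
      (isOpen_interior.mem_nhds hv)).filter_mono (nhdsWithin_le_nhds (s := Ioi 0))
    exact (Filter.Eventually.and (Ioo_mem_nhdsGT hr) hev).exists
  constructor <;> intro hT
  · obtain ⟨t, ht, hmem⟩ := hnear (P.dir j) (P.corner_mem_interior_closure_of_twoSided h (.inl hT))
    rw [h, ← sidePoint_castSucc_add] at hmem
    exact P.twoSided_of_mem ⟨by linarith [ht.1], by linarith [ht.2]⟩ hmem
  · obtain ⟨t, ht, hmem⟩ := hnear (-P.dir i) (P.corner_mem_interior_closure_of_twoSided h (.inr hT))
    rw [← sidePoint_succ_sub] at hmem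
    exact P.twoSided_of_mem ⟨by linarith [ht.2], by linarith [ht.1]⟩ hmem

end Corner

lemma twoSided_iff (i j : Fin d) : P.TwoSided i ↔ P.TwoSided j := by
  have := P.neZero
  suffices key : ∀ n (hn : n < d), P.TwoSided ⟨n, hn⟩ ↔ P.TwoSided 0 from
    (key i i.2).trans (key j j.2).symm
  intro n
  induction n with
  | zero => exact fun _ => Iff.rfl
  | succ n ih => exact fun hn => (P.twoSided_iff_of_adjacent rfl).symm.trans (ih (by omega))

/-- Otherwise the closure of the domain would be open, hence the whole plane. -/
lemma not_twoSided (i : Fin d) : ¬ P.TwoSided i := by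
  intro hT
  have hall (j : Fin d) : P.TwoSided j := (P.twoSided_iff i j).1 hT
  have hfr : frontier P.domain ⊆ interior (closure P.domain) := by
    intro q hq
    rcases P.mem_frontier_cases hq with hv | ⟨j, s, hs, rfl⟩
    · obtain ⟨k, rfl⟩ := P.exists_eq_corner_of_mem_vertices hv
      obtain ⟨l, hl⟩ := P.exists_prev k
      exact hl ▸ P.corner_mem_interior_closure_of_twoSided hl (Or.inl (hall l))
    · exact hall j s hs
  have hopen : IsOpen (closure P.domain) := by
    rw [← subset_interior_iff_isOpen]
    calc closure P.domain = P.domain ∪ frontier P.domain := closure_eq_self_union_frontier _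
      _ ⊆ interior (closure P.domain) :=
        union_subset (interior_maximal subset_closure P.isOpen_domain) hfr
  have huniv : closure P.domain = univ :=
    IsClopen.eq_univ ⟨isClosed_closure, hopen⟩ P.isConnected_domain.nonempty.closure
  exact NormedSpace.unbounded_univ ℝ ℂ (huniv ▸ P.isBounded_domain.closure)

lemma exists_ball_mem_domain_iff {i : Fin d} {s : ℝ} (hs : s ∈ P.openSide i) :
    ∃ r > 0, ∀ q ∈ Metric.ball (P.sidePoint i s) r, (q ∈ P.domain ↔ 0 < (P.frame i q).im) := by
  obtain ⟨r, hr, hleft | hsub⟩ := P.exists_ball_left_or_subset_closure hs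
  · exact ⟨r, hr, hleft⟩
  · exact absurd (P.twoSided_of_mem hs
      (mem_interior.2 ⟨_, hsub, Metric.isOpen_ball, Metric.mem_ball_self hr⟩)) (P.not_twoSided i)

end PolygonalTable

/-! ### Free flights -/

lemma exists_first_exit {X : Type*} [TopologicalSpace X] {D : Set X} (hD : IsOpen D) {γ : ℝ → X}
    (hγ : Continuous γ) {r : ℝ} (hr : 0 < r) (hstart : ∀ t ∈ Ioo 0 r, γ t ∈ D)
    (hexit : ∃ t > 0, γ t ∉ D) :
    ∃ t > 0, γ t ∈ frontier D ∧ ∀ t' ∈ Ioo 0 t, γ t' ∈ D := by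
  obtain ⟨T, hT0, hT⟩ := hexit
  have hle {t : ℝ} (ht0 : 0 < t) (ht : γ t ∉ D) : r ≤ t :=
    not_lt.1 fun h => ht (hstart t ⟨ht0, h⟩)
  have hclosed : IsClosed (Ici r ∩ γ ⁻¹' Dᶜ) := isClosed_Ici.inter (hD.isClosed_compl.preimage hγ)
  have hbdd : BddBelow (Ici r ∩ γ ⁻¹' Dᶜ) := ⟨r, fun t ht => ht.1⟩
  obtain ⟨hrS, hS⟩ := hclosed.csInf_mem ⟨T, hle hT0 hT, hT⟩ hbdd
  set t₀ := sInf (Ici r ∩ γ ⁻¹' Dᶜ)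
  have ht₀ : 0 < t₀ := hr.trans_le hrS
  have hbefore : ∀ t' ∈ Ioo 0 t₀, γ t' ∈ D := fun t' ht' => by_contra fun h =>
    ht'.2.not_ge (csInf_le hbdd ⟨hle ht'.1 h, h⟩)
  refine ⟨t₀, ht₀, ?_, hbefore⟩
  rw [hD.frontier_eq]
  refine ⟨mem_closure_of_tendsto (hγ.continuousWithinAt (s := Iio t₀)) ?_, hS⟩
  filter_upwards [Ioo_mem_nhdsLT ht₀] with t' ht' using hbefore t' ht'

namespace PolygonalTable

variable {d : ℕ} (P : PolygonalTable d)

/-- The ray that leaves the point of parameter `s` of the `i`-th side at the angle `θ`. -/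
def ray (i : Fin d) (s θ t : ℝ) : ℂ :=
  P.sidePoint i s + (t * (Real.sin θ + Real.cos θ * Complex.I)) * P.dir i

/-- The direction of the `j`-th side in the frame of the `i`-th one. -/
def relDir (i j : Fin d) : ℂ := (starRingEnd ℂ) (P.dir i) * P.dir j

/-- The position of the `j`-th side in the frame of the `i`-th one. -/
def relBase (i j : Fin d) : ℂ := P.frame i (P.sidePoint j 0)

/-- The free flight from the point of parameter `s` of the `i`-th side at the angle `θ` reaches the
point `q`. -/
def FliesTo (i : Fin d) (s θ : ℝ) (q : ℂ) : Prop :=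
  ∃ t > 0, P.ray i s θ t = q ∧ ∀ t' ∈ Ioo 0 t, P.ray i s θ t' ∈ P.domain

/-- The vector of base parameter `s` and angle `θ` on the `i`-th side hits the interior of the
`j`-th side at the parameter `s'`. -/
structure HitsSide (i : Fin d) (s θ : ℝ) (j : Fin d) (s' : ℝ) : Prop where
  base_mem : s ∈ P.openSide i
  angle_mem : θ ∈ Ioo (-(π / 2)) (π / 2)
  hit_mem : s' ∈ P.openSide j
  fliesTo : P.FliesTo i s θ (P.sidePoint j s')

/-- The vector of base parameter `s` and angle `θ` on the `i`-th side hits the vertex `w`. -/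
structure HitsVertex (i : Fin d) (s θ : ℝ) (w : ℂ) : Prop where
  vertex_mem : w ∈ P.vertices
  fliesTo : P.FliesTo i s θ w

/-- The specular angle after a collision with the `j`-th side. -/
def outAngle (i j : Fin d) (θ : ℝ) : ℝ :=
  Real.arcsin ((P.relDir i j).re * Real.sin θ + (P.relDir i j).im * Real.cos θ)

/-- The rate at which the base of a ray of angle `θ` leaving side `i` moves when the point where it
meets side `j` moves at unit speed. It is negative when the ray arrives from the left of side `j`,
where the domain lies. -/
def slope (i j : Fin d) (θ : ℝ) : ℝ :=
  (P.relDir i j).re - (P.relDir i j).im * Real.tan θ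

/-- The parameter of the point where the ray from `(s, θ)` on side `i` meets the line through
side `j`. -/
def hitCoord (i j : Fin d) (s θ : ℝ) : ℝ :=
  (s - (P.relBase i j).re + (P.relBase i j).im * Real.tan θ) / P.slope i j θ

lemma frame_ray (i : Fin d) (s θ t : ℝ) :
    P.frame i (P.ray i s θ t) = s + t * (Real.sin θ + Real.cos θ * Complex.I) :=
  P.frame_sidePoint_add i s _

lemma frame_ray_re (i : Fin d) (s θ t : ℝ) :
    (P.frame i (P.ray i s θ t)).re = s + t * Real.sin θ := by
  rw [frame_ray]
  simp [-Complex.ofReal_sin, -Complex.ofReal_cos]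

lemma frame_ray_im (i : Fin d) (s θ t : ℝ) :
    (P.frame i (P.ray i s θ t)).im = t * Real.cos θ := by
  rw [frame_ray]
  simp [-Complex.ofReal_sin, -Complex.ofReal_cos]

lemma frame_sidePoint_eq_relBase_add (i j : Fin d) (s : ℝ) :
    P.frame i (P.sidePoint j s) = P.relBase i j + s * P.relDir i j := by
  simp only [frame, sidePoint, relBase, relDir]
  push_cast
  ring

lemma frame_sidePoint_re (i j : Fin d) (s : ℝ) :
    (P.frame i (P.sidePoint j s)).re = (P.relBase i j).re + s * (P.relDir i j).re := by
  rw [frame_sidePoint_eq_relBase_add]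
  simp

lemma frame_sidePoint_im (i j : Fin d) (s : ℝ) :
    (P.frame i (P.sidePoint j s)).im = (P.relBase i j).im + s * (P.relDir i j).im := by
  rw [frame_sidePoint_eq_relBase_add]
  simp

lemma frame_injective (i : Fin d) : Function.Injective (P.frame i) := by
  intro p q h
  rw [P.eq_sidePoint_add i 0 p, P.eq_sidePoint_add i 0 q, h]

lemma norm_relDir (i j : Fin d) : ‖P.relDir i j‖ = 1 := by
  rw [relDir, norm_mul, RCLike.norm_conj, P.norm_dir, P.norm_dir, one_mul]

lemma relDir_sq (i j : Fin d) : (P.relDir i j).re ^ 2 + (P.relDir i j).im ^ 2 = 1 := by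
  have h := Complex.normSq_eq_norm_sq (P.relDir i j)
  rw [P.norm_relDir, Complex.normSq_apply] at h
  linarith

lemma relDir_symm (i j : Fin d) : P.relDir j i = (starRingEnd ℂ) (P.relDir i j) := by
  simp [relDir, mul_comm]

lemma continuous_ray (i : Fin d) : Continuous fun x : ℝ × ℝ × ℝ => P.ray i x.1 x.2.1 x.2.2 := by
  unfold ray sidePoint
  fun_prop

lemma norm_sin_add_cos_mul_I (θ : ℝ) : ‖(Real.sin θ + Real.cos θ * Complex.I : ℂ)‖ = 1 := by
  rw [Complex.norm_add_mul_I, Real.sin_sq_add_cos_sq, Real.sqrt_one]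

lemma norm_ray_sub_ray (i : Fin d) (s θ t t' : ℝ) :
    ‖P.ray i s θ t - P.ray i s θ t'‖ = |t - t'| := by
  have h : P.ray i s θ t - P.ray i s θ t' =
      (t - t' : ℝ) * (Real.sin θ + Real.cos θ * Complex.I) * P.dir i := by
    simp only [ray]
    push_cast
    ring
  rw [h, norm_mul, norm_mul, norm_sin_add_cos_mul_I, P.norm_dir, Complex.norm_real, mul_one,
    mul_one, Real.norm_eq_abs]

@[simp]
lemma ray_zero (i : Fin d) (s θ : ℝ) : P.ray i s θ 0 = P.sidePoint i s := by
  simp [ray]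

lemma norm_ray_sub (i : Fin d) (s θ t : ℝ) : ‖P.ray i s θ t - P.sidePoint i s‖ = |t| := by
  simpa using P.norm_ray_sub_ray i s θ t 0

lemma norm_sidePoint_sub (i : Fin d) (s s' : ℝ) :
    ‖P.sidePoint i s' - P.sidePoint i s‖ = |s' - s| := by
  rw [← P.norm_frame_sub i, frame_sidePoint, frame_sidePoint, ← Complex.ofReal_sub,
    Complex.norm_real, Real.norm_eq_abs]

lemma ray_eq_of_hit {i j : Fin d} {s θ T σ : ℝ} (h : P.ray i s θ T = P.sidePoint j σ) (t : ℝ) :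
    P.ray i s θ t = P.sidePoint j σ +
      (-(T - t) * (Real.sin θ + Real.cos θ * Complex.I) * P.relDir j i) * P.dir j := by
  have hi : P.relDir j i * P.dir j = P.dir i := by
    rw [relDir, mul_comm (starRingEnd ℂ _), mul_assoc, P.conj_dir_mul_dir, mul_one]
  rw [← h, ray, ray, mul_assoc _ _ (P.dir j), hi]
  push_cast
  ring

lemma frame_ray_im_of_hit {i j : Fin d} {s θ T σ : ℝ} (h : P.ray i s θ T = P.sidePoint j σ)
    (t : ℝ) : (P.frame j (P.ray i s θ t)).im =
      (T - t) * -((P.relDir i j).re * Real.cos θ - (P.relDir i j).im * Real.sin θ) := by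
  rw [P.ray_eq_of_hit h t, P.frame_sidePoint_add, relDir_symm]
  simp [-Complex.ofReal_sin, -Complex.ofReal_cos]
  ring

lemma exists_ray_mem_domain {i : Fin d} {s : ℝ} (hs : s ∈ P.openSide i) :
    ∃ r > 0, ∀ s', |s' - s| < r → ∀ θ ∈ Ioo (-(π / 2)) (π / 2), ∀ t ∈ Ioo 0 r,
      P.ray i s' θ t ∈ P.domain := by
  obtain ⟨r, hr, hball⟩ := P.exists_ball_mem_domain_iff hs
  refine ⟨r / 2, half_pos hr, fun s' hs' θ hθ t ht => (hball _ ?_).2 ?_⟩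
  · rw [mem_ball_iff_norm]
    calc ‖P.ray i s' θ t - P.sidePoint i s‖
        ≤ ‖P.ray i s' θ t - P.sidePoint i s'‖ + ‖P.sidePoint i s' - P.sidePoint i s‖ :=
          norm_sub_le_norm_sub_add_norm_sub _ _ _
      _ < r / 2 + r / 2 := by
          rw [norm_ray_sub, abs_of_pos ht.1, norm_sidePoint_sub]
          exact add_lt_add ht.2 hs'
      _ = r := add_halves r
  · rw [frame_ray_im]
    exact mul_pos ht.1 (Real.cos_pos_of_mem_Ioo hθ)

lemma exists_ray_notMem_domain (i : Fin d) (s θ : ℝ) : ∃ t > 0, P.ray i s θ t ∉ P.domain := by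
  obtain ⟨R, hR0, hR⟩ := P.isBounded_domain.exists_pos_norm_le
  refine ⟨R + ‖P.sidePoint i s‖ + 1, by positivity, fun hmem => ?_⟩
  have hdist := P.norm_ray_sub i s θ (R + ‖P.sidePoint i s‖ + 1)
  rw [abs_of_nonneg (by positivity)] at hdist
  linarith [hR _ hmem, norm_sub_le (P.ray i s θ (R + ‖P.sidePoint i s‖ + 1)) (P.sidePoint i s)]

lemma exists_first_hit {i : Fin d} {s θ : ℝ} (hs : s ∈ P.openSide i)
    (hθ : θ ∈ Ioo (-(π / 2)) (π / 2)) : ∃ q ∈ frontier P.domain, P.FliesTo i s θ q := by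
  obtain ⟨r, hr, hstart⟩ := P.exists_ray_mem_domain hs
  have hcont : Continuous (P.ray i s θ) :=
    (P.continuous_ray i).comp (by fun_prop : Continuous fun t : ℝ => (s, θ, t))
  obtain ⟨t, ht, hf, hd⟩ := exists_first_exit P.isOpen_domain hcont hr
    (hstart s (by simpa using hr) θ hθ) (P.exists_ray_notMem_domain i s θ)
  exact ⟨_, hf, t, ht, rfl, hd⟩

lemma hitsSide_or_hitsVertex {i : Fin d} {s θ : ℝ} (hs : s ∈ P.openSide i)
    (hθ : θ ∈ Ioo (-(π / 2)) (π / 2)) :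
    (∃ j s', P.HitsSide i s θ j s') ∨ ∃ w, P.HitsVertex i s θ w := by
  obtain ⟨q, hq, hfly⟩ := P.exists_first_hit hs hθ
  rcases P.mem_frontier_cases hq with h | ⟨j, s', hs', rfl⟩
  · exact Or.inr ⟨q, h, hfly⟩
  · exact Or.inl ⟨j, s', hs, hθ, hs', hfly⟩

lemma hasDerivAt_bdry {i : Fin d} {s : ℝ} (hs : s ∈ P.openSide i) :
    HasDerivAt P.bdry (P.dir i) s := by
  have h : HasDerivAt (P.sidePoint i) (P.dir i) s := by
    unfold sidePoint
    have h1 : HasDerivAt (fun s : ℝ => ((s - P.corner i.castSucc : ℝ) : ℂ)) 1 s :=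
      ((hasDerivAt_id s).sub_const _).ofReal_comp
    simpa using (h1.mul_const (P.dir i)).const_add (P.bdry (P.corner i.castSucc))
  refine h.congr_of_eventuallyEq ?_
  filter_upwards [isOpen_Ioo.mem_nhds hs] with x hx
  exact P.bdry_eq_of_mem_openSide hx

lemma deriv_bdry {i : Fin d} {s : ℝ} (hs : s ∈ P.openSide i) : deriv P.bdry s = P.dir i :=
  (P.hasDerivAt_bdry hs).deriv

lemma bdry_add_velocity {i : Fin d} {s : ℝ} (hs : s ∈ P.openSide i) (θ t : ℝ) :
    P.bdry s + t * P.velocity (s, θ) = P.ray i s θ t := by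
  simp only [velocity, P.deriv_bdry hs, P.bdry_eq_of_mem_openSide hs, ray]
  ring

variable {P}

lemma FliesTo.hitPoint_eq {i : Fin d} {s θ : ℝ} {q : ℂ} (h : P.FliesTo i s θ q)
    (hs : s ∈ P.openSide i) (hq : q ∈ frontier P.domain) : P.hitPoint (s, θ) = q := by
  obtain ⟨t, ht, rfl, hd⟩ := h
  have hT : P.flightTime (s, θ) = t := by
    refine IsLeast.csInf_eq ⟨⟨ht, (P.bdry_add_velocity hs θ t).symm ▸ hq⟩, ?_⟩
    rintro t' ⟨ht'0, ht'⟩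
    rw [P.bdry_add_velocity hs] at ht'
    by_contra hlt
    exact P.notMem_domain_of_mem_frontier ht' (hd t' ⟨ht'0, not_le.1 hlt⟩)
  rw [hitPoint, hT, P.bdry_add_velocity hs]

lemma HitsVertex.hitPoint_eq {i : Fin d} {s θ : ℝ} {w : ℂ} (h : P.HitsVertex i s θ w)
    (hs : s ∈ P.openSide i) : P.hitPoint (s, θ) = w :=
  h.fliesTo.hitPoint_eq hs (P.vertices_subset_frontier h.vertex_mem)

lemma HitsSide.hitPoint_eq {i j : Fin d} {s θ s' : ℝ} (h : P.HitsSide i s θ j s') :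
    P.hitPoint (s, θ) = P.sidePoint j s' :=
  h.fliesTo.hitPoint_eq h.base_mem (P.sidePoint_mem_frontier (Ioo_subset_Icc_self h.hit_mem))

lemma HitsVertex.mem_singularSet {i : Fin d} {s θ : ℝ} {w : ℂ} (h : P.HitsVertex i s θ w)
    (hs : s ∈ P.openSide i) (hθ : θ ∈ Ioo (-(π / 2)) (π / 2)) :
    (s, θ) ∈ P.singularSet :=
  Or.inl (Or.inr ⟨P.bdry_notMem_vertices hs, hθ, (h.hitPoint_eq hs).symm ▸ h.vertex_mem⟩)

lemma HitsSide.notMem_singularSet {i j : Fin d} {s θ s' : ℝ} (h : P.HitsSide i s θ j s') :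
    (s, θ) ∉ P.singularSet := by
  rintro ((hV | hS) | hθ | hθ)
  · exact P.bdry_notMem_vertices h.base_mem hV.1
  · exact P.sidePoint_notMem_vertices h.hit_mem (h.hitPoint_eq ▸ hS.2.2)
  · exact h.angle_mem.1.ne' hθ
  · exact h.angle_mem.2.ne hθ

lemma HitsSide.hitParam_eq {i j : Fin d} {s θ s' : ℝ} (h : P.HitsSide i s θ j s') :
    P.hitParam (s, θ) = s' := by
  rw [hitParam, h.hitPoint_eq, ← P.bdry_eq_of_mem_openSide h.hit_mem]
  exact P.bdry_injOn.leftInvOn_invFunOn (P.openSide_subset_Ico j h.hit_mem)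

lemma HitsSide.specularMap_eq {i j : Fin d} {s θ s' : ℝ} (h : P.HitsSide i s θ j s') :
    P.specularMap (s, θ) = (s', P.outAngle i j θ) := by
  rw [specularMap, h.hitParam_eq, P.deriv_bdry h.hit_mem, velocity, P.deriv_bdry h.base_mem,
    outAngle]
  congr 2
  rw [Complex.inner]
  have : P.dir j * (starRingEnd ℂ) ((↑(Real.sin θ) + ↑(Real.cos θ) * Complex.I) * P.dir i) =
      (↑(Real.sin θ) - ↑(Real.cos θ) * Complex.I) * P.relDir i j := by
    rw [relDir, map_mul, map_add, map_mul, Complex.conj_I, Complex.conj_ofReal,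
      Complex.conj_ofReal]
    ring
  simp only [this]
  simp [-Complex.ofReal_sin, -Complex.ofReal_cos]
  ring

lemma HitsSide.billiardMap_eq {i j : Fin d} {s θ s' : ℝ} (h : P.HitsSide i s θ j s')
    (f : ℝ → ℝ) : P.billiardMap f (s, θ) = (s', f (P.outAngle i j θ)) := by
  rw [billiardMap, h.specularMap_eq]

lemma HitsSide.unique {i j k : Fin d} {s θ s' s'' : ℝ} (h : P.HitsSide i s θ j s')
    (h' : P.HitsSide i s θ k s'') : j = k ∧ s' = s'' :=
  P.sidePoint_unique h.hit_mem h'.hit_mem (h.hitPoint_eq.symm.trans h'.hitPoint_eq)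

lemma HitsSide.transversal {i j : Fin d} {s θ s' : ℝ} (h : P.HitsSide i s θ j s') :
    (P.relDir i j).re * Real.cos θ - (P.relDir i j).im * Real.sin θ < 0 := by
  obtain ⟨t, ht, hhit, hd⟩ := h.fliesTo
  obtain ⟨r, hr, hdom⟩ := P.exists_ball_mem_domain_iff h.hit_mem
  obtain ⟨u, hu0, hu⟩ := exists_between (lt_min hr ht)
  obtain ⟨hur, hut⟩ := lt_min_iff.1 hu
  have hball : P.ray i s θ (t - u) ∈ Metric.ball (P.sidePoint j s') r := by
    rwa [← hhit, mem_ball_iff_norm, norm_ray_sub_ray, sub_sub_cancel_left, abs_neg, abs_of_pos hu0]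
  have him := (hdom _ hball).1 (hd _ ⟨by linarith, by linarith⟩)
  rw [P.frame_ray_im_of_hit hhit] at him
  nlinarith

/-! ### Flights in the coordinates of a side -/

lemma tan_mul_cos_of_mem {θ : ℝ} (hθ : θ ∈ Ioo (-(π / 2)) (π / 2)) :
    Real.tan θ * Real.cos θ = Real.sin θ :=
  Real.tan_mul_cos (Real.cos_pos_of_mem_Ioo hθ).ne'

variable (P) in
/-- The base parameter of the line of angle `θ` to side `i` that passes through `q`. -/
def foot (i : Fin d) (θ : ℝ) (q : ℂ) : ℝ :=
  (P.frame i q).re - (P.frame i q).im * Real.tan θ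

lemma foot_ray {θ : ℝ} (hθ : θ ∈ Ioo (-(π / 2)) (π / 2)) (i : Fin d) (s t : ℝ) :
    P.foot i θ (P.ray i s θ t) = s := by
  rw [foot, frame_ray_im, frame_ray_re, ← tan_mul_cos_of_mem hθ]
  ring

variable (P) in
lemma ray_foot {θ : ℝ} (hθ : θ ∈ Ioo (-(π / 2)) (π / 2)) (i : Fin d) (q : ℂ) :
    P.ray i (P.foot i θ q) θ ((P.frame i q).im / Real.cos θ) = q := by
  have hcos := (Real.cos_pos_of_mem_Ioo hθ).ne'
  apply P.frame_injective i
  apply Complex.ext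
  · rw [frame_ray_re, foot, ← tan_mul_cos_of_mem hθ]
    field_simp
    ring
  · rw [frame_ray_im]
    field_simp

lemma foot_sub_foot (i : Fin d) (θ θ' : ℝ) (q : ℂ) :
    P.foot i θ q - P.foot i θ' q = -((P.frame i q).im * (Real.tan θ - Real.tan θ')) := by
  rw [foot, foot]
  ring

lemma foot_sidePoint (i j : Fin d) (θ p : ℝ) : P.foot i θ (P.sidePoint j p) =
    (P.relBase i j).re - (P.relBase i j).im * Real.tan θ + p * P.slope i j θ := by
  rw [foot, frame_sidePoint_re, frame_sidePoint_im, slope]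
  ring

lemma foot_sidePoint_sub (i j : Fin d) (θ p p' : ℝ) :
    P.foot i θ (P.sidePoint j p) - P.foot i θ (P.sidePoint j p') = (p - p') * P.slope i j θ := by
  rw [foot_sidePoint, foot_sidePoint]
  ring

lemma foot_hitCoord {i j : Fin d} {θ : ℝ} (hslope : P.slope i j θ ≠ 0) (s : ℝ) :
    P.foot i θ (P.sidePoint j (P.hitCoord i j s θ)) = s := by
  rw [foot_sidePoint, hitCoord, div_mul_cancel₀ _ hslope]
  ring

lemma continuousAt_foot {θ : ℝ} (hθ : θ ∈ Ioo (-(π / 2)) (π / 2)) (i : Fin d) (q : ℂ) :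
    ContinuousAt (fun θ => P.foot i θ q) θ :=
  continuousAt_const.sub
    (continuousAt_const.mul (Real.continuousAt_tan.2 (Real.cos_pos_of_mem_Ioo hθ).ne'))

lemma slope_mul_cos {θ : ℝ} (hθ : θ ∈ Ioo (-(π / 2)) (π / 2)) (i j : Fin d) :
    P.slope i j θ * Real.cos θ =
      (P.relDir i j).re * Real.cos θ - (P.relDir i j).im * Real.sin θ := by
  rw [slope, ← tan_mul_cos_of_mem hθ]
  ring

lemma FliesTo.foot_eq {i : Fin d} {s θ : ℝ} {q : ℂ} (h : P.FliesTo i s θ q)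
    (hθ : θ ∈ Ioo (-(π / 2)) (π / 2)) : P.foot i θ q = s := by
  obtain ⟨t, -, rfl, -⟩ := h
  exact foot_ray hθ i s t

lemma FliesTo.frame_im_pos {i : Fin d} {s θ : ℝ} {q : ℂ} (h : P.FliesTo i s θ q)
    (hθ : θ ∈ Ioo (-(π / 2)) (π / 2)) : 0 < (P.frame i q).im := by
  obtain ⟨t, ht, rfl, -⟩ := h
  rw [frame_ray_im]
  exact mul_pos ht (Real.cos_pos_of_mem_Ioo hθ)

lemma FliesTo.mem_domain_of_foot_eq {i : Fin d} {s θ : ℝ} {q q' : ℂ} (h : P.FliesTo i s θ q)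
    (hθ : θ ∈ Ioo (-(π / 2)) (π / 2)) (hfoot : P.foot i θ q' = s)
    (him : (P.frame i q').im ∈ Ioo 0 (P.frame i q).im) : q' ∈ P.domain := by
  obtain ⟨t, -, rfl, hdom⟩ := h
  have hcos := Real.cos_pos_of_mem_Ioo hθ
  rw [frame_ray_im] at him
  rw [← P.ray_foot hθ i q', hfoot]
  exact hdom _ ⟨div_pos him.1 hcos, (div_lt_iff₀ hcos).2 him.2⟩

lemma HitsSide.slope_neg {i j : Fin d} {s θ s' : ℝ} (h : P.HitsSide i s θ j s') :
    P.slope i j θ < 0 :=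
  neg_of_mul_neg_left ((slope_mul_cos h.angle_mem i j).trans_lt h.transversal)
    (Real.cos_pos_of_mem_Ioo h.angle_mem).le

lemma HitsSide.foot_eq {i j : Fin d} {s θ s' : ℝ} (h : P.HitsSide i s θ j s') :
    P.foot i θ (P.sidePoint j s') = s :=
  h.fliesTo.foot_eq h.angle_mem

lemma HitsSide.height_pos {i j : Fin d} {s θ s' : ℝ} (h : P.HitsSide i s θ j s') :
    0 < (P.frame i (P.sidePoint j s')).im :=
  h.fliesTo.frame_im_pos h.angle_mem

lemma HitsSide.eq_hitCoord {i j : Fin d} {s θ s' : ℝ} (h : P.HitsSide i s θ j s') :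
    s' = P.hitCoord i j s θ := by
  rw [hitCoord, eq_div_iff h.slope_neg.ne]
  linarith [h.foot_eq, P.foot_sidePoint i j θ s']

lemma cos_outAngle {i j : Fin d} {θ : ℝ} (hθ : θ ∈ Ioo (-(π / 2)) (π / 2))
    (hslope : P.slope i j θ < 0) :
    Real.cos (P.outAngle i j θ) = -(P.slope i j θ * Real.cos θ) := by
  have hneg := mul_neg_of_neg_of_pos hslope (Real.cos_pos_of_mem_Ioo hθ)
  rw [slope_mul_cos hθ] at hneg ⊢
  rw [outAngle, Real.cos_arcsin, Real.sqrt_eq_iff_mul_self_eq_of_pos (neg_pos.2 hneg)]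
  linear_combination P.relDir_sq i j +
    ((P.relDir i j).re ^ 2 + (P.relDir i j).im ^ 2) * Real.sin_sq_add_cos_sq θ

lemma sin_outAngle (i j : Fin d) (θ : ℝ) :
    Real.sin (P.outAngle i j θ) =
      (P.relDir i j).re * Real.sin θ + (P.relDir i j).im * Real.cos θ := by
  have hunit : ((P.relDir i j).re * Real.sin θ + (P.relDir i j).im * Real.cos θ) ^ 2 +
      ((P.relDir i j).re * Real.cos θ - (P.relDir i j).im * Real.sin θ) ^ 2 = 1 := by
    linear_combination P.relDir_sq i j +
      ((P.relDir i j).re ^ 2 + (P.relDir i j).im ^ 2) * Real.sin_sq_add_cos_sq θ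
  rw [outAngle, Real.sin_arcsin] <;> nlinarith

lemma outAngle_mem {i j : Fin d} {θ : ℝ} (hθ : θ ∈ Ioo (-(π / 2)) (π / 2))
    (hslope : P.slope i j θ < 0) : P.outAngle i j θ ∈ Ioo (-(π / 2)) (π / 2) := by
  have hcos : 0 < Real.cos (P.outAngle i j θ) := by
    rw [cos_outAngle hθ hslope]
    exact neg_pos.2 (mul_neg_of_neg_of_pos hslope (Real.cos_pos_of_mem_Ioo hθ))
  obtain ⟨hlo, hhi⟩ := Real.arcsin_mem_Icc
    ((P.relDir i j).re * Real.sin θ + (P.relDir i j).im * Real.cos θ)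
  rw [← outAngle] at hlo hhi
  refine ⟨lt_of_le_of_ne hlo fun heq => ?_, lt_of_le_of_ne hhi fun heq => ?_⟩
  · rw [← heq, Real.cos_neg, Real.cos_pi_div_two] at hcos
    exact lt_irrefl _ hcos
  · rw [heq, Real.cos_pi_div_two] at hcos
    exact lt_irrefl _ hcos

lemma HitsSide.cos_outAngle {i j : Fin d} {s θ s' : ℝ} (h : P.HitsSide i s θ j s') :
    Real.cos (P.outAngle i j θ) = -(P.slope i j θ * Real.cos θ) :=
  PolygonalTable.cos_outAngle h.angle_mem h.slope_neg

lemma HitsSide.outAngle_mem {i j : Fin d} {s θ s' : ℝ} (h : P.HitsSide i s θ j s') :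
    P.outAngle i j θ ∈ Ioo (-(π / 2)) (π / 2) :=
  PolygonalTable.outAngle_mem h.angle_mem h.slope_neg

variable (P) in
/-- The time at which the ray from `(s, θ)` on side `i` meets the line through side `j`. -/
def hitTime (i j : Fin d) (s θ : ℝ) : ℝ :=
  (P.frame i (P.sidePoint j (P.hitCoord i j s θ))).im / Real.cos θ

lemma ray_hitTime {i j : Fin d} {θ : ℝ} (hθ : θ ∈ Ioo (-(π / 2)) (π / 2))
    (hslope : P.slope i j θ ≠ 0) (s : ℝ) :
    P.ray i s θ (P.hitTime i j s θ) = P.sidePoint j (P.hitCoord i j s θ) := by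
  have hray := P.ray_foot hθ i (P.sidePoint j (P.hitCoord i j s θ))
  rwa [foot_hitCoord hslope] at hray

lemma HitsSide.hitTime_pos {i j : Fin d} {s θ s' : ℝ} (h : P.HitsSide i s θ j s') :
    0 < P.hitTime i j s θ := by
  rw [hitTime, ← h.eq_hitCoord]
  exact div_pos h.height_pos (Real.cos_pos_of_mem_Ioo h.angle_mem)

lemma HitsSide.ray_hitTime_eq {i j : Fin d} {s θ s' : ℝ} (h : P.HitsSide i s θ j s') :
    P.ray i s θ (P.hitTime i j s θ) = P.sidePoint j s' := by
  rw [ray_hitTime h.angle_mem h.slope_neg.ne, ← h.eq_hitCoord]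

lemma HitsSide.ray_mem_domain {i j : Fin d} {s θ s' t : ℝ} (h : P.HitsSide i s θ j s')
    (ht : t ∈ Ioo 0 (P.hitTime i j s θ)) : P.ray i s θ t ∈ P.domain := by
  obtain ⟨T, -, hhit, hdom⟩ := h.fliesTo
  have hT : P.hitTime i j s θ = T := by
    have him := congrArg (fun q => (P.frame i q).im) (h.ray_hitTime_eq.trans hhit.symm)
    simp only [frame_ray_im] at him
    exact mul_right_cancel₀ (Real.cos_pos_of_mem_Ioo h.angle_mem).ne' him
  exact hdom t (hT ▸ ht)

lemma continuousAt_slope {θ : ℝ} (hθ : θ ∈ Ioo (-(π / 2)) (π / 2)) (i j : Fin d) :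
    ContinuousAt (P.slope i j) θ :=
  continuousAt_const.sub
    (continuousAt_const.mul (Real.continuousAt_tan.2 (Real.cos_pos_of_mem_Ioo hθ).ne'))

lemma continuousAt_hitCoord {i j : Fin d} {x : ℝ × ℝ} (hθ : x.2 ∈ Ioo (-(π / 2)) (π / 2))
    (hslope : P.slope i j x.2 ≠ 0) :
    ContinuousAt (fun x : ℝ × ℝ => P.hitCoord i j x.1 x.2) x := by
  have htan : ContinuousAt (fun x : ℝ × ℝ => Real.tan x.2) x :=
    (Real.continuousAt_tan.2 (Real.cos_pos_of_mem_Ioo hθ).ne').comp continuousAt_snd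
  exact ((continuousAt_fst.sub continuousAt_const).add (continuousAt_const.mul htan)).div
    ((continuousAt_slope hθ i j).comp continuousAt_snd) hslope

lemma continuousAt_hitTime {i j : Fin d} {x : ℝ × ℝ} (hθ : x.2 ∈ Ioo (-(π / 2)) (π / 2))
    (hslope : P.slope i j x.2 ≠ 0) :
    ContinuousAt (fun x : ℝ × ℝ => P.hitTime i j x.1 x.2) x := by
  simp only [hitTime, frame_sidePoint_im]
  exact (continuousAt_const.add ((continuousAt_hitCoord hθ hslope).mul continuousAt_const)).div
    (by fun_prop) (Real.cos_pos_of_mem_Ioo hθ).ne'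

lemma eventually_angle_mem {x : ℝ × ℝ} (hθ : x.2 ∈ Ioo (-(π / 2)) (π / 2)) :
    ∀ᶠ y : ℝ × ℝ in 𝓝 x, y.2 ∈ Ioo (-(π / 2)) (π / 2) :=
  continuousAt_snd.eventually (isOpen_Ioo.mem_nhds hθ)

lemma eventually_slope_neg {i j : Fin d} {x : ℝ × ℝ} (hθ : x.2 ∈ Ioo (-(π / 2)) (π / 2))
    (hslope : P.slope i j x.2 < 0) : ∀ᶠ y : ℝ × ℝ in 𝓝 x, P.slope i j y.2 < 0 :=
  ((continuousAt_slope hθ i j).comp continuousAt_snd).eventually_lt_const hslope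

lemma continuous_ray_prod (i : Fin d) :
    Continuous fun z : (ℝ × ℝ) × ℝ => P.ray i z.1.1 z.1.2 z.2 :=
  (P.continuous_ray i).comp (by fun_prop : Continuous fun z : (ℝ × ℝ) × ℝ => (z.1.1, z.1.2, z.2))

lemma eventually_ray_mem_domain {i : Fin d} {x : ℝ × ℝ} {T : ℝ} (hs : x.1 ∈ P.openSide i)
    (hθ : x.2 ∈ Ioo (-(π / 2)) (π / 2)) (h : ∀ t ∈ Ioc 0 T, P.ray i x.1 x.2 t ∈ P.domain) :
    ∀ᶠ y : ℝ × ℝ in 𝓝 x, ∀ t ∈ Ioc 0 T, P.ray i y.1 y.2 t ∈ P.domain := by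
  obtain ⟨r, hr, hstart⟩ := P.exists_ray_mem_domain hs
  have hmiddle : ∀ᶠ y : ℝ × ℝ in 𝓝 x, ∀ t ∈ Icc (r / 2) T, P.ray i y.1 y.2 t ∈ P.domain :=
    isCompact_Icc.eventually_forall_of_forall_eventually fun t ht =>
      ((continuous_ray_prod i).continuousAt (x := (x, t))).eventually
        (P.isOpen_domain.mem_nhds (h t ⟨(half_pos hr).trans_le ht.1, ht.2⟩))
  have hclose : ∀ᶠ y : ℝ × ℝ in 𝓝 x, |y.1 - x.1| < r :=
    continuousAt_fst.eventually (Metric.ball_mem_nhds x.1 hr)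
  filter_upwards [hmiddle, hclose, eventually_angle_mem hθ] with y hmid hy hyθ t ht
  rcases lt_or_ge t r with htr | htr
  · exact hstart y.1 hy y.2 hyθ t ⟨ht.1, htr⟩
  · exact hmid t ⟨by linarith, ht.2⟩

lemma HitsSide.exists_eventually_ray_mem_domain {i j : Fin d} {s θ s' : ℝ}
    (h : P.HitsSide i s θ j s') : ∃ T < P.hitTime i j s θ, ∀ᶠ x : ℝ × ℝ in 𝓝 (s, θ),
      ∀ t ∈ Ioo T (P.hitTime i j x.1 x.2), P.ray i x.1 x.2 t ∈ P.domain := by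
  obtain ⟨r, hr, hball⟩ := P.exists_ball_mem_domain_iff h.hit_mem
  have hnear : ∀ᶠ z : (ℝ × ℝ) × ℝ in 𝓝 ((s, θ), P.hitTime i j s θ),
      P.ray i z.1.1 z.1.2 z.2 ∈ Metric.ball (P.sidePoint j s') r := by
    refine (continuous_ray_prod i).continuousAt.eventually (Metric.isOpen_ball.mem_nhds ?_)
    simpa only [h.ray_hitTime_eq] using Metric.mem_ball_self hr
  rw [nhds_prod_eq, eventually_prod_iff] at hnear
  obtain ⟨p, hp, q, hq, hpq⟩ := hnear
  obtain ⟨ε, hε, hqε⟩ := Metric.eventually_nhds_iff_ball.1 hq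
  have htime : ∀ᶠ x : ℝ × ℝ in 𝓝 (s, θ), P.hitTime i j x.1 x.2 < P.hitTime i j s θ + ε :=
    (continuousAt_hitTime (x := (s, θ)) h.angle_mem h.slope_neg.ne).eventually_lt_const
      (lt_add_of_pos_right _ hε)
  refine ⟨P.hitTime i j s θ - ε, sub_lt_self _ hε, ?_⟩
  filter_upwards [hp, htime, eventually_angle_mem (x := (s, θ)) h.angle_mem,
    eventually_slope_neg (x := (s, θ)) h.angle_mem h.slope_neg] with x hpx hx hxθ hslope t ht
  refine (hball _ (hpq hpx (hqε t ?_))).2 ?_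
  · rw [Real.ball_eq_Ioo]
    exact ⟨ht.1, ht.2.trans hx⟩
  · rw [P.frame_ray_im_of_hit (ray_hitTime hxθ hslope.ne x.1), ← slope_mul_cos hxθ]
    exact mul_pos (sub_pos.2 ht.2)
      (neg_pos.2 (mul_neg_of_neg_of_pos hslope (Real.cos_pos_of_mem_Ioo hxθ)))

lemma HitsSide.eventually {i j : Fin d} {s θ s' : ℝ} (h : P.HitsSide i s θ j s') :
    ∀ᶠ x : ℝ × ℝ in 𝓝 (s, θ), P.HitsSide i x.1 x.2 j (P.hitCoord i j x.1 x.2) := by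
  have hcoord : ∀ᶠ x : ℝ × ℝ in 𝓝 (s, θ), P.hitCoord i j x.1 x.2 ∈ P.openSide j :=
    (continuousAt_hitCoord (x := (s, θ)) h.angle_mem h.slope_neg.ne).eventually
      (isOpen_Ioo.mem_nhds (h.eq_hitCoord ▸ h.hit_mem : P.hitCoord i j s θ ∈ P.openSide j))
  have htime : ∀ᶠ x : ℝ × ℝ in 𝓝 (s, θ), 0 < P.hitTime i j x.1 x.2 :=
    (continuousAt_hitTime (x := (s, θ)) h.angle_mem h.slope_neg.ne).eventually_const_lt
      h.hitTime_pos
  obtain ⟨T, hT, hend⟩ := h.exists_eventually_ray_mem_domain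
  have hstart := eventually_ray_mem_domain (x := (s, θ)) (T := T) h.base_mem h.angle_mem
    fun t ht => h.ray_mem_domain ⟨ht.1, ht.2.trans_lt hT⟩
  filter_upwards [hcoord, htime, hstart, hend, continuousAt_fst.eventually
    (isOpen_Ioo.mem_nhds h.base_mem), eventually_angle_mem (x := (s, θ)) h.angle_mem,
    eventually_slope_neg (x := (s, θ)) h.angle_mem h.slope_neg]
    with x hσ hτ hxs hxe hs hθ hslope
  refine ⟨hs, hθ, hσ, _, hτ, ray_hitTime hθ hslope.ne x.1, fun t ht => ?_⟩
  rcases le_or_gt t T with htT | htT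
  · exact hxs t ⟨ht.1, htT⟩
  · exact hxe t ⟨htT, ht.2⟩

lemma HitsSide.of_isPreconnected {i j : Fin d} {U : Set (ℝ × ℝ)} (hU : IsPreconnected U)
    (hside : ∀ x ∈ U, x.1 ∈ P.openSide i) (hang : ∀ x ∈ U, x.2 ∈ Ioo (-(π / 2)) (π / 2))
    (hv : ∀ x ∈ U, ∀ w, ¬ P.HitsVertex i x.1 x.2 w) {x y : ℝ × ℝ} (hx : x ∈ U) (hy : y ∈ U)
    {s' : ℝ} (h : P.HitsSide i x.1 x.2 j s') :
    P.HitsSide i y.1 y.2 j (P.hitCoord i j y.1 y.2) := by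
  have hex : ∀ z ∈ U, ∃ k, P.HitsSide i z.1 z.2 k (P.hitCoord i k z.1 z.2) := by
    intro z hz
    rcases P.hitsSide_or_hitsVertex (hside z hz) (hang z hz) with ⟨k, s'', h⟩ | ⟨w, h⟩
    · exact ⟨k, h.eq_hitCoord ▸ h⟩
    · exact absurd h (hv z hz w)
  have hconst := hU.induction₂ (fun z z' => P.HitsSide i z.1 z.2 j (P.hitCoord i j z.1 z.2) ↔
    P.HitsSide i z'.1 z'.2 j (P.hitCoord i j z'.1 z'.2)) ?_
      (fun _ _ _ _ _ _ h₁ h₂ => h₁.trans h₂) (fun _ _ _ _ h => h.symm) hx hy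
  · exact hconst.1 (h.eq_hitCoord ▸ h)
  · intro z hz
    obtain ⟨k, hk⟩ := hex z hz
    refine Filter.Eventually.filter_mono nhdsWithin_le_nhds ?_
    filter_upwards [hk.eventually] with z' hz'
    exact ⟨fun h' => (h'.unique hk).1 ▸ hz', fun h' => (h'.unique hz').1 ▸ hk⟩

lemma HitsSide.reverse {i j : Fin d} {s θ s' : ℝ} (h : P.HitsSide i s θ j s') :
    P.HitsSide j s' (-P.outAngle i j θ) i s := by
  obtain ⟨t, ht, hhit, hdom⟩ := h.fliesTo
  have hrev (u : ℝ) : P.ray j s' (-P.outAngle i j θ) u = P.ray i s θ (t - u) := by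
    rw [P.ray_eq_of_hit hhit, ray, Real.sin_neg, Real.cos_neg, sin_outAngle, h.cos_outAngle,
      slope_mul_cos h.angle_mem, relDir_symm]
    congr 2
    apply Complex.ext <;> simp [-Complex.ofReal_sin, -Complex.ofReal_cos] <;> ring
  refine ⟨h.hit_mem, ⟨neg_lt_neg h.outAngle_mem.2, neg_lt.1 h.outAngle_mem.1⟩, h.base_mem, t, ht,
    ?_, fun u hu => ?_⟩
  · rw [hrev, sub_self, ray_zero]
  · rw [hrev]
    exact hdom _ ⟨sub_pos.2 hu.2, sub_lt_self _ hu.1⟩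

end PolygonalTable

/-! ### Reflection laws -/

/-- A reflection law for which the argument works: an increasing differentiable function on the
open interval of angles that contracts towards `0` by the factor `l`. -/
structure IsAngleContraction (f : ℝ → ℝ) (l : ℝ) : Prop where
  lt_one : l < 1
  strictMonoOn : StrictMonoOn f (Ioo (-(π / 2)) (π / 2))
  differentiableOn : DifferentiableOn ℝ f (Ioo (-(π / 2)) (π / 2))
  abs_le : ∀ θ ∈ Ioo (-(π / 2)) (π / 2), |f θ| ≤ l * |θ|

namespace IsAngleContraction

variable {f : ℝ → ℝ} {l : ℝ}

lemma nonneg (hf : IsAngleContraction f l) : 0 ≤ l := by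
  have hπ := Real.pi_gt_three
  simpa using (abs_nonneg _).trans (hf.abs_le 1 ⟨by linarith, by linarith⟩)

lemma abs_apply_le (hf : IsAngleContraction f l) {θ : ℝ} (hθ : θ ∈ Ioo (-(π / 2)) (π / 2)) :
    |f θ| ≤ |θ| :=
  (hf.abs_le θ hθ).trans (mul_le_of_le_one_left (abs_nonneg θ) hf.lt_one.le)

lemma map_mem (hf : IsAngleContraction f l) {θ : ℝ} (hθ : θ ∈ Ioo (-(π / 2)) (π / 2)) :
    f θ ∈ Ioo (-(π / 2)) (π / 2) :=
  abs_lt.1 ((hf.abs_apply_le hθ).trans_lt (abs_lt.2 hθ))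

lemma differentiableAt (hf : IsAngleContraction f l) {θ : ℝ} (hθ : θ ∈ Ioo (-(π / 2)) (π / 2)) :
    DifferentiableAt ℝ f θ :=
  hf.differentiableOn.differentiableAt (isOpen_Ioo.mem_nhds hθ)

end IsAngleContraction

namespace IsContractingLaw

variable {f : ℝ → ℝ}

lemma differentiableAt (hf : IsContractingLaw f) {θ : ℝ} (hθ : θ ∈ Ioo (-(π / 2)) (π / 2)) :
    DifferentiableAt ℝ f θ :=
  differentiableAt_of_deriv_ne_zero (hf.deriv_pos θ hθ).ne'

lemma bddAbove_abs_deriv (hf : IsContractingLaw f) :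
    BddAbove ((fun θ => |deriv f θ|) '' Ioo (-(π / 2)) (π / 2)) := by
  have huniq : UniqueDiffOn ℝ (Icc (-(π / 2)) (π / 2)) :=
    uniqueDiffOn_Icc (neg_lt_self Real.pi_div_two_pos)
  obtain ⟨C, hC⟩ := isCompact_Icc.bddAbove_image
    (hf.contDiffOn.continuousOn_derivWithin huniq (by norm_num)).abs
  refine ⟨C, ?_⟩
  rintro _ ⟨θ, hθ, rfl⟩
  have hderiv : derivWithin f (Icc (-(π / 2)) (π / 2)) θ = deriv f θ :=
    derivWithin_of_mem_nhds (Icc_mem_nhds hθ.1 hθ.2)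
  exact hC ⟨θ, Ioo_subset_Icc_self hθ, congrArg abs hderiv⟩

lemma exists_isAngleContraction (hf : IsContractingLaw f) : ∃ l, IsAngleContraction f l := by
  have h0 : (0 : ℝ) ∈ Ioo (-(π / 2)) (π / 2) := by simp [Real.pi_pos]
  refine ⟨_, hf.contracting, ?_, fun θ hθ => (hf.differentiableAt hθ).differentiableWithinAt,
    fun θ hθ => ?_⟩
  · refine strictMonoOn_of_deriv_pos (convex_Ioo _ _)
      (hf.contDiffOn.continuousOn.mono Ioo_subset_Icc_self) fun θ hθ => ?_
    rw [interior_Ioo] at hθ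
    exact hf.deriv_pos θ hθ
  · have hmvt := (convex_Ioo (-(π / 2)) (π / 2)).norm_image_sub_le_of_norm_deriv_le
      (fun x hx => hf.differentiableAt hx)
      (fun x hx => le_csSup hf.bddAbove_abs_deriv ⟨x, hx, rfl⟩) h0 hθ
    simpa [hf.map_zero] using hmvt

end IsContractingLaw

/-! ### Diverging vectors -/

namespace PolygonalTable

variable {d : ℕ} {P : PolygonalTable d} {f : ℝ → ℝ} {l : ℝ}

variable (P) in
/-- The vectors based on the `i`-th side that diverge from the one of base parameter `s₀` and
angle `θ₀`, on the side of it given by the sign `ε`. -/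
def diverging (i : Fin d) (s₀ θ₀ ε : ℝ) : Set (ℝ × ℝ) :=
  {x | x.1 ∈ P.openSide i ∧ 0 ≤ ε * (x.1 - s₀) ∧ 0 ≤ ε * (x.2 - θ₀) ∧
    0 < ε * (x.1 - s₀) + ε * (x.2 - θ₀)}

lemma convex_diverging (i : Fin d) (s₀ θ₀ ε : ℝ) : Convex ℝ (P.diverging i s₀ θ₀ ε) := by
  refine convex_iff_forall_pos.2 ?_
  rintro ⟨s, θ⟩ ⟨h₁, h₂, h₃, h₄⟩ ⟨s', θ'⟩ ⟨h₁', h₂', h₃', h₄'⟩ a b ha hb hab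
  have hfst : ε * (a * s + b * s' - s₀) = a * (ε * (s - s₀)) + b * (ε * (s' - s₀)) := by
    linear_combination ε * s₀ * hab
  have hsnd : ε * (a * θ + b * θ' - θ₀) = a * (ε * (θ - θ₀)) + b * (ε * (θ' - θ₀)) := by
    linear_combination ε * θ₀ * hab
  refine ⟨convex_Ioo _ _ h₁ h₁' ha.le hb.le hab, ?_, ?_, ?_⟩ <;>
    simp only [Prod.smul_mk, Prod.mk_add_mk, smul_eq_mul, hfst, hsnd]
  · exact add_nonneg (mul_nonneg ha.le h₂) (mul_nonneg hb.le h₂')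
  · exact add_nonneg (mul_nonneg ha.le h₃) (mul_nonneg hb.le h₃')
  · linarith [mul_pos ha h₄, mul_pos hb h₄']

lemma sign_mul_tan_sub_pos {θ θ₀ ε : ℝ} (hθ : θ ∈ Ioo (-(π / 2)) (π / 2))
    (hθ₀ : θ₀ ∈ Ioo (-(π / 2)) (π / 2)) (hε : ε = 1 ∨ ε = -1) (h : 0 < ε * (θ - θ₀)) :
    0 < ε * (Real.tan θ - Real.tan θ₀) := by
  rcases hε with rfl | rfl
  · simpa using Real.strictMonoOn_tan hθ₀ hθ (by simpa using h)
  · simpa using Real.strictMonoOn_tan hθ hθ₀ (by simpa using h)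

lemma sign_mul_tan_sub_nonneg {θ θ₀ ε : ℝ} (hθ : θ ∈ Ioo (-(π / 2)) (π / 2))
    (hθ₀ : θ₀ ∈ Ioo (-(π / 2)) (π / 2)) (hε : ε = 1 ∨ ε = -1) (h : 0 ≤ ε * (θ - θ₀)) :
    0 ≤ ε * (Real.tan θ - Real.tan θ₀) := by
  rcases hε with rfl | rfl
  · simpa using Real.strictMonoOn_tan.monotoneOn hθ₀ hθ (by simpa using h)
  · simpa using Real.strictMonoOn_tan.monotoneOn hθ hθ₀ (by simpa using h)

lemma foot_lt_of_mem_diverging {i : Fin d} {x : ℝ × ℝ} {s₀ θ₀ ε : ℝ} {q : ℂ}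
    (hx : x ∈ P.diverging i s₀ θ₀ ε) (hθ : x.2 ∈ Ioo (-(π / 2)) (π / 2))
    (hθ₀ : θ₀ ∈ Ioo (-(π / 2)) (π / 2)) (hε : ε = 1 ∨ ε = -1) (hfoot : P.foot i x.2 q = x.1)
    (him : 0 < (P.frame i q).im) : 0 < ε * (P.foot i θ₀ q - s₀) := by
  obtain ⟨-, hs, hangle, hsum⟩ := hx
  have hsplit : ε * (P.foot i θ₀ q - s₀) =
      ε * (x.1 - s₀) + (P.frame i q).im * (ε * (Real.tan x.2 - Real.tan θ₀)) := by
    linear_combination ε * hfoot - ε * P.foot_sub_foot i x.2 θ₀ q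
  rw [hsplit]
  rcases hangle.eq_or_lt with h | h
  · have := mul_nonneg him.le (sign_mul_tan_sub_nonneg hθ hθ₀ hε hangle)
    linarith
  · have := mul_pos him (sign_mul_tan_sub_pos hθ hθ₀ hε h)
    linarith

variable (P) in
/-- There are finitely many vertices, so those that are not aligned with the reference vector stay
away from it. -/
lemma eventually_foot_vertex_eq (i : Fin d) (s₀ : ℝ) {θ₀ : ℝ} (hθ₀ : θ₀ ∈ Ioo (-(π / 2)) (π / 2)) :
    ∀ᶠ x : ℝ × ℝ in 𝓝 (s₀, θ₀), ∀ w ∈ P.vertices,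
      P.foot i x.2 w = x.1 → P.foot i θ₀ w = s₀ := by
  refine (eventually_all_finite P.finite_vertices).2 fun w _ => ?_
  by_cases hw : P.foot i θ₀ w = s₀
  · exact Eventually.of_forall fun _ _ => hw
  · have hfoot : ContinuousAt (fun x : ℝ × ℝ => P.foot i x.2 w) (s₀, θ₀) :=
      ContinuousAt.comp (g := fun θ => P.foot i θ w) (f := Prod.snd)
        (continuousAt_foot hθ₀ i w) continuousAt_snd
    filter_upwards [(hfoot.sub continuousAt_fst).eventually_ne (sub_ne_zero.2 hw)] with x hx h
      using absurd (sub_eq_zero.2 h) hx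

lemma eventually_not_hitsVertex_of_diverging (i : Fin d) (s₀ : ℝ) {θ₀ ε : ℝ}
    (hθ₀ : θ₀ ∈ Ioo (-(π / 2)) (π / 2)) (hε : ε = 1 ∨ ε = -1) :
    ∀ᶠ x : ℝ × ℝ in 𝓝 (s₀, θ₀), x ∈ P.diverging i s₀ θ₀ ε → ∀ w, ¬ P.HitsVertex i x.1 x.2 w := by
  filter_upwards [eventually_angle_mem (x := (s₀, θ₀)) hθ₀, P.eventually_foot_vertex_eq i s₀ hθ₀]
    with x hθ hx hdiv w hw
  have hfoot := hw.fliesTo.foot_eq hθ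
  have hlt := foot_lt_of_mem_diverging hdiv hθ hθ₀ hε hfoot (hw.fliesTo.frame_im_pos hθ)
  rw [hx w hw.vertex_mem hfoot, sub_self, mul_zero] at hlt
  exact lt_irrefl _ hlt

lemma eventually_outAngle_eq {i j : Fin d} {θ₀ : ℝ} (hθ₀ : θ₀ ∈ Ioo (-(π / 2)) (π / 2))
    (hslope : P.slope i j θ₀ < 0) :
    ∀ᶠ θ in 𝓝 θ₀, P.outAngle i j θ = P.outAngle i j θ₀ - (θ - θ₀) := by
  have hcont : ContinuousAt (fun θ => P.outAngle i j θ₀ - (θ - θ₀)) θ₀ := by fun_prop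
  filter_upwards [hcont.eventually
    (isOpen_Ioo.mem_nhds (by simpa using outAngle_mem hθ₀ hslope))] with θ hθ
  have hsin := Real.sin_add θ₀ (θ - θ₀)
  have hcos := Real.cos_add θ₀ (θ - θ₀)
  rw [add_sub_cancel] at hsin hcos
  rw [← Real.arcsin_sin hθ.1.le hθ.2.le, Real.sin_sub, sin_outAngle, cos_outAngle hθ₀ hslope,
    slope_mul_cos hθ₀, outAngle, hsin, hcos]
  congr 1
  ring

lemma exists_mem_openSide_near {i : Fin d} {s s₀ ε r : ℝ} (hε : ε = 1 ∨ ε = -1)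
    (hs : s ∈ P.openSide i) (hdiv : 0 ≤ ε * (s - s₀)) (hr : |s - s₀| < r) :
    ∃ s' ∈ P.openSide i, 0 < ε * (s' - s₀) ∧ |s' - s₀| < r := by
  have hε₂ : ε * ε = 1 := by rcases hε with rfl | rfl <;> norm_num
  have hcont : ContinuousAt (fun u : ℝ => s + ε * u) 0 := by fun_prop
  have hside : ∀ᶠ u : ℝ in 𝓝 0, s + ε * u ∈ P.openSide i :=
    hcont.eventually (isOpen_Ioo.mem_nhds (by simpa [openSide] using hs))
  have hnear : ∀ᶠ u : ℝ in 𝓝 0, |s + ε * u - s₀| < r :=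
    (hcont.sub continuousAt_const).abs.eventually_lt_const (by simpa using hr)
  obtain ⟨u, ⟨hu, hur⟩, hu₀⟩ := (((hside.and hnear).filter_mono nhdsWithin_le_nhds).and
    (self_mem_nhdsWithin (a := (0 : ℝ)) (s := Ioi 0))).exists
  refine ⟨_, hu, ?_, hur⟩
  calc (0 : ℝ) < ε * (s - s₀) + u := add_pos_of_nonneg_of_pos hdiv hu₀
    _ = ε * (s + ε * u - s₀) := by linear_combination -u * hε₂

variable (P) in
/-- The diverging cone near a vector is connected and hits no vertex, so it flies to one side. -/
lemma eventually_hitsSide_of_diverging (i : Fin d) (s₀ : ℝ) {θ₀ ε : ℝ}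
    (hθ₀ : θ₀ ∈ Ioo (-(π / 2)) (π / 2)) (hε : ε = 1 ∨ ε = -1) :
    (∀ᶠ x : ℝ × ℝ in 𝓝 (s₀, θ₀), x ∉ P.diverging i s₀ θ₀ ε) ∨
    ∃ j, (∀ᶠ x : ℝ × ℝ in 𝓝 (s₀, θ₀), x ∈ P.diverging i s₀ θ₀ ε →
        P.HitsSide i x.1 x.2 j (P.hitCoord i j x.1 x.2)) ∧
      ∃ s s', P.HitsSide i s θ₀ j s' := by
  obtain ⟨r, hr, hball⟩ := Metric.eventually_nhds_iff_ball.1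
    ((eventually_angle_mem (x := (s₀, θ₀)) hθ₀).and
      (eventually_not_hitsVertex_of_diverging (P := P) i s₀ hθ₀ hε))
  rw [or_iff_not_imp_left]
  intro hne
  obtain ⟨x, hxdiv, hxr⟩ :=
    ((not_eventually.1 hne).and_eventually (Metric.ball_mem_nhds _ hr)).exists
  rw [not_not] at hxdiv
  rw [Prod.dist_eq, max_lt_iff] at hxr
  obtain ⟨s, hs, hspos, hsr⟩ := exists_mem_openSide_near hε hxdiv.1 hxdiv.2.1 hxr.1
  have hsdiv : (s, θ₀) ∈ P.diverging i s₀ θ₀ ε := ⟨hs, hspos.le, by simp, by simpa using hspos⟩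
  have hsball : (s, θ₀) ∈ Metric.ball (s₀, θ₀) r := by
    rw [Metric.mem_ball, Prod.dist_eq, max_lt_iff]
    exact ⟨hsr, by simpa using hr⟩
  obtain ⟨j, s', hj⟩ := (P.hitsSide_or_hitsVertex hs hθ₀).resolve_right
    fun ⟨w, hw⟩ => (hball _ hsball).2 hsdiv w hw
  refine ⟨j, ?_, s, s', hj⟩
  filter_upwards [Metric.ball_mem_nhds _ hr] with y hyr hydiv
  have hconn : IsPreconnected (P.diverging i s₀ θ₀ ε ∩ Metric.ball (s₀, θ₀) r) :=
    ((convex_diverging i s₀ θ₀ ε).inter (convex_ball _ _)).isPreconnected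
  exact HitsSide.of_isPreconnected hconn (fun z hz => hz.1.1) (fun z hz => (hball z hz.2).1)
    (fun z hz => (hball z hz.2).2 hz.1) ⟨hsdiv, hsball⟩ ⟨hydiv, hyr⟩ hj

lemma singularSetIter_zero (f : ℝ → ℝ) : P.singularSetIter f 0 = ∅ := by
  simp [singularSetIter]

lemma mem_singularSetIter {n : ℕ} {x : ℝ × ℝ} :
    x ∈ P.singularSetIter f n ↔ ∃ k < n, (P.billiardMap f)^[k] x ∈ P.singularSet := by
  simp [singularSetIter]

lemma mem_singularSetIter_succ {n : ℕ} {x : ℝ × ℝ} :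
    x ∈ P.singularSetIter f (n + 1) ↔
      x ∈ P.singularSet ∨ P.billiardMap f x ∈ P.singularSetIter f n := by
  simp only [mem_singularSetIter]
  constructor
  · rintro ⟨_ | k, hk, h⟩
    · exact Or.inl h
    · exact Or.inr ⟨k, Nat.succ_lt_succ_iff.1 hk, by rwa [Function.iterate_succ_apply] at h⟩
  · rintro (h | ⟨k, hk, h⟩)
    · exact ⟨0, n.succ_pos, h⟩
    · exact ⟨k + 1, Nat.succ_lt_succ hk, by rwa [Function.iterate_succ_apply]⟩

lemma singularSetIter_mono {m n : ℕ} (h : m ≤ n) :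
    P.singularSetIter f m ⊆ P.singularSetIter f n := fun x hx => by
  rw [mem_singularSetIter] at hx ⊢
  obtain ⟨k, hk, hx⟩ := hx
  exact ⟨k, hk.trans_le h, hx⟩

lemma exists_hitsSide_of_notMem {i : Fin d} {x : ℝ × ℝ} (hs : x.1 ∈ P.openSide i)
    (hθ : x.2 ∈ Ioo (-(π / 2)) (π / 2)) (h : x ∉ P.singularSet) :
    ∃ j s', P.HitsSide i x.1 x.2 j s' :=
  (P.hitsSide_or_hitsVertex hs hθ).resolve_right
    fun ⟨_, hw⟩ => h (hw.mem_singularSet hs hθ)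

variable (P) in
/-- The branch of the billiard map that carries vectors on side `i` to side `j`. -/
def branch (f : ℝ → ℝ) (i j : Fin d) (x : ℝ × ℝ) : ℝ × ℝ :=
  (P.hitCoord i j x.1 x.2, f (P.outAngle i j x.2))

lemma HitsSide.billiardMap_eq_branch {i j : Fin d} {s θ s' : ℝ} (h : P.HitsSide i s θ j s')
    (f : ℝ → ℝ) : P.billiardMap f (s, θ) = P.branch f i j (s, θ) := by
  rw [h.billiardMap_eq, branch, ← h.eq_hitCoord]

lemma continuousAt_branch (hf : IsAngleContraction f l) {i j : Fin d} {x : ℝ × ℝ}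
    (hθ : x.2 ∈ Ioo (-(π / 2)) (π / 2)) (hslope : P.slope i j x.2 < 0) :
    ContinuousAt (P.branch f i j) x := by
  have hout : ContinuousAt (fun x : ℝ × ℝ => P.outAngle i j x.2) x := by
    unfold outAngle
    exact (Real.continuous_arcsin.comp (by fun_prop)).continuousAt
  exact (continuousAt_hitCoord hθ hslope.ne).prodMk
    (ContinuousAt.comp (g := f) (f := fun x : ℝ × ℝ => P.outAngle i j x.2)
      (hf.differentiableAt (outAngle_mem hθ hslope)).continuousAt hout)

lemma eventually_sign_mul_angle_sub_pos (hf : IsAngleContraction f l) {i j : Fin d} {θ₀ ε : ℝ}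
    (hθ₀ : θ₀ ∈ Ioo (-(π / 2)) (π / 2)) (hε : ε = 1 ∨ ε = -1) (hslope : P.slope i j θ₀ < 0) :
    ∀ᶠ θ in 𝓝 θ₀, 0 < ε * (θ - θ₀) →
      0 < -ε * (f (P.outAngle i j θ) - f (P.outAngle i j θ₀)) := by
  have h₀ := outAngle_mem hθ₀ hslope
  filter_upwards [eventually_outAngle_eq hθ₀ hslope, isOpen_Ioo.mem_nhds hθ₀,
    (continuousAt_slope hθ₀ i j).eventually_lt_const hslope] with θ hout hθ hneg hpos
  have hmem := outAngle_mem hθ hneg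
  rcases hε with rfl | rfl
  · have := hf.strictMonoOn hmem h₀ (by linarith)
    linarith
  · have := hf.strictMonoOn h₀ hmem (by linarith)
    linarith

/-- The sign changes because a collision reverses the orientation. -/
lemma eventually_branch_mem_diverging (hf : IsAngleContraction f l) {i j : Fin d} (s₀ : ℝ)
    {θ₀ ε : ℝ} (hθ₀ : θ₀ ∈ Ioo (-(π / 2)) (π / 2)) (hε : ε = 1 ∨ ε = -1)
    (hslope : P.slope i j θ₀ < 0) :
    ∀ᶠ x : ℝ × ℝ in 𝓝 (s₀, θ₀), ∀ s', P.HitsSide i x.1 x.2 j s' → 0 ≤ ε * (x.2 - θ₀) →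
      0 ≤ -ε * (s' - P.hitCoord i j s₀ θ₀) →
      0 < ε * (x.2 - θ₀) ∨ 0 < -ε * (s' - P.hitCoord i j s₀ θ₀) →
      (s', f (P.outAngle i j x.2)) ∈
        P.diverging j (P.hitCoord i j s₀ θ₀) (f (P.outAngle i j θ₀)) (-ε) := by
  filter_upwards [continuousAt_snd.eventually
    (eventually_sign_mul_angle_sub_pos hf hθ₀ hε hslope)] with x hx s' hs' hangle hs hor
  rcases hangle.eq_or_lt with hzero | hpos
  · have hθ : x.2 = θ₀ := by rcases hε with rfl | rfl <;> linarith
    refine ⟨hs'.hit_mem, hs, by simp [hθ], ?_⟩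
    simpa [hθ] using hor.resolve_left hzero.not_lt
  · exact ⟨hs'.hit_mem, hs, (hx hpos).le, add_pos_of_nonneg_of_pos hs (hx hpos)⟩

lemma eventually_branch_mem_diverging_of_mem_diverging (hf : IsAngleContraction f l)
    {i j : Fin d} (s₀ : ℝ) {θ₀ ε : ℝ} (hθ₀ : θ₀ ∈ Ioo (-(π / 2)) (π / 2)) (hε : ε = 1 ∨ ε = -1)
    (hslope : P.slope i j θ₀ < 0) :
    ∀ᶠ x : ℝ × ℝ in 𝓝 (s₀, θ₀), x ∈ P.diverging i s₀ θ₀ ε → ∀ s', P.HitsSide i x.1 x.2 j s' →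
      (s', f (P.outAngle i j x.2)) ∈
        P.diverging j (P.hitCoord i j s₀ θ₀) (f (P.outAngle i j θ₀)) (-ε) := by
  filter_upwards [eventually_branch_mem_diverging hf s₀ hθ₀ hε hslope] with x hx hdiv s' hs'
  have hfoot := foot_lt_of_mem_diverging hdiv hs'.angle_mem hθ₀ hε hs'.foot_eq hs'.height_pos
  have hshift : P.foot i θ₀ (P.sidePoint j s') - s₀ =
      (s' - P.hitCoord i j s₀ θ₀) * P.slope i j θ₀ := by
    rw [← foot_sidePoint_sub, foot_hitCoord hslope.ne]
  have hpos : 0 < -ε * (s' - P.hitCoord i j s₀ θ₀) := by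
    rw [hshift, ← mul_assoc] at hfoot
    linarith [neg_of_mul_pos_left hfoot hslope.le]
  exact hx s' hs' hdiv.2.2.1 hpos.le (Or.inr hpos)

lemma eventually_diverging_notMem (hf : IsAngleContraction f l) (n : ℕ) (i : Fin d) (s₀ : ℝ)
    {θ₀ ε : ℝ} (hθ₀ : θ₀ ∈ Ioo (-(π / 2)) (π / 2)) (hε : ε = 1 ∨ ε = -1) :
    ∀ᶠ x : ℝ × ℝ in 𝓝 (s₀, θ₀), x ∈ P.diverging i s₀ θ₀ ε → x ∉ P.singularSetIter f n := by
  induction n generalizing i s₀ θ₀ ε with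
  | zero => simp [singularSetIter_zero]
  | succ n ih =>
    rcases P.eventually_hitsSide_of_diverging i s₀ hθ₀ hε with hempty | ⟨j, hhit, s, s', hs⟩
    · filter_upwards [hempty] with x hx hx' using absurd hx' hx
    have hε' : -ε = 1 ∨ -ε = -1 := by rcases hε with rfl | rfl <;> simp
    filter_upwards [hhit,
      eventually_branch_mem_diverging_of_mem_diverging hf s₀ hθ₀ hε hs.slope_neg,
      (continuousAt_branch (x := (s₀, θ₀)) hf hθ₀ hs.slope_neg).eventually
        (ih j _ (hf.map_mem hs.outAngle_mem) hε')] with x hxj hxdiv hxn hx hsing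
    rcases mem_singularSetIter_succ.1 hsing with h | h
    · exact (hxj hx).notMem_singularSet h
    · exact hxn (hxdiv hx _ (hxj hx)) ((hxj hx).billiardMap_eq_branch f ▸ h)

/-! ### Parallel rays near a trajectory -/

lemma exists_vertex_mem_uIcc {j : Fin d} {s q : ℝ} (hs : s ∈ P.openSide j)
    (hq : q ∉ P.openSide j) : ∃ c ∈ uIcc s q, c ≠ s ∧ P.sidePoint j c ∈ P.vertices := by
  have hvertex (k : Fin (d + 1))
      (hk : P.corner k ∈ Icc (P.corner j.castSucc) (P.corner j.succ)) :
      P.sidePoint j (P.corner k) ∈ P.vertices := ⟨k, P.bdry_eq_sidePoint hk⟩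
  have hside := (P.corner_castSucc_lt_succ j).le
  rcases le_or_gt q (P.corner j.castSucc) with h | h
  · exact ⟨_, mem_uIcc_of_ge h hs.1.le, hs.1.ne, hvertex _ (left_mem_Icc.2 hside)⟩
  · have hq' : P.corner j.succ ≤ q := not_lt.1 fun hlt => hq ⟨h, hlt⟩
    exact ⟨_, mem_uIcc_of_le hs.2.le hq', hs.2.ne', hvertex _ (right_mem_Icc.2 hside)⟩

lemma antitone_foot_sidePoint {i j : Fin d} {θ : ℝ} (hslope : P.slope i j θ ≤ 0) :
    Antitone fun p => P.foot i θ (P.sidePoint j p) := fun p q hpq => by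
  have := mul_nonpos_of_nonneg_of_nonpos (sub_nonneg.2 hpq) hslope
  rw [← foot_sidePoint_sub] at this
  exact sub_nonpos.1 this

/-- Otherwise some ray between the two would have length zero, and the sides would cross. -/
lemma HitsSide.frame_im_pos_of_foot_mem {i j : Fin d} {s θ s' q : ℝ} (h : P.HitsSide i s θ j s')
    (hq : q ∈ P.openSide j) (hfoot : P.foot i θ (P.sidePoint j q) ∈ P.openSide i) :
    0 < (P.frame i (P.sidePoint j q)).im := by
  by_contra! hneg
  have hconn : IsPreconnected
      (P.openSide j ∩ (fun p => P.foot i θ (P.sidePoint j p)) ⁻¹' P.openSide i) :=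
    (ordConnected_Ioo.inter
      (ordConnected_Ioo.preimage_anti (antitone_foot_sidePoint h.slope_neg.le))).isPreconnected
  have hcont : Continuous fun p => (P.frame i (P.sidePoint j p)).im :=
    Complex.continuous_im.comp ((P.continuous_frame i).comp (P.continuous_sidePoint j))
  obtain ⟨p, ⟨hpj, hpi⟩, hp : (P.frame i (P.sidePoint j p)).im = 0⟩ :=
    hconn.intermediate_value ⟨hq, hfoot⟩
      ⟨h.hit_mem, by rw [mem_preimage, h.foot_eq]; exact h.base_mem⟩ hcont.continuousOn
      ⟨hneg, h.height_pos.le⟩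
  rw [mem_preimage, foot, hp, zero_mul, sub_zero] at hpi
  obtain rfl := (P.sidePoint_unique hpj hpi (P.eq_sidePoint_of_im_eq_zero hp)).1
  simpa using h.height_pos

lemma sign_mul_foot_sub_neg {i j : Fin d} {s₀ θ₀ ε s' p : ℝ} (hslope : P.slope i j θ₀ < 0)
    (hs' : 0 ≤ ε * (s' - P.hitCoord i j s₀ θ₀)) (hp : 0 < ε * (p - s')) :
    ε * (P.foot i θ₀ (P.sidePoint j p) - s₀) < 0 := by
  have hfoot := P.foot_sidePoint_sub i j θ₀ p (P.hitCoord i j s₀ θ₀)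
  rw [foot_hitCoord hslope.ne] at hfoot
  rw [hfoot, ← mul_assoc]
  exact mul_neg_of_pos_of_neg (by linarith) hslope

lemma sign_mul_hitCoord_sub_pos {i j : Fin d} {s t θ ε : ℝ} (hslope : P.slope i j θ < 0)
    (hst : ε * s < ε * t) : 0 < ε * (P.hitCoord i j s θ - P.hitCoord i j t θ) := by
  have hfoot := P.foot_sidePoint_sub i j θ (P.hitCoord i j s θ) (P.hitCoord i j t θ)
  rw [foot_hitCoord hslope.ne, foot_hitCoord hslope.ne] at hfoot
  have hneg : 0 < -(ε * (s - t)) := by linarith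
  rw [hfoot, ← mul_assoc] at hneg
  exact pos_of_mul_neg_left (by linarith) hslope.le

/-- If a ray that has not yet crossed the reference trajectory hits side `j`, then a parallel ray
that starts closer to the reference one cannot hit an aligned vertex: side `j`, extended from the
hit point, cuts the parallel ray before the vertex, and does so before side `j` ends, because the
end points of side `j` are not aligned. -/
lemma HitsSide.not_hitsVertex {i j : Fin d} {s t θ s' s₀ θ₀ ε : ℝ} {w : ℂ}
    (h : P.HitsSide i t θ j s') (hθ₀ : θ₀ ∈ Ioo (-(π / 2)) (π / 2)) (hε : ε = 1 ∨ ε = -1)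
    (hangle : 0 < ε * (θ - θ₀)) (hslope : P.slope i j θ₀ < 0)
    (hs' : 0 ≤ ε * (s' - P.hitCoord i j s₀ θ₀)) (hs : s ∈ P.openSide i) (hst : ε * s ≤ ε * t)
    (haligned : ∀ p ∈ uIcc s t, ∀ v ∈ P.vertices, P.foot i θ v = p → P.foot i θ₀ v = s₀) :
    ¬ P.HitsVertex i s θ w := by
  intro hw
  have hθ := h.angle_mem
  have hlt : ε * s < ε * t := hst.lt_of_ne fun heq => by
    obtain rfl : s = t := by rcases hε with rfl | rfl <;> linarith
    exact h.notMem_singularSet (hw.mem_singularSet hs hθ)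
  have hq : 0 < ε * (P.hitCoord i j s θ - s') :=
    h.eq_hitCoord ▸ sign_mul_hitCoord_sub_pos h.slope_neg hlt
  have hfootq := foot_hitCoord h.slope_neg.ne s
  set q := P.hitCoord i j s θ
  have hqside : q ∈ P.openSide j := by
    by_contra hqside
    obtain ⟨c, hc, hne, hvertex⟩ := exists_vertex_mem_uIcc h.hit_mem hqside
    have hfootc := (antitone_foot_sidePoint h.slope_neg.le).mapsTo_uIcc hc
    rw [h.foot_eq, hfootq, uIcc_comm] at hfootc
    have hcpos : 0 < ε * (c - s') := by
      rcases hε with rfl | rfl <;> rcases mem_uIcc.1 hc with hc | hc <;>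
        rcases hne.lt_or_gt with hne | hne <;> linarith
    have := sign_mul_foot_sub_neg hslope hs' hcpos
    rw [haligned _ hfootc _ hvertex rfl, sub_self, mul_zero] at this
    exact lt_irrefl _ this
  have hqheight := h.frame_im_pos_of_foot_mem hqside (hfootq.symm ▸ hs)
  have hlower : (P.frame i (P.sidePoint j q)).im < (P.frame i w).im := by
    have hwfoot := hw.fliesTo.foot_eq hθ
    have hw₀ := haligned s left_mem_uIcc w hw.vertex_mem hwfoot
    have hneg := sign_mul_foot_sub_neg hslope hs' hq
    have hdiff : ε * (P.foot i θ₀ (P.sidePoint j q) - s₀) =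
        ((P.frame i (P.sidePoint j q)).im - (P.frame i w).im) *
          (ε * (Real.tan θ - Real.tan θ₀)) := by
      linear_combination ε * (hfootq - P.foot_sub_foot i θ θ₀ (P.sidePoint j q) - hwfoot +
        P.foot_sub_foot i θ θ₀ w + hw₀)
    rw [hdiff] at hneg
    exact sub_neg.1 (neg_of_mul_neg_left hneg (sign_mul_tan_sub_pos hθ hθ₀ hε hangle).le)
  exact P.notMem_domain_of_mem_frontier (P.sidePoint_mem_frontier (Ioo_subset_Icc_self hqside))
    (hw.fliesTo.mem_domain_of_foot_eq hθ hfootq ⟨hqheight, hlower⟩)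

lemma HitsSide.side_eq_of_forall_not_hitsVertex {i j k : Fin d} {s t θ s' t' : ℝ}
    (hs : P.HitsSide i s θ j s') (ht : P.HitsSide i t θ k t')
    (hv : ∀ p ∈ uIcc s t, ∀ w, ¬ P.HitsVertex i p θ w) : j = k := by
  have hside : uIcc s t ⊆ P.openSide i := ordConnected_Ioo.uIcc_subset hs.base_mem ht.base_mem
  have hconn : IsPreconnected (uIcc s t ×ˢ {θ}) := isPreconnected_uIcc.prod isPreconnected_singleton
  have hhit := HitsSide.of_isPreconnected hconn (x := (s, θ)) (y := (t, θ))
    (fun x hx => hside hx.1) (by rintro ⟨p, _⟩ ⟨-, rfl⟩; exact hs.angle_mem)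
    (by rintro ⟨p, _⟩ ⟨hp, rfl⟩; exact hv p hp) ⟨left_mem_uIcc, rfl⟩ ⟨right_mem_uIcc, rfl⟩ hs
  exact (hhit.unique ht).1

/-- Here `0 ≤ ε * (t' - P.hitCoord i k s₀ θ₀)` says that the ray from `(t, θ)` hits the boundary
before it crosses the trajectory of `(s₀, θ₀)`. -/
lemma exists_ball_side_eq (i : Fin d) (s₀ : ℝ) {θ₀ ε : ℝ} (hθ₀ : θ₀ ∈ Ioo (-(π / 2)) (π / 2))
    (hε : ε = 1 ∨ ε = -1) :
    ∃ r > 0, ∀ s t θ, (s, θ) ∈ Metric.ball (s₀, θ₀) r → (t, θ) ∈ Metric.ball (s₀, θ₀) r →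
      0 < ε * (θ - θ₀) → ε * s ≤ ε * t → ∀ j k s' t', P.HitsSide i s θ j s' →
      P.HitsSide i t θ k t' → P.slope i k θ₀ < 0 → 0 ≤ ε * (t' - P.hitCoord i k s₀ θ₀) →
      j = k := by
  obtain ⟨r, hr, hball⟩ := Metric.eventually_nhds_iff_ball.1 (P.eventually_foot_vertex_eq i s₀ hθ₀)
  refine ⟨r, hr, fun s t θ hsr htr hangle hst j k s' t' hs ht hslope ht' => ?_⟩
  rw [← ball_prod_same] at hsr htr hball
  have hnear : uIcc s t ⊆ Metric.ball s₀ r :=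
    (convex_ball s₀ r).ordConnected.uIcc_subset hsr.1 htr.1
  refine hs.side_eq_of_forall_not_hitsVertex ht fun p hp w => ?_
  have hpt : ε * p ≤ ε * t := by
    rcases hε with rfl | rfl <;> rcases mem_uIcc.1 hp with hp | hp <;> linarith
  exact ht.not_hitsVertex hθ₀ hε hangle hslope ht'
    (ordConnected_Ioo.uIcc_subset hs.base_mem ht.base_mem hp) hpt fun u hu =>
      hball (u, θ) ⟨hnear (uIcc_subset_uIcc_right hp hu), hsr.2⟩

/-! ### Nongrazing singularities -/

variable {η : ℝ}

variable (P) in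
/-- The vectors whose first `n` collisions are not grazing: the cosine of the angle with the normal
is at least `η`. -/
def nonGrazing (f : ℝ → ℝ) (η : ℝ) : ℕ → Set (ℝ × ℝ)
  | 0 => univ
  | n + 1 => {x | η ≤ Real.cos (P.specularMap x).2 ∧ P.billiardMap f x ∈ nonGrazing f η n}

variable (P) in
/-- The vectors that become singular exactly after `m` collisions, none of them grazing. -/
def firstSingular (f : ℝ → ℝ) (η : ℝ) (m : ℕ) : Set (ℝ × ℝ) :=
  {x | x ∉ P.singularSetIter f m ∧ (P.billiardMap f)^[m] x ∈ P.singularSet ∧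
    x ∈ P.nonGrazing f η m}

lemma firstSingular_zero : P.firstSingular f η 0 = P.singularSet := by
  ext x
  simp [firstSingular, singularSetIter_zero, nonGrazing]

lemma firstSingular_subset {m : ℕ} : P.firstSingular f η m ⊆ P.singularSetIter f (m + 1) :=
  fun _ hx => mem_singularSetIter.2 ⟨m, m.lt_succ_self, hx.2.1⟩

lemma notMem_singularSet_of_mem_firstSingular {m : ℕ} {x : ℝ × ℝ}
    (hx : x ∈ P.firstSingular f η (m + 1)) : x ∉ P.singularSet :=
  fun h => hx.1 (mem_singularSetIter_succ.2 (Or.inl h))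

lemma HitsSide.mem_firstSingular_succ_iff {i j : Fin d} {s θ s' : ℝ} {m : ℕ}
    (h : P.HitsSide i s θ j s') : (s, θ) ∈ P.firstSingular f η (m + 1) ↔
      η ≤ Real.cos (P.outAngle i j θ) ∧ P.branch f i j (s, θ) ∈ P.firstSingular f η m := by
  simp only [firstSingular, mem_ofPred_eq, mem_singularSetIter_succ, nonGrazing,
    Function.iterate_succ_apply, not_or, h.specularMap_eq, h.billiardMap_eq_branch]
  have := h.notMem_singularSet
  tauto

lemma exists_hitsVertex_of_mem {i : Fin d} {s θ : ℝ} (hs : s ∈ P.openSide i)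
    (hθ : θ ∈ Ioo (-(π / 2)) (π / 2)) (h : (s, θ) ∈ P.singularSet) :
    ∃ w, P.HitsVertex i s θ w :=
  (P.hitsSide_or_hitsVertex hs hθ).resolve_left fun ⟨_, _, hside⟩ => hside.notMem_singularSet h

lemma encard_vertices_le : P.vertices.encard ≤ d := by
  have hsub : P.vertices ⊆ range fun k : Fin d => P.bdry (P.corner k.castSucc) := fun q hq =>
    (P.exists_eq_corner_of_mem_vertices hq).imp fun _ => Eq.symm
  calc P.vertices.encard ≤ (range fun k : Fin d => P.bdry (P.corner k.castSucc)).encard :=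
        encard_le_encard hsub
    _ ≤ (univ : Set (Fin d)).encard := by rw [← image_univ]; exact encard_image_le _ _
    _ = d := by simp

lemma encard_singularSet_le (i : Fin d) {θ : ℝ} (hθ : θ ∈ Ioo (-(π / 2)) (π / 2)) :
    {s | s ∈ P.openSide i ∧ (s, θ) ∈ P.singularSet}.encard ≤ d := by
  have hsub : {s | s ∈ P.openSide i ∧ (s, θ) ∈ P.singularSet} ⊆ P.foot i θ '' P.vertices := by
    rintro s ⟨hs, h⟩
    obtain ⟨w, hw⟩ := exists_hitsVertex_of_mem hs hθ h
    exact ⟨w, hw.vertex_mem, hw.fliesTo.foot_eq hθ⟩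
  exact (encard_le_encard hsub).trans ((encard_image_le _ _).trans encard_vertices_le)

lemma encard_le_of_branch_mem {i j : Fin d} {θ : ℝ} {S : Set ℝ} {A : Set (ℝ × ℝ)}
    (hS : ∀ s ∈ S, P.HitsSide i s θ j (P.hitCoord i j s θ) ∧ P.branch f i j (s, θ) ∈ A) :
    S.encard ≤ {s | s ∈ P.openSide j ∧ (s, f (P.outAngle i j θ)) ∈ A}.encard := by
  have hinj : InjOn (fun s => P.hitCoord i j s θ) S := fun s hs t ht h => by
    rw [← (hS s hs).1.foot_eq, ← (hS t ht).1.foot_eq]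
    exact congrArg (fun p => P.foot i θ (P.sidePoint j p)) h
  rw [← hinj.encard_image]
  refine encard_le_encard ?_
  rintro _ ⟨s, hs, rfl⟩
  exact ⟨(hS s hs).1.hit_mem, (hS s hs).2⟩

lemma eventually_cos_outAngle_lt {i j : Fin d} (s₀ : ℝ) {θ₀ : ℝ}
    (hθ₀ : θ₀ ∈ Ioo (-(π / 2)) (π / 2)) (hη : 0 < η) (hslope : 0 ≤ P.slope i j θ₀) :
    ∀ᶠ x : ℝ × ℝ in 𝓝 (s₀, θ₀), ∀ s', P.HitsSide i x.1 x.2 j s' →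
      Real.cos (P.outAngle i j x.2) < η := by
  have hcont : ContinuousAt (fun θ => -(P.slope i j θ * Real.cos θ)) θ₀ :=
    ((continuousAt_slope hθ₀ i j).mul Real.continuous_cos.continuousAt).neg
  have hlt : -(P.slope i j θ₀ * Real.cos θ₀) < η :=
    (neg_nonpos.2 (mul_nonneg hslope (Real.cos_pos_of_mem_Ioo hθ₀).le)).trans_lt hη
  filter_upwards [continuousAt_snd.eventually (hcont.eventually_lt_const hlt)] with x hx s' hs'
  rwa [hs'.cos_outAngle]

lemma eventually_branch_notMem_singularSetIter (hf : IsAngleContraction f l) (n : ℕ) {i j : Fin d}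
    (s₀ : ℝ) {θ₀ ε : ℝ} (hθ₀ : θ₀ ∈ Ioo (-(π / 2)) (π / 2)) (hε : ε = 1 ∨ ε = -1)
    (hslope : P.slope i j θ₀ < 0) :
    ∀ᶠ x : ℝ × ℝ in 𝓝 (s₀, θ₀), P.HitsSide i x.1 x.2 j (P.hitCoord i j x.1 x.2) →
      0 < ε * (x.2 - θ₀) → ε * (P.hitCoord i j x.1 x.2 - P.hitCoord i j s₀ θ₀) ≤ 0 →
      P.branch f i j x ∉ P.singularSetIter f n := by
  have hε' : -ε = 1 ∨ -ε = -1 := by rcases hε with rfl | rfl <;> simp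
  filter_upwards [eventually_branch_mem_diverging hf s₀ hθ₀ hε hslope,
    (continuousAt_branch (x := (s₀, θ₀)) hf hθ₀ hslope).eventually
      (eventually_diverging_notMem (P := P) hf n j (P.hitCoord i j s₀ θ₀)
        (hf.map_mem (outAngle_mem hθ₀ hslope)) hε')] with x hdiv hreg hx hangle hcross
  exact hreg (hdiv _ hx hangle.le (by linarith) (Or.inl hangle))

/-- A vector that crossed the reference trajectory before its collision would diverge from it
afterwards, and nearby diverging vectors are not singular. -/
lemma eventually_exists_hitsSide_of_mem_firstSingular (hf : IsAngleContraction f l) (hη : 0 < η)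
    (m : ℕ) (i : Fin d) (s₀ : ℝ) {θ₀ ε : ℝ} (hθ₀ : θ₀ ∈ Ioo (-(π / 2)) (π / 2))
    (hε : ε = 1 ∨ ε = -1) :
    ∀ᶠ x : ℝ × ℝ in 𝓝 (s₀, θ₀), x.1 ∈ P.openSide i → x ∈ P.firstSingular f η (m + 1) →
      0 < ε * (x.2 - θ₀) → ∃ j, P.HitsSide i x.1 x.2 j (P.hitCoord i j x.1 x.2) ∧
        P.slope i j θ₀ < 0 ∧ 0 ≤ ε * (P.hitCoord i j x.1 x.2 - P.hitCoord i j s₀ θ₀) := by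
  have hgrazing : ∀ᶠ x : ℝ × ℝ in 𝓝 (s₀, θ₀), ∀ j, 0 ≤ P.slope i j θ₀ → ∀ s',
      P.HitsSide i x.1 x.2 j s' → Real.cos (P.outAngle i j x.2) < η :=
    eventually_all.2 fun j =>
      eventually_imp_distrib_left.2 fun h => eventually_cos_outAngle_lt s₀ hθ₀ hη h
  have hregular : ∀ᶠ x : ℝ × ℝ in 𝓝 (s₀, θ₀), ∀ j, P.slope i j θ₀ < 0 →
      P.HitsSide i x.1 x.2 j (P.hitCoord i j x.1 x.2) → 0 < ε * (x.2 - θ₀) →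
      ε * (P.hitCoord i j x.1 x.2 - P.hitCoord i j s₀ θ₀) ≤ 0 →
      P.branch f i j x ∉ P.singularSetIter f (m + 1) :=
    eventually_all.2 fun j => eventually_imp_distrib_left.2 fun h =>
      eventually_branch_notMem_singularSetIter hf (m + 1) s₀ hθ₀ hε h
  filter_upwards [eventually_angle_mem (x := (s₀, θ₀)) hθ₀, hgrazing, hregular]
    with x hθ hgraz hreg hs hx hangle
  obtain ⟨j, s', hj⟩ := exists_hitsSide_of_notMem hs hθ (notMem_singularSet_of_mem_firstSingular hx)
  obtain ⟨hcos, hnext⟩ := hj.mem_firstSingular_succ_iff.1 hx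
  have hslope : P.slope i j θ₀ < 0 := by
    by_contra! h
    exact (hgraz j h s' hj).not_ge hcos
  obtain rfl := hj.eq_hitCoord
  refine ⟨j, hj, hslope, ?_⟩
  by_contra! h
  exact hreg j hslope hj hangle h.le (firstSingular_subset hnext)

/-- Since all these vectors hit the same side, the bound is inherited from the next collision. -/
lemma exists_nhds_encard_openSide_firstSingular_succ_le (hf : IsAngleContraction f l) (hη : 0 < η)
    {m : ℕ}
    (ih : ∀ (j : Fin d) (s₁ : ℝ) {θ₁ : ℝ}, θ₁ ∈ Ioo (-(π / 2)) (π / 2) → ∃ U ∈ 𝓝 (s₁, θ₁),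
      ∀ θ, {s | s ∈ P.openSide j ∧ (s, θ) ∈ U ∩ P.firstSingular f η m}.encard ≤ d)
    (i : Fin d) (s₀ : ℝ) {θ₀ ε : ℝ} (hθ₀ : θ₀ ∈ Ioo (-(π / 2)) (π / 2))
    (hε : ε = 1 ∨ ε = -1) :
    ∃ U ∈ 𝓝 (s₀, θ₀), ∀ θ, 0 < ε * (θ - θ₀) →
      {s | s ∈ P.openSide i ∧ (s, θ) ∈ U ∩ P.firstSingular f η (m + 1)}.encard ≤ d := by
  obtain ⟨r, hr, hsame⟩ := exists_ball_side_eq (P := P) i s₀ hθ₀ hε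
  choose! U hU hcard using fun j => ih j (P.hitCoord i j s₀ θ₀) (θ₁ := f (P.outAngle i j θ₀))
  have hbranch : ∀ᶠ x in 𝓝 (s₀, θ₀), ∀ j, P.slope i j θ₀ < 0 → P.branch f i j x ∈ U j :=
    eventually_all.2 fun j => eventually_imp_distrib_left.2 fun h =>
      (continuousAt_branch (x := (s₀, θ₀)) hf hθ₀ h).eventually
        (hU j (hf.map_mem (outAngle_mem hθ₀ h)))
  obtain ⟨V, hV, hmem⟩ := ((hbranch.and (Metric.ball_mem_nhds _ hr)).and
    (eventually_exists_hitsSide_of_mem_firstSingular (P := P) hf hη m i s₀ hθ₀ hε)).exists_mem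
  refine ⟨V, hV, fun θ hangle => ?_⟩
  set S := {s | s ∈ P.openSide i ∧ (s, θ) ∈ V ∩ P.firstSingular f η (m + 1)}
  have hhit : ∀ s ∈ S, ∃ j, P.HitsSide i s θ j (P.hitCoord i j s θ) ∧ P.slope i j θ₀ < 0 ∧
      0 ≤ ε * (P.hitCoord i j s θ - P.hitCoord i j s₀ θ₀) := fun s hs =>
    (hmem _ hs.2.1).2 hs.1 hs.2.2 hangle
  have hside_le : ∀ s ∈ S, ∀ t ∈ S, ε * s ≤ ε * t → ∀ j k s' t', P.HitsSide i s θ j s' →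
      P.HitsSide i t θ k t' → j = k := by
    intro s hs t ht hst j k s' t' hj hk
    obtain ⟨k', hk', hslope, hcross⟩ := hhit t ht
    obtain ⟨rfl, rfl⟩ := hk.unique hk'
    exact hsame s t θ (hmem _ hs.2.1).1.2 (hmem _ ht.2.1).1.2 hangle hst j k _ _ hj hk hslope hcross
  rcases S.eq_empty_or_nonempty with hS | ⟨t, ht⟩
  · simp [hS]
  obtain ⟨j, hj, hslope, -⟩ := hhit t ht
  refine (encard_le_of_branch_mem (f := f) (j := j) fun s hs => ?_).trans
    (hcard j (hf.map_mem (outAngle_mem hθ₀ hslope)) (f (P.outAngle i j θ)))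
  obtain ⟨k, hk, -, -⟩ := hhit s hs
  obtain rfl : k = j := (le_total (ε * s) (ε * t)).elim
    (fun h => hside_le s hs t ht h _ _ _ _ hk hj)
    (fun h => (hside_le t ht s hs h _ _ _ _ hj hk).symm)
  exact ⟨hk, (hmem _ hs.2.1).1.1 k hslope, (hk.mem_firstSingular_succ_iff.1 hs.2.2).2⟩

/-- That the bound does not depend on `m` is what makes the number of cuts grow only linearly. -/
lemma exists_nhds_encard_openSide_firstSingular_le (hf : IsAngleContraction f l) (hη : 0 < η)
    (m : ℕ) (i : Fin d) (s₀ : ℝ) {θ₀ : ℝ} (hθ₀ : θ₀ ∈ Ioo (-(π / 2)) (π / 2)) :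
    ∃ U ∈ 𝓝 (s₀, θ₀), ∀ θ,
      {s | s ∈ P.openSide i ∧ (s, θ) ∈ U ∩ P.firstSingular f η m}.encard ≤ d := by
  induction m generalizing i s₀ θ₀ with
  | zero =>
    refine ⟨{x | x.2 ∈ Ioo (-(π / 2)) (π / 2)}, eventually_angle_mem (x := (s₀, θ₀)) hθ₀,
      fun θ => ?_⟩
    by_cases hθ : θ ∈ Ioo (-(π / 2)) (π / 2)
    · refine (encard_le_encard ?_).trans (P.encard_singularSet_le i hθ)
      rintro s ⟨hs, -, h⟩
      exact ⟨hs, firstSingular_zero (P := P) ▸ h⟩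
    · refine (encard_eq_zero.2 (eq_empty_of_forall_notMem fun s hs => hθ hs.2.1)).trans_le ?_
      exact zero_le
  | succ m ih =>
    obtain ⟨U₁, hU₁, hcard₁⟩ :=
      exists_nhds_encard_openSide_firstSingular_succ_le hf hη ih i s₀ hθ₀ (Or.inl rfl)
    obtain ⟨U₂, hU₂, hcard₂⟩ :=
      exists_nhds_encard_openSide_firstSingular_succ_le hf hη ih i s₀ hθ₀ (Or.inr rfl)
    obtain ⟨V, hV, hparallel⟩ :=
      ((eventually_diverging_notMem (P := P) hf (m + 2) i s₀ hθ₀ (Or.inl rfl)).and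
        (eventually_diverging_notMem (P := P) hf (m + 2) i s₀ hθ₀ (Or.inr rfl))).exists_mem
    refine ⟨U₁ ∩ U₂ ∩ V, inter_mem (inter_mem hU₁ hU₂) hV, fun θ => ?_⟩
    rcases lt_trichotomy θ θ₀ with hlt | rfl | hgt
    · refine (encard_le_encard ?_).trans (hcard₂ θ (by linarith))
      exact fun s hs => ⟨hs.1, hs.2.1.1.2, hs.2.2⟩
    · have hsub : {s | s ∈ P.openSide i ∧ (s, θ) ∈ U₁ ∩ U₂ ∩ V ∩ P.firstSingular f η (m + 1)} ⊆
          {s₀} := by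
        rintro s ⟨hs, ⟨-, hsV⟩, hsing⟩
        by_contra hne
        rcases lt_or_gt_of_ne hne with h | h
        · exact (hparallel _ hsV).2 ⟨hs, by linarith, by simp, by linarith⟩
            (firstSingular_subset hsing)
        · exact (hparallel _ hsV).1 ⟨hs, by linarith, by simp, by linarith⟩
            (firstSingular_subset hsing)
      calc _ ≤ (1 : ℕ∞) := encard_singleton s₀ ▸ encard_le_encard hsub
        _ ≤ d := Nat.one_le_cast.2 i.pos
    · refine (encard_le_encard ?_).trans (hcard₁ θ (by linarith))
      exact fun s hs => ⟨hs.1, hs.2.1.1.1, hs.2.2⟩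

/-- Unlike the local bound, this one is uniform but grows with `m`. -/
lemma encard_openSide_firstSingular_le (hf : IsAngleContraction f l) (m : ℕ) (i : Fin d) {θ : ℝ}
    (hθ : θ ∈ Ioo (-(π / 2)) (π / 2)) :
    {s | s ∈ P.openSide i ∧ (s, θ) ∈ P.firstSingular f η m}.encard ≤ (d ^ (m + 1) : ℕ) := by
  induction m generalizing i θ with
  | zero =>
    rw [firstSingular_zero, zero_add, pow_one]
    exact encard_singularSet_le i hθ
  | succ m ih =>
    let S (j : Fin d) : Set ℝ := {s | P.HitsSide i s θ j (P.hitCoord i j s θ) ∧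
      P.branch f i j (s, θ) ∈ P.firstSingular f η m}
    have hsub : {s | s ∈ P.openSide i ∧ (s, θ) ∈ P.firstSingular f η (m + 1)} ⊆
        ⋃ j, S j := by
      rintro s ⟨hs, h⟩
      obtain ⟨j, s', hj⟩ :=
        exists_hitsSide_of_notMem (x := (s, θ)) hs hθ (notMem_singularSet_of_mem_firstSingular h)
      obtain rfl := hj.eq_hitCoord
      exact mem_iUnion.2 ⟨j, hj, (hj.mem_firstSingular_succ_iff.1 h).2⟩
    have hcard (j : Fin d) : (S j).encard ≤ (d ^ (m + 1) : ℕ) := by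
      rcases (S j).eq_empty_or_nonempty with hS | ⟨s, hs⟩
      · simp [hS]
      · exact (encard_le_of_branch_mem fun s hs => hs).trans (ih j (hf.map_mem hs.1.outAngle_mem))
    calc _ ≤ (⋃ j, S j).encard := encard_le_encard hsub
      _ ≤ ∑ j, (S j).encard := encard_iUnion_le_of_fintype S
      _ ≤ ∑ _ : Fin d, ((d ^ (m + 1) : ℕ) : ℕ∞) := Finset.sum_le_sum fun j _ => hcard j
      _ = (d ^ (m + 1 + 1) : ℕ) := by simp [pow_succ' d (m + 1)]

end PolygonalTable

/-! ### Consecutive flights between parallel sides -/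

lemma zero_mem_Ioo_pi_div_two : (0 : ℝ) ∈ Ioo (-(π / 2)) (π / 2) := by
  simp [Real.pi_pos]

lemma IsAngleContraction.map_zero {f : ℝ → ℝ} {l : ℝ} (hf : IsAngleContraction f l) : f 0 = 0 := by
  simpa using hf.abs_le 0 zero_mem_Ioo_pi_div_two

namespace PolygonalTable

variable {d : ℕ} {P : PolygonalTable d} {f : ℝ → ℝ} {l : ℝ}

lemma dir_eq_dir_mul_relDir (i j : Fin d) : P.dir j = P.dir i * P.relDir i j := by
  rw [relDir]
  linear_combination (-P.dir j) * P.conj_dir_mul_dir i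

lemma NoParallelSidesFacing.relDir_ne (hP : P.NoParallelSidesFacing) {i j : Fin d} {s s' : ℝ}
    (h : P.HitsSide i s 0 j s') : P.relDir i j ≠ -1 := by
  intro hrel
  obtain ⟨t, ht, hhit, hdom⟩ := h.fliesTo
  have hray (u : ℝ) : P.ray i s 0 u = P.sidePoint i s + (u * Complex.I) * P.dir i := by
    simp [ray]
  have hflight : P.sidePoint j s' - P.sidePoint i s = (t * Complex.I) * P.dir i := by
    rw [← hhit, hray, add_sub_cancel_left]
  have horth : inner ℝ (P.sidePoint j s' - P.sidePoint i s) (P.dir i) = 0 := by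
    have hconj : P.dir i * (starRingEnd ℂ) ((t * Complex.I) * P.dir i) = -(t * Complex.I) := by
      rw [map_mul, map_mul, Complex.conj_I, Complex.conj_ofReal]
      linear_combination (-(t * Complex.I)) * P.conj_dir_mul_dir i
    rw [hflight, Complex.inner, hconj]
    simp
  have hne : P.sidePoint i s ≠ P.sidePoint j s' := by
    rw [ne_comm, ← sub_ne_zero, hflight, ← norm_ne_zero_iff]
    simpa [P.norm_dir] using ht.ne'
  have hsegment : openSegment ℝ (P.sidePoint i s) (P.sidePoint j s') ⊆ P.domain := by
    rw [openSegment_eq_image']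
    rintro _ ⟨u, hu, rfl⟩
    have hmem := hdom (u * t) ⟨mul_pos hu.1 ht, mul_lt_of_lt_one_left ht hu.2⟩
    rw [hray] at hmem
    convert hmem using 2
    rw [hflight, Complex.real_smul]
    push_cast
    ring
  refine P.sidePoint_notMem_vertices h.base_mem (hP i j _ ⟨s, Ioo_subset_Icc_self h.base_mem,
    P.bdry_eq_of_mem_openSide h.base_mem⟩ _ ⟨s', Ioo_subset_Icc_self h.hit_mem,
    P.bdry_eq_of_mem_openSide h.hit_mem⟩ hne hsegment horth ?_).1
  rw [dir_eq_dir_mul_relDir i j, hrel, mul_neg_one, inner_neg_right, horth, neg_zero]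

lemma eventually_relDir_ne_of_diverging (hP : P.NoParallelSidesFacing) (i : Fin d) (s₀ : ℝ)
    {ε : ℝ} (hε : ε = 1 ∨ ε = -1) :
    ∀ᶠ x : ℝ × ℝ in 𝓝 (s₀, 0), x ∈ P.diverging i s₀ 0 ε → ∀ j s', P.HitsSide i x.1 x.2 j s' →
      P.relDir i j ≠ -1 := by
  rcases P.eventually_hitsSide_of_diverging i s₀ zero_mem_Ioo_pi_div_two hε with
    hempty | ⟨j, hhit, s, s', horth⟩
  · filter_upwards [hempty] with x hx hx' using absurd hx' hx
  · filter_upwards [hhit] with x hx hx' k s' hk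
    rw [← ((hx hx').unique hk).1]
    exact hP.relDir_ne horth

lemma HitsSide.outAngle_eq_neg {i j : Fin d} {s θ s' : ℝ} (h : P.HitsSide i s θ j s')
    (hrel : P.relDir i j = -1) : P.outAngle i j θ = -θ := by
  simp [outAngle, hrel, Real.arcsin_sin h.angle_mem.1.le h.angle_mem.2.le]

/-- After a flight between parallel sides, either the outgoing vector diverges from the orthogonal
one, or the reversed flight does. -/
lemma eventually_relDir_ne_of_relDir_eq (hf : IsAngleContraction f l)
    (hP : P.NoParallelSidesFacing) {i j : Fin d} (hrel : P.relDir i j = -1) (s₀ : ℝ) {ε : ℝ}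
    (hε : ε = 1 ∨ ε = -1) :
    ∀ᶠ x : ℝ × ℝ in 𝓝 (s₀, 0), 0 < ε * x.2 → ∀ s' k s'', P.HitsSide i x.1 x.2 j s' →
      P.HitsSide j s' (f (P.outAngle i j x.2)) k s'' → P.relDir j k ≠ -1 := by
  have h0 := zero_mem_Ioo_pi_div_two
  have hε' : -ε = 1 ∨ -ε = -1 := by rcases hε with rfl | rfl <;> simp
  have hslope : P.slope i j 0 < 0 := by simp [slope, hrel]
  have hout : P.outAngle i j 0 = 0 := by simp [outAngle, hrel]
  have hbranch : P.branch f i j (s₀, 0) = (P.hitCoord i j s₀ 0, 0) := by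
    rw [branch, hout, hf.map_zero]
  have hforward := continuousAt_branch (x := (s₀, 0)) hf h0 hslope
  have hbackward : ContinuousAt (fun x : ℝ × ℝ => (P.hitCoord i j x.1 x.2, x.2)) (s₀, 0) :=
    (continuousAt_hitCoord (x := (s₀, 0)) h0 hslope.ne).prodMk continuousAt_snd
  rw [ContinuousAt, hbranch] at hforward
  have hdiv := eventually_branch_mem_diverging hf s₀ h0 hε hslope
  rw [hout, hf.map_zero] at hdiv
  filter_upwards [hdiv, hforward.eventually (eventually_relDir_ne_of_diverging hP j _ hε'),
    hbackward.eventually (eventually_relDir_ne_of_diverging hP j (P.hitCoord i j s₀ 0) hε)]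
    with x hxdiv hxforward hxbackward hpos s' k s'' hs' hs''
  rw [← sub_zero x.2] at hpos
  simp only [branch, ← hs'.eq_hitCoord] at hxforward hxbackward
  rcases le_or_gt 0 (-ε * (s' - P.hitCoord i j s₀ 0)) with h | h
  · exact hxforward (hxdiv s' hs' hpos.le h (Or.inl hpos)) k s'' hs''
  · have hreverse := hs'.reverse
    rw [hs'.outAngle_eq_neg hrel, neg_neg] at hreverse
    have hmem : (s', x.2) ∈ P.diverging j (P.hitCoord i j s₀ 0) 0 ε :=
      ⟨hs'.hit_mem, by linarith, hpos.le, by simp only; linarith⟩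
    exact absurd (by simp [P.relDir_symm i j, hrel]) (hxbackward hmem i x.1 hreverse)

lemma eventually_not_parallel (hf : IsAngleContraction f l) (hP : P.NoParallelSidesFacing)
    (i : Fin d) (s₀ : ℝ) :
    ∀ᶠ x : ℝ × ℝ in 𝓝 (s₀, 0), ∀ j s' k s'', P.HitsSide i x.1 x.2 j s' →
      P.HitsSide j s' (f (P.outAngle i j x.2)) k s'' → P.relDir i j = -1 →
      P.relDir j k ≠ -1 := by
  refine eventually_all.2 fun j => ?_
  by_cases hrel : P.relDir i j = -1
  swap
  · exact Eventually.of_forall fun _ _ _ _ _ _ h => absurd h hrel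
  filter_upwards [eventually_relDir_ne_of_relDir_eq hf hP hrel s₀ (Or.inl rfl),
    eventually_relDir_ne_of_relDir_eq hf hP hrel s₀ (Or.inr rfl)]
    with x hpos hneg s' k s'' hs' hs'' _
  rcases lt_trichotomy x.2 0 with h | h | h
  · exact hneg (by linarith) s' k s'' hs' hs''
  · exact absurd hrel (hP.relDir_ne (h ▸ hs'))
  · exact hpos (by linarith) s' k s'' hs' hs''

lemma HitsSide.relDir_re {i j : Fin d} {s θ s' : ℝ} (h : P.HitsSide i s θ j s') :
    (P.relDir i j).re = -Real.cos (θ + P.outAngle i j θ) := by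
  rw [Real.cos_add, P.sin_outAngle, h.cos_outAngle, slope_mul_cos h.angle_mem]
  linear_combination (-(P.relDir i j).re) * Real.sin_sq_add_cos_sq θ

lemma neg_one_lt_relDir_re {i j : Fin d} (h : P.relDir i j ≠ -1) : -1 < (P.relDir i j).re := by
  have hunit := P.relDir_sq i j
  refine lt_of_le_of_ne (by nlinarith [sq_nonneg (P.relDir i j).im]) fun hre => h ?_
  rw [← hre] at hunit
  exact Complex.ext (by simp [← hre]) (by simpa using hunit)

variable (P) in
lemma exists_relDir_eq_of_abs_lt : ∃ r > 0, ∀ i s θ j s', P.HitsSide i s θ j s' → |θ| < r →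
    |P.outAngle i j θ| < r → P.relDir i j = -1 := by
  have hev : ∀ᶠ u : ℝ in 𝓝 0, ∀ i j, P.relDir i j ≠ -1 → -Real.cos u < (P.relDir i j).re := by
    simp only [eventually_all]
    intro i j hij
    exact (by fun_prop : Continuous fun u => -Real.cos u).continuousAt.eventually_lt_const
      (by simpa using neg_one_lt_relDir_re hij)
  obtain ⟨r, hr, hball⟩ := Metric.eventually_nhds_iff.1 hev
  refine ⟨r / 2, half_pos hr, fun i s θ j s' h hθ hout => ?_⟩
  by_contra hne
  have hlt := hball (y := θ + P.outAngle i j θ)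
    (by rw [Real.dist_eq, sub_zero]; linarith [abs_add_le θ (P.outAngle i j θ)]) i j hne
  exact hlt.ne h.relDir_re.symm

lemma exists_uniform_angle (hf : IsAngleContraction f l) (hP : P.NoParallelSidesFacing) :
    ∃ κ > 0, ∀ i s θ j s' k s'', P.HitsSide i s θ j s' →
      P.HitsSide j s' (f (P.outAngle i j θ)) k s'' → |θ| < κ → |P.outAngle i j θ| < κ →
      κ ≤ |P.outAngle j k (f (P.outAngle i j θ))| := by
  have hev : ∀ᶠ θ : ℝ in 𝓝 0, ∀ s ∈ Icc (0 : ℝ) 1, ∀ i j s' k s'', P.HitsSide i s θ j s' →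
      P.HitsSide j s' (f (P.outAngle i j θ)) k s'' → P.relDir i j = -1 → P.relDir j k ≠ -1 :=
    isCompact_Icc.eventually_forall_of_forall_eventually fun s₀ _ =>
      (continuous_swap.tendsto ((0 : ℝ), s₀)).eventually
        (eventually_all.2 fun i => eventually_not_parallel hf hP i s₀)
  obtain ⟨r, hr, hparallel⟩ := Metric.eventually_nhds_iff.1 hev
  obtain ⟨r', hr', horth⟩ := P.exists_relDir_eq_of_abs_lt
  refine ⟨min r r', lt_min hr hr', fun i s θ j s' k s'' hs' hs'' hθ hout => ?_⟩
  by_contra! hout'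
  have hθ' := (hf.abs_apply_le hs'.outAngle_mem).trans_lt hout
  rw [lt_min_iff] at hθ hout hθ' hout'
  exact hparallel (by simpa using hθ.1) s
    (Ioo_subset_Icc_self (P.openSide_subset i hs'.base_mem)) i j s' k s'' hs' hs''
    (horth i s θ j s' hs' hθ.2 hout.2) (horth j s' _ k s'' hs'' hθ'.2 hout'.2)

end PolygonalTable

/-! ### Expansion along a trajectory -/

namespace IsAngleContraction

variable {f : ℝ → ℝ} {l : ℝ}

lemma cos_mul_abs_le (hf : IsAngleContraction f l) {θ : ℝ} (hθ : θ ∈ Ioo (-(π / 2)) (π / 2)) :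
    Real.cos (l * |θ|) ≤ Real.cos (f θ) := by
  have hl : l * |θ| ≤ |θ| := mul_le_of_le_one_left (abs_nonneg θ) hf.lt_one.le
  have habs : |θ| < π / 2 := abs_lt.2 hθ
  rw [← Real.cos_abs (f θ)]
  exact Real.cos_le_cos_of_nonneg_of_le_pi (abs_nonneg _) (by linarith [Real.pi_pos])
    (hf.abs_le θ hθ)

lemma one_le_cos_div_cos (hf : IsAngleContraction f l) {θ : ℝ}
    (hθ : θ ∈ Ioo (-(π / 2)) (π / 2)) : 1 ≤ Real.cos (f θ) / Real.cos θ := by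
  have habs : |θ| < π / 2 := abs_lt.2 hθ
  rw [one_le_div (Real.cos_pos_of_mem_Ioo hθ), ← Real.cos_abs θ, ← Real.cos_abs (f θ)]
  exact Real.cos_le_cos_of_nonneg_of_le_pi (abs_nonneg _) (by linarith [Real.pi_pos])
    (hf.abs_apply_le hθ)

end IsAngleContraction

lemma cos_mul_mul_cos_le {l κ θ : ℝ} (hl₀ : 0 ≤ l) (hl₁ : l ≤ 1) (hκ : 0 ≤ κ) (hκθ : κ ≤ θ)
    (hθ : θ ≤ π / 2) : Real.cos (l * κ) * Real.cos θ ≤ Real.cos (l * θ) * Real.cos κ := by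
  have hlκ : l * κ ≤ κ := mul_le_of_le_one_left hκ hl₁
  have hlκ₀ : 0 ≤ l * κ := mul_nonneg hl₀ hκ
  have hlθ₀ : 0 ≤ l * θ := mul_nonneg hl₀ (hκ.trans hκθ)
  have hdiff : 0 ≤ (1 - l) * (θ - κ) := mul_nonneg (by linarith) (by linarith)
  have hsum : Real.cos (θ + l * κ) ≤ Real.cos (l * θ + κ) :=
    Real.cos_le_cos_of_nonneg_of_le_pi (by linarith) (by linarith) (by linarith)
  have hsub : Real.cos (θ - l * κ) ≤ Real.cos (l * θ - κ) := by
    rw [← Real.cos_abs (l * θ - κ)]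
    refine Real.cos_le_cos_of_nonneg_of_le_pi (abs_nonneg _) (by linarith [Real.pi_pos]) ?_
    exact abs_le.2 ⟨by nlinarith, by nlinarith⟩
  rw [Real.cos_add, Real.cos_add] at hsum
  rw [Real.cos_sub, Real.cos_sub] at hsub
  linarith

lemma IsAngleContraction.exists_one_lt_le_cos_div_cos {f : ℝ → ℝ} {l : ℝ}
    (hf : IsAngleContraction f l) {κ : ℝ} (hκ : 0 < κ) :
    ∃ σ > 1, ∀ θ ∈ Ioo (-(π / 2)) (π / 2), κ ≤ |θ| → σ ≤ Real.cos (f θ) / Real.cos θ := by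
  have hπ := Real.pi_gt_three
  have hκ₀ : 0 < min κ 1 := lt_min hκ one_pos
  have hκ₁ : min κ 1 ≤ 1 := min_le_right κ 1
  have hcos : 0 < Real.cos (min κ 1) := Real.cos_pos_of_mem_Ioo ⟨by linarith, by linarith⟩
  refine ⟨Real.cos (l * min κ 1) / Real.cos (min κ 1), ?_, fun θ hθ hκθ => ?_⟩
  · rw [gt_iff_lt, one_lt_div hcos]
    exact Real.cos_lt_cos_of_nonneg_of_le_pi (mul_nonneg hf.nonneg hκ₀.le) (by linarith)
      (mul_lt_of_lt_one_left hκ₀ hf.lt_one)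
  · rw [div_le_div_iff₀ hcos (Real.cos_pos_of_mem_Ioo hθ), ← Real.cos_abs θ]
    exact (cos_mul_mul_cos_le hf.nonneg hf.lt_one.le hκ₀.le ((min_le_left κ 1).trans hκθ)
      (abs_lt.2 hθ).le).trans (mul_le_mul_of_nonneg_right (hf.cos_mul_abs_le hθ) hcos.le)

namespace PolygonalTable

variable {d : ℕ} {P : PolygonalTable d} {f : ℝ → ℝ} {l : ℝ}

variable (P) in
/-- The vectors based at interior points of the sides whose first `n` collisions are defined. -/
def regular (f : ℝ → ℝ) (n : ℕ) : Set (ℝ × ℝ) :=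
  {x | (∃ i, x.1 ∈ P.openSide i) ∧ x.2 ∈ Ioo (-(π / 2)) (π / 2)} \ P.singularSetIter f n

lemma exists_hitsSide_of_mem_regular {n : ℕ} {x : ℝ × ℝ} (hx : x ∈ P.regular f (n + 1)) :
    ∃ i j s', P.HitsSide i x.1 x.2 j s' := by
  obtain ⟨⟨⟨i, hi⟩, hθ⟩, hsing⟩ := hx
  rw [mem_singularSetIter_succ, not_or] at hsing
  exact ⟨i, exists_hitsSide_of_notMem hi hθ hsing.1⟩

lemma billiardMap_mem_regular (hf : IsAngleContraction f l) {n : ℕ} {x : ℝ × ℝ}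
    (hx : x ∈ P.regular f (n + 1)) : P.billiardMap f x ∈ P.regular f n := by
  obtain ⟨i, j, s', hj⟩ := exists_hitsSide_of_mem_regular hx
  have hsing := hx.2
  rw [mem_singularSetIter_succ, not_or] at hsing
  refine ⟨?_, hsing.2⟩
  rw [show P.billiardMap f x = _ from hj.billiardMap_eq f]
  exact ⟨⟨j, hj.hit_mem⟩, hf.map_mem hj.outAngle_mem⟩

lemma HitsSide.mem_regular (hf : IsAngleContraction f l) {n : ℕ} {i j : Fin d} {s θ s' : ℝ}
    (h : P.HitsSide i s θ j s') (hx : (s, θ) ∈ P.regular f (n + 1)) :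
    (s', f (P.outAngle i j θ)) ∈ P.regular f n :=
  h.billiardMap_eq f ▸ billiardMap_mem_regular hf hx

lemma HitsSide.exists_next (hf : IsAngleContraction f l) {n : ℕ} {i j : Fin d} {s θ s' : ℝ}
    (h : P.HitsSide i s θ j s') (hx : (s, θ) ∈ P.regular f (n + 2)) :
    ∃ k s'', P.HitsSide j s' (f (P.outAngle i j θ)) k s'' := by
  have hsing := (h.mem_regular hf hx).2
  rw [mem_singularSetIter_succ, not_or] at hsing
  exact exists_hitsSide_of_notMem (x := (s', f (P.outAngle i j θ))) h.hit_mem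
    (hf.map_mem h.outAngle_mem) hsing.1

lemma specularMap_snd_mem {n : ℕ} {x : ℝ × ℝ} (hx : x ∈ P.regular f (n + 1)) :
    (P.specularMap x).2 ∈ Ioo (-(π / 2)) (π / 2) := by
  obtain ⟨i, j, s', hj⟩ := exists_hitsSide_of_mem_regular hx
  rw [show P.specularMap x = _ from hj.specularMap_eq]
  exact hj.outAngle_mem

variable (P) in
/-- The factor by which the reflection law `f` changes the expansion at the first collision. -/
def gain (f : ℝ → ℝ) (x : ℝ × ℝ) : ℝ :=
  Real.cos (f (P.specularMap x).2) / Real.cos (P.specularMap x).2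

variable (P) in
/-- The expansion coefficient of the `n`-th iterate divided by the cosine of the initial angle. -/
def growth (f : ℝ → ℝ) : ℕ → ℝ × ℝ → ℝ
  | 0, x => (Real.cos x.2)⁻¹
  | n + 1, x => P.gain f x * growth f n (P.billiardMap f x)

lemma HitsSide.gain_eq {i j : Fin d} {s θ s' : ℝ} (h : P.HitsSide i s θ j s') (f : ℝ → ℝ) :
    P.gain f (s, θ) = Real.cos (f (P.outAngle i j θ)) / Real.cos (P.outAngle i j θ) := by
  rw [gain, h.specularMap_eq]

lemma one_le_gain (hf : IsAngleContraction f l) {n : ℕ} {x : ℝ × ℝ}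
    (hx : x ∈ P.regular f (n + 1)) : 1 ≤ P.gain f x :=
  hf.one_le_cos_div_cos (specularMap_snd_mem hx)

lemma one_le_growth (hf : IsAngleContraction f l) {n : ℕ} {x : ℝ × ℝ}
    (hx : x ∈ P.regular f n) : 1 ≤ P.growth f n x := by
  induction n generalizing x with
  | zero => exact (one_le_inv₀ (Real.cos_pos_of_mem_Ioo hx.1.2)).2 (Real.cos_le_one _)
  | succ n ih =>
    exact one_le_mul_of_one_le_of_one_le (one_le_gain hf hx) (ih (billiardMap_mem_regular hf hx))

lemma growth_ge_of_notMem_nonGrazing (hf : IsAngleContraction f l) {η : ℝ} (hη : 0 < η) {n : ℕ}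
    {x : ℝ × ℝ} (hx : x ∈ P.regular f n) (hgraze : x ∉ P.nonGrazing f η n) :
    Real.cos (l * (π / 2)) / η ≤ P.growth f n x := by
  induction n generalizing x with
  | zero => exact absurd (mem_univ x) hgraze
  | succ n ih =>
    have hnext := billiardMap_mem_regular hf hx
    have hgrowth := one_le_growth hf hnext
    by_cases hcos : η ≤ Real.cos (P.specularMap x).2
    · exact (ih hnext fun h => hgraze ⟨hcos, h⟩).trans
        (le_mul_of_one_le_left (zero_le_one.trans hgrowth) (one_le_gain hf hx))
    · have hθ := specularMap_snd_mem hx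
      have habs : |(P.specularMap x).2| < π / 2 := abs_lt.2 hθ
      have hlπ : l * (π / 2) ≤ π / 2 := mul_le_of_le_one_left Real.pi_div_two_pos.le hf.lt_one.le
      have hlπ₀ : 0 ≤ l * (π / 2) := mul_nonneg hf.nonneg Real.pi_div_two_pos.le
      have hc : Real.cos (l * (π / 2)) ≤ Real.cos (f (P.specularMap x).2) :=
        (Real.cos_le_cos_of_nonneg_of_le_pi (mul_nonneg hf.nonneg (abs_nonneg _)) (by linarith)
          (mul_le_mul_of_nonneg_left habs.le hf.nonneg)).trans (hf.cos_mul_abs_le hθ)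
      have hc₀ : 0 ≤ Real.cos (l * (π / 2)) :=
        Real.cos_nonneg_of_neg_pi_div_two_le_of_le (by linarith) hlπ
      have hgain : Real.cos (l * (π / 2)) / η ≤ P.gain f x :=
        div_le_div₀ (hc₀.trans hc) hc (Real.cos_pos_of_mem_Ioo hθ) (not_le.1 hcos).le
      exact hgain.trans (le_mul_of_one_le_right ((div_nonneg hc₀ hη.le).trans hgain) hgrowth)

lemma exists_one_lt_le_gain (hf : IsAngleContraction f l) (hP : P.NoParallelSidesFacing) :
    ∃ σ > 1, ∀ x ∈ P.regular f 3, σ ≤ P.gain f x ∨ σ ≤ P.gain f (P.billiardMap f x) ∨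
      σ ≤ P.gain f (P.billiardMap f (P.billiardMap f x)) := by
  obtain ⟨κ, hκ, hangle⟩ := exists_uniform_angle hf hP
  obtain ⟨σ, hσ, hrate⟩ := hf.exists_one_lt_le_cos_div_cos hκ
  refine ⟨σ, hσ, fun (s, θ) hx => ?_⟩
  obtain ⟨i, j, s₁, h₁⟩ := exists_hitsSide_of_mem_regular hx
  obtain ⟨k, s₂, h₂⟩ := h₁.exists_next hf hx
  obtain ⟨m, s₃, h₃⟩ := h₂.exists_next hf (h₁.mem_regular hf hx)
  rw [h₁.billiardMap_eq, h₂.billiardMap_eq, h₁.gain_eq, h₂.gain_eq, h₃.gain_eq]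
  by_contra! hlt
  have hsmall {θ : ℝ} (hθ : θ ∈ Ioo (-(π / 2)) (π / 2))
      (h : Real.cos (f θ) / Real.cos θ < σ) : |θ| < κ :=
    not_le.1 fun hκθ => h.not_ge (hrate θ hθ hκθ)
  have hθ₁ := (hf.abs_apply_le h₁.outAngle_mem).trans_lt (hsmall h₁.outAngle_mem hlt.1)
  exact (hangle _ _ _ _ _ _ _ h₂ h₃ hθ₁ (hsmall h₂.outAngle_mem hlt.2.1)).not_gt
    (hsmall h₃.outAngle_mem hlt.2.2)

lemma exists_pow_le_growth (hf : IsAngleContraction f l) (hP : P.NoParallelSidesFacing) :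
    ∃ σ > 1, ∀ n, ∀ x ∈ P.regular f n, σ ^ (n / 3) ≤ P.growth f n x := by
  obtain ⟨σ, hσ, hgain⟩ := exists_one_lt_le_gain hf hP
  refine ⟨σ, hσ, fun n => ?_⟩
  induction n using Nat.strong_induction_on with
  | _ n ih =>
  intro x hx
  rcases lt_or_ge n 3 with hn | hn
  · rw [Nat.div_eq_of_lt hn, pow_zero]
    exact one_le_growth hf hx
  obtain ⟨m, rfl⟩ := Nat.exists_eq_add_of_le' hn
  have hx₁ := billiardMap_mem_regular hf hx
  have hx₂ := billiardMap_mem_regular hf hx₁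
  have hx₃ := billiardMap_mem_regular hf hx₂
  have h₁ := one_le_gain hf hx
  have h₂ := one_le_gain hf hx₁
  have h₃ := one_le_gain hf hx₂
  have hthree : σ ≤ P.gain f x *
      (P.gain f (P.billiardMap f x) * P.gain f (P.billiardMap f (P.billiardMap f x))) := by
    have hx' : x ∈ P.regular f 3 := ⟨hx.1, fun h => hx.2 (singularSetIter_mono hn h)⟩
    rcases hgain x hx' with h | h | h
    · exact h.trans (le_mul_of_one_le_right (by linarith) (one_le_mul_of_one_le_of_one_le h₂ h₃))
    · exact (h.trans (le_mul_of_one_le_right (by linarith) h₃)).trans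
        (le_mul_of_one_le_left (by nlinarith) h₁)
    · exact (h.trans (le_mul_of_one_le_left (by linarith) h₂)).trans
        (le_mul_of_one_le_left (by nlinarith) h₁)
  rw [Nat.add_div_right _ (by norm_num), pow_succ']
  simp only [growth]
  rw [← mul_assoc (P.gain f (P.billiardMap f x)), ← mul_assoc]
  exact mul_le_mul hthree (ih m (by omega) _ hx₃) (by positivity) (by nlinarith)

lemma HitsSide.eventuallyEq_branch {i j : Fin d} {s θ s' : ℝ} (h : P.HitsSide i s θ j s')
    (f : ℝ → ℝ) : P.billiardMap f =ᶠ[𝓝 (s, θ)] P.branch f i j := by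
  filter_upwards [h.eventually] with x hx using hx.billiardMap_eq f

lemma differentiableAt_outAngle {i j : Fin d} {θ : ℝ} (hθ : θ ∈ Ioo (-(π / 2)) (π / 2))
    (hslope : P.slope i j θ < 0) : DifferentiableAt ℝ (P.outAngle i j) θ := by
  have hsin (u : ℝ) (hu : u ^ 2 = 1) : Real.sin (P.outAngle i j θ) ≠ u := fun h => by
    have hcos := pow_pos (Real.cos_pos_of_mem_Ioo (outAngle_mem hθ hslope)) 2
    have hsum := Real.sin_sq_add_cos_sq (P.outAngle i j θ)
    rw [h, hu] at hsum
    linarith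
  rw [sin_outAngle] at hsin
  exact (Real.differentiableAt_arcsin.2 ⟨hsin (-1) (by norm_num), hsin 1 (by norm_num)⟩).comp θ
    (by fun_prop)

lemma differentiableAt_branch (hf : IsAngleContraction f l) {i j : Fin d} {x : ℝ × ℝ}
    (hθ : x.2 ∈ Ioo (-(π / 2)) (π / 2)) (hslope : P.slope i j x.2 < 0) :
    DifferentiableAt ℝ (P.branch f i j) x := by
  have htan : DifferentiableAt ℝ (fun x : ℝ × ℝ => Real.tan x.2) x :=
    DifferentiableAt.comp (g := Real.tan) x
      (Real.differentiableAt_tan.2 (Real.cos_pos_of_mem_Ioo hθ).ne') differentiableAt_snd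
  have hnum : DifferentiableAt ℝ (fun x : ℝ × ℝ => x.1 - (P.relBase i j).re +
      (P.relBase i j).im * Real.tan x.2) x :=
    (differentiableAt_fst.sub_const _).add (htan.const_mul _)
  have hden : DifferentiableAt ℝ (fun x : ℝ × ℝ => P.slope i j x.2) x :=
    (htan.const_mul _).const_sub _
  have hcoord : DifferentiableAt ℝ (fun x : ℝ × ℝ => P.hitCoord i j x.1 x.2) x := by
    simp only [hitCoord, div_eq_mul_inv]
    exact hnum.fun_mul (hden.fun_inv hslope.ne)
  have hangle : DifferentiableAt ℝ (f ∘ P.outAngle i j) x.2 :=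
    (hf.differentiableAt (outAngle_mem hθ hslope)).comp x.2 (differentiableAt_outAngle hθ hslope)
  exact hcoord.prodMk
    (DifferentiableAt.comp (g := f ∘ P.outAngle i j) x hangle differentiableAt_snd)

lemma fderiv_branch_apply (hf : IsAngleContraction f l) {i j : Fin d} {x : ℝ × ℝ}
    (hθ : x.2 ∈ Ioo (-(π / 2)) (π / 2)) (hslope : P.slope i j x.2 < 0) :
    fderiv ℝ (P.branch f i j) x (1, 0) = ((P.slope i j x.2)⁻¹, 0) := by
  have hline : HasDerivAt (fun t : ℝ => (t, x.2)) ((1 : ℝ), (0 : ℝ)) x.1 :=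
    (hasDerivAt_id x.1).prodMk (hasDerivAt_const x.1 x.2)
  have hcomp := (differentiableAt_branch hf hθ hslope).hasFDerivAt.comp_hasDerivAt
    (f := fun t : ℝ => (t, x.2)) x.1 hline
  have hcoord : HasDerivAt (fun t => P.hitCoord i j t x.2) (P.slope i j x.2)⁻¹ x.1 := by
    unfold hitCoord
    simpa [div_eq_mul_inv] using (((hasDerivAt_id x.1).sub_const (P.relBase i j).re).add_const
      ((P.relBase i j).im * Real.tan x.2)).div_const (P.slope i j x.2)
  exact hcomp.unique (hcoord.prodMk (hasDerivAt_const x.1 (f (P.outAngle i j x.2))))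

lemma HitsSide.inv_slope {i j : Fin d} {s θ s' : ℝ} (h : P.HitsSide i s θ j s') :
    (P.slope i j θ)⁻¹ = -(Real.cos θ / Real.cos (P.outAngle i j θ)) := by
  have hcos := (Real.cos_pos_of_mem_Ioo h.angle_mem).ne'
  have hslope := h.slope_neg.ne
  rw [h.cos_outAngle]
  field_simp

lemma fderiv_iterate_billiardMap (hf : IsAngleContraction f l) {n : ℕ} {x : ℝ × ℝ}
    (hx : x ∈ P.regular f n) : DifferentiableAt ℝ (P.billiardMap f)^[n] x ∧
      fderiv ℝ (P.billiardMap f)^[n] x (1, 0) =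
        ((-1) ^ n * (Real.cos x.2 * P.growth f n x), 0) := by
  induction n generalizing x with
  | zero =>
    refine ⟨differentiableAt_id, ?_⟩
    simp [growth, (Real.cos_pos_of_mem_Ioo hx.1.2).ne']
  | succ n ih =>
    obtain ⟨i, j, s', hj⟩ := exists_hitsSide_of_mem_regular hx
    obtain ⟨hdiff, hderiv⟩ := ih (billiardMap_mem_regular hf hx)
    have heq := hj.eventuallyEq_branch f
    have hstep : DifferentiableAt ℝ (P.billiardMap f) x :=
      (differentiableAt_branch hf hj.angle_mem hj.slope_neg).congr_of_eventuallyEq heq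
    have hscale : fderiv ℝ (P.billiardMap f) x (1, 0) =
        (-(Real.cos x.2 / Real.cos (P.outAngle i j x.2))) • ((1 : ℝ), (0 : ℝ)) := by
      rw [heq.fderiv_eq, fderiv_branch_apply hf hj.angle_mem hj.slope_neg, hj.inv_slope]
      simp
    rw [Function.iterate_succ]
    refine ⟨hdiff.comp x hstep, ?_⟩
    have hgain : P.gain f x = _ := hj.gain_eq f
    have hmap : P.billiardMap f x = _ := hj.billiardMap_eq f
    rw [fderiv_comp x hdiff hstep, ContinuousLinearMap.comp_apply, hscale, map_smul, hderiv,
      growth, hgain, hmap, Prod.smul_mk, smul_zero, smul_eq_mul]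
    congr 1
    ring

lemma expansion_eq (hf : IsAngleContraction f l) {n : ℕ} {x : ℝ × ℝ} (hx : x ∈ P.regular f n) :
    P.expansion f n x = ENNReal.ofReal (Real.cos x.2 * P.growth f n x) := by
  have hcos : 0 ≤ Real.cos x.2 := (Real.cos_pos_of_mem_Ioo hx.1.2).le
  have hgrowth : 0 ≤ P.growth f n x := zero_le_one.trans (one_le_growth hf hx)
  rw [expansion, (fderiv_iterate_billiardMap hf hx).2, ← ofReal_norm, WithLp.prod_norm_eq_of_L2]
  simp [Real.sqrt_sq_eq_abs, ENNReal.ofReal_mul hcos, abs_of_nonneg hcos, abs_of_nonneg hgrowth]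

end PolygonalTable

/-! ### Components of a cut segment -/

section Components

variable {X : Type*} [TopologicalSpace X]

lemma subset_of_mem_componentsOf {A γ : Set X} (hγ : γ ∈ componentsOf A) : γ ⊆ A := by
  obtain ⟨p, -, rfl⟩ := hγ
  exact connectedComponentIn_subset A p

lemma nonempty_of_mem_componentsOf {A γ : Set X} (hγ : γ ∈ componentsOf A) : γ.Nonempty := by
  obtain ⟨p, hp, rfl⟩ := hγ
  exact ⟨p, mem_connectedComponentIn hp⟩

lemma eq_connectedComponentIn_of_mem_componentsOf {A γ : Set X} (hγ : γ ∈ componentsOf A) {x : X}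
    (hx : x ∈ γ) : γ = connectedComponentIn A x := by
  obtain ⟨p, -, rfl⟩ := hγ
  exact connectedComponentIn_eq hx

lemma componentsOf_prod_singleton {Y : Type*} [TopologicalSpace Y] (A : Set X) (y : Y) :
    componentsOf (A ×ˢ {y}) = (· ×ˢ {y}) '' componentsOf A := by
  have hcomp {x : X} (hx : x ∈ A) :
      connectedComponentIn (A ×ˢ {y}) (x, y) = connectedComponentIn A x ×ˢ {y} := by
    refine Subset.antisymm (fun p hp => ⟨?_, (connectedComponentIn_subset _ _ hp).2⟩) ?_
    · have hpre : IsPreconnected (Prod.fst '' connectedComponentIn (A ×ˢ {y}) (x, y)) :=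
        isPreconnected_connectedComponentIn.image Prod.fst continuousOn_fst
      exact hpre.subset_connectedComponentIn
        (mem_image_of_mem Prod.fst (mem_connectedComponentIn (mk_mem_prod hx (mem_singleton y))))
        (image_subset_iff.2 fun q hq => (connectedComponentIn_subset _ _ hq).1)
        (mem_image_of_mem Prod.fst hp)
    · have hpre : IsPreconnected (connectedComponentIn A x ×ˢ ({y} : Set Y)) :=
        isPreconnected_connectedComponentIn.prod isPreconnected_singleton
      exact hpre.subset_connectedComponentIn ⟨mem_connectedComponentIn hx, rfl⟩
        (prod_mono_left (connectedComponentIn_subset A x))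
  unfold componentsOf
  rw [image_image, prod_singleton, image_image]
  exact image_congr fun x hx => by rw [← prod_singleton, hcomp hx]

variable {A γ : Set ℝ}

lemma Ico_sSup_subset_of_mem_componentsOf (hγ : γ ∈ componentsOf A) {x : ℝ} (hx : x ∈ γ) :
    Ico x (sSup γ) ⊆ γ := by
  obtain ⟨p, -, rfl⟩ := hγ
  rintro s ⟨hxs, hs⟩
  obtain ⟨y, hy, hsy⟩ := exists_lt_of_lt_csSup ⟨x, hx⟩ hs
  exact isPreconnected_connectedComponentIn.ordConnected.out hx hy ⟨hxs, hsy.le⟩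

lemma lt_sSup_of_mem_componentsOf (hA : IsOpen A) (hbdd : BddAbove A) (hγ : γ ∈ componentsOf A)
    {x : ℝ} (hx : x ∈ γ) : x < sSup γ := by
  have hopen : IsOpen γ := by
    obtain ⟨p, -, rfl⟩ := hγ
    exact hA.connectedComponentIn
  have hnhds : γ ∈ 𝓝[>] x := mem_nhdsWithin_of_mem_nhds (hopen.mem_nhds hx)
  obtain ⟨y, hy, hxy⟩ := Filter.nonempty_of_mem (inter_mem hnhds self_mem_nhdsWithin)
  exact lt_of_lt_of_le hxy (le_csSup (hbdd.mono (subset_of_mem_componentsOf hγ)) hy)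

lemma sSup_notMem_of_mem_componentsOf (hA : IsOpen A) (hbdd : BddAbove A)
    (hγ : γ ∈ componentsOf A) : sSup γ ∉ A := fun hsup => by
  obtain ⟨x, hx⟩ := nonempty_of_mem_componentsOf hγ
  have hlt := lt_sSup_of_mem_componentsOf hA hbdd hγ hx
  have hsub : Icc x (sSup γ) ⊆ A := by
    rw [← Ico_union_right hlt.le]
    exact union_subset ((Ico_sSup_subset_of_mem_componentsOf hγ hx).trans
      (subset_of_mem_componentsOf hγ)) (singleton_subset_iff.2 hsup)
  have hmem : sSup γ ∈ connectedComponentIn A x :=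
    isPreconnected_Icc.subset_connectedComponentIn (left_mem_Icc.2 hlt.le) hsub
      (right_mem_Icc.2 hlt.le)
  rw [← eq_connectedComponentIn_of_mem_componentsOf hγ hx] at hmem
  exact (lt_sSup_of_mem_componentsOf hA hbdd hγ hmem).false

lemma injOn_sSup_componentsOf (hA : IsOpen A) (hbdd : BddAbove A) :
    InjOn sSup (componentsOf A) := by
  intro γ hγ γ' hγ' hsup
  obtain ⟨x, hx⟩ := nonempty_of_mem_componentsOf hγ
  obtain ⟨x', hx'⟩ := nonempty_of_mem_componentsOf hγ'
  have hlt := lt_sSup_of_mem_componentsOf hA hbdd hγ hx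
  have hlt' := lt_sSup_of_mem_componentsOf hA hbdd hγ' hx'
  have hmem : max x x' ∈ γ := Ico_sSup_subset_of_mem_componentsOf hγ hx
    ⟨le_max_left x x', max_lt hlt (hsup ▸ hlt')⟩
  have hmem' : max x x' ∈ γ' := Ico_sSup_subset_of_mem_componentsOf hγ' hx'
    ⟨le_max_right x x', max_lt (hsup ▸ hlt) hlt'⟩
  rw [eq_connectedComponentIn_of_mem_componentsOf hγ hmem,
    eq_connectedComponentIn_of_mem_componentsOf hγ' hmem']

/-- Every component ends at a cut or at the right end of the segment. -/
lemma encard_le_of_subset_componentsOf {N : Set (ℝ × ℝ)} {a b θ : ℝ} {T : Set (Set (ℝ × ℝ))}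
    (hT : T ⊆ componentsOf (Ioo a b ×ˢ {θ} \ N)) (hfin : {s ∈ Ioo a b | (s, θ) ∈ N}.Finite)
    {Z : Set ℝ} (hZ : ∀ γ ∈ T, ∃ x, (x, θ) ∈ γ ∧ ∀ r ∈ Ioo x b, (r, θ) ∈ N →
      (∀ s ∈ Ico x r, (s, θ) ∉ N) → r ∈ Z) : T.encard ≤ Z.encard + 1 := by
  set A : Set ℝ := Ioo a b \ {s ∈ Ioo a b | (s, θ) ∈ N} with hAdef
  have hA : IsOpen A := isOpen_Ioo.sdiff hfin.isClosed
  have hbdd : BddAbove A := bddAbove_Ioo.mono sdiff_subset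
  have hprod : Ioo a b ×ˢ {θ} \ N = A ×ˢ {θ} := by
    ext ⟨s, t⟩
    simp only [hAdef, Set.mem_sdiff, mem_prod, mem_singleton_iff]
    grind
  rw [hprod, componentsOf_prod_singleton] at hT
  obtain ⟨T', hT', rfl⟩ := subset_image_iff.1 hT
  have hend : MapsTo sSup T' (insert b Z) := fun γ hγ => by
    obtain ⟨x, ⟨hx, -⟩, hcut⟩ := hZ _ (mem_image_of_mem _ hγ)
    have hsub : Ico x (sSup γ) ⊆ A := (Ico_sSup_subset_of_mem_componentsOf (hT' hγ) hx).trans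
      (subset_of_mem_componentsOf (hT' hγ))
    have hlt := lt_sSup_of_mem_componentsOf hA hbdd (hT' hγ) hx
    have hle : sSup γ ≤ b := csSup_le ⟨x, hx⟩ fun s hs =>
      (subset_of_mem_componentsOf (hT' hγ) hs).1.2.le
    refine hle.eq_or_lt.imp id fun hltb => hcut _ ⟨hlt, hltb⟩ ?_ fun s hs hN =>
      (hsub hs).2 ⟨(hsub hs).1, hN⟩
    by_contra hN
    have hax := (hsub (left_mem_Ico.2 hlt)).1.1
    exact sSup_notMem_of_mem_componentsOf hA hbdd (hT' hγ) ⟨⟨hax.trans hlt, hltb⟩, fun h => hN h.2⟩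
  calc ((· ×ˢ {θ}) '' T').encard ≤ T'.encard := encard_image_le _ _
    _ ≤ (insert b Z).encard :=
      encard_le_encard_of_injOn hend ((injOn_sSup_componentsOf hA hbdd).mono hT')
    _ ≤ Z.encard + 1 := encard_insert_le Z b

end Components

/-! ### Periodicity in the arclength parameter -/

namespace PolygonalTable

variable {d : ℕ} {P : PolygonalTable d} {f : ℝ → ℝ} {l η : ℝ}

lemma bdry_add_intCast (s : ℝ) (k : ℤ) : P.bdry (s + k) = P.bdry s := by
  rw [← P.bdry_fract, Int.fract_add_intCast, P.bdry_fract]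

lemma deriv_bdry_add_intCast (s : ℝ) (k : ℤ) : deriv P.bdry (s + k) = deriv P.bdry s := by
  rw [← deriv_comp_add_const, funext fun s => P.bdry_add_intCast s k]

lemma specularMap_add_intCast (s θ : ℝ) (k : ℤ) :
    P.specularMap (s + k, θ) = P.specularMap (s, θ) := by
  simp only [specularMap, hitParam, hitPoint, flightTime, velocity, bdry_add_intCast,
    deriv_bdry_add_intCast]

lemma billiardMap_add_intCast (s θ : ℝ) (k : ℤ) :
    P.billiardMap f (s + k, θ) = P.billiardMap f (s, θ) := by
  simp only [billiardMap, specularMap_add_intCast]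

lemma add_intCast_mem_singularSet {s θ : ℝ} (k : ℤ) :
    (s + k, θ) ∈ P.singularSet ↔ (s, θ) ∈ P.singularSet := by
  simp only [singularSet, vertexSet, hitVertexSet, phaseBoundary, hitPoint, flightTime, velocity,
    bdry_add_intCast, deriv_bdry_add_intCast, mem_union, mem_ofPred_eq]

lemma add_intCast_mem_singularSetIter {n : ℕ} {s θ : ℝ} (k : ℤ) :
    (s + k, θ) ∈ P.singularSetIter f n ↔ (s, θ) ∈ P.singularSetIter f n := by
  cases n with
  | zero => simp only [singularSetIter_zero, mem_empty_iff_false]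
  | succ n =>
    rw [mem_singularSetIter_succ, mem_singularSetIter_succ, add_intCast_mem_singularSet,
      billiardMap_add_intCast]

lemma add_intCast_mem_nonGrazing {n : ℕ} {s θ : ℝ} (k : ℤ) :
    (s + k, θ) ∈ P.nonGrazing f η n ↔ (s, θ) ∈ P.nonGrazing f η n := by
  cases n with
  | zero => exact Iff.rfl
  | succ n =>
    simp only [nonGrazing, mem_ofPred_eq, billiardMap_add_intCast, specularMap_add_intCast]

lemma add_intCast_mem_firstSingular {m : ℕ} {s θ : ℝ} (k : ℤ) :
    (s + k, θ) ∈ P.firstSingular f η m ↔ (s, θ) ∈ P.firstSingular f η m := by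
  cases m with
  | zero => simp only [firstSingular_zero, add_intCast_mem_singularSet]
  | succ m =>
    simp only [firstSingular, mem_ofPred_eq, add_intCast_mem_singularSetIter,
      add_intCast_mem_nonGrazing, Function.iterate_succ_apply, billiardMap_add_intCast]

lemma expansion_add_intCast {n : ℕ} (hn : n ≠ 0) (s θ : ℝ) (k : ℤ) :
    P.expansion f n (s + k, θ) = P.expansion f n (s, θ) := by
  obtain ⟨n, rfl⟩ := Nat.exists_eq_succ_of_ne_zero hn
  have hadd (y : ℝ × ℝ) : y + ((k : ℝ), (0 : ℝ)) = (y.1 + k, y.2) := by ext <;> simp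
  have hperiodic : (fun y : ℝ × ℝ => (P.billiardMap f)^[n + 1] (y + ((k : ℝ), (0 : ℝ)))) =
      (P.billiardMap f)^[n + 1] := by
    funext y
    rw [hadd, Function.iterate_succ_apply, Function.iterate_succ_apply, billiardMap_add_intCast]
  rw [expansion, expansion, ← hadd (s, θ), ← fderiv_comp_add_right, hperiodic]

lemma exists_sub_floor_mem_openSide {s θ : ℝ} (hθ : θ ∈ Ioo (-(π / 2)) (π / 2))
    (h : (s, θ) ∉ P.singularSet) : ∃ i, s - ⌊s⌋ ∈ P.openSide i := by
  obtain ⟨i, hle, hlt⟩ := P.exists_mem_Ico ⟨Int.fract_nonneg s, Int.fract_lt_one s⟩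
  refine ⟨i, hle.lt_of_ne fun heq => h (Or.inl (Or.inl ⟨?_, hθ⟩)), hlt⟩
  exact P.bdry_fract s ▸ ⟨i.castSucc, congrArg P.bdry heq⟩

lemma sub_floor_mem_regular {n : ℕ} (hn : n ≠ 0) {s θ : ℝ} (hθ : θ ∈ Ioo (-(π / 2)) (π / 2))
    (h : (s, θ) ∉ P.singularSetIter f n) : (s - ⌊s⌋, θ) ∈ P.regular f n := by
  refine ⟨⟨exists_sub_floor_mem_openSide hθ fun hsing => h ?_, hθ⟩, fun hsing => h ?_⟩
  · exact mem_singularSetIter.2 ⟨0, Nat.pos_of_ne_zero hn, hsing⟩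
  · rwa [← add_intCast_mem_singularSetIter ⌊s⌋, sub_add_cancel] at hsing

lemma sub_mem_openSide_of_ordConnected {K : Set ℝ} (hK : K.OrdConnected) {θ : ℝ}
    (hθ : θ ∈ Ioo (-(π / 2)) (π / 2)) (h : ∀ s ∈ K, (s, θ) ∉ P.singularSet) {i : Fin d} {k : ℤ}
    {a b : ℝ} (ha : a ∈ K) (hai : a - k ∈ P.openSide i) (hb : b ∈ K) : b - k ∈ P.openSide i := by
  have hcorner (c : Fin (d + 1)) : P.corner c + k ∉ K := fun hc =>
    h _ hc (Or.inl (Or.inl ⟨by rw [bdry_add_intCast]; exact ⟨c, rfl⟩, hθ⟩))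
  obtain ⟨hleft, hright⟩ := hai
  refine ⟨?_, ?_⟩ <;> by_contra! hle
  · exact hcorner i.castSucc (hK.out hb ha ⟨by linarith, by linarith⟩)
  · exact hcorner i.succ (hK.out ha hb ⟨by linarith, by linarith⟩)

lemma exists_forall_hitsSide_of_isPreconnected {K : Set ℝ} (hK : IsPreconnected K) {a : ℝ}
    (ha : a ∈ K) {θ : ℝ} (hθ : θ ∈ Ioo (-(π / 2)) (π / 2))
    (h : ∀ s ∈ K, (s, θ) ∉ P.singularSet) :
    ∃ (k : ℤ) (i j : Fin d), ∀ s ∈ K, P.HitsSide i (s - k) θ j (P.hitCoord i j (s - k) θ) := by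
  obtain ⟨i, hi⟩ := exists_sub_floor_mem_openSide hθ (h a ha)
  have hside (s : ℝ) (hs : s ∈ K) : s - ⌊a⌋ ∈ P.openSide i :=
    sub_mem_openSide_of_ordConnected hK.ordConnected hθ h ha hi hs
  have hsing (s : ℝ) (hs : s ∈ K) : (s - ⌊a⌋, θ) ∉ P.singularSet := by
    rw [← add_intCast_mem_singularSet ⌊a⌋, sub_add_cancel]
    exact h s hs
  obtain ⟨j, s', hj⟩ := exists_hitsSide_of_notMem (x := (a - ⌊a⌋, θ)) hi hθ (hsing a ha)
  have hU : IsPreconnected ((fun s : ℝ => ((s - ⌊a⌋, θ) : ℝ × ℝ)) '' K) :=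
    hK.image _ (by fun_prop)
  refine ⟨⌊a⌋, i, j, fun s hs => HitsSide.of_isPreconnected hU (forall_mem_image.2 hside)
    (forall_mem_image.2 fun _ _ => hθ) (forall_mem_image.2 fun t ht w hw => ?_)
    (mem_image_of_mem _ ha) (mem_image_of_mem _ hs) hj⟩
  exact hsing t ht (hw.mem_singularSet (hside t ht) hθ)

/-- All the vectors of an uncut horizontal segment collide under the same angles. -/
lemma nonGrazing_of_isPreconnected (hf : IsAngleContraction f l) {m : ℕ} {K : Set ℝ}
    (hK : IsPreconnected K) {θ : ℝ} (hθ : θ ∈ Ioo (-(π / 2)) (π / 2))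
    (h : ∀ s ∈ K, (s, θ) ∉ P.singularSetIter f m) {a b : ℝ} (ha : a ∈ K) (hb : b ∈ K)
    (hng : (a, θ) ∈ P.nonGrazing f η m) : (b, θ) ∈ P.nonGrazing f η m := by
  induction m generalizing K θ a b with
  | zero => trivial
  | succ m ih =>
    simp only [mem_singularSetIter_succ, not_or] at h
    obtain ⟨k, i, j, hhit⟩ :=
      exists_forall_hitsSide_of_isPreconnected hK ha hθ fun s hs => (h s hs).1
    have hspec (s : ℝ) (hs : s ∈ K) : (P.specularMap (s, θ)).2 = P.outAngle i j θ := by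
      rw [← sub_add_cancel s (k : ℝ), specularMap_add_intCast, (hhit s hs).specularMap_eq]
    have hmap (s : ℝ) (hs : s ∈ K) :
        P.billiardMap f (s, θ) = (P.hitCoord i j (s - k) θ, f (P.outAngle i j θ)) := by
      rw [← sub_add_cancel s (k : ℝ), billiardMap_add_intCast, (hhit s hs).billiardMap_eq,
        sub_add_cancel]
    obtain ⟨hcos, hnext⟩ := hng
    rw [hspec a ha] at hcos
    rw [hmap a ha] at hnext
    refine ⟨(hspec b hb).symm ▸ hcos, ?_⟩
    rw [hmap b hb]
    have himage : IsPreconnected ((fun s => P.hitCoord i j (s - k) θ) '' K) :=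
      hK.image _ (by unfold hitCoord; fun_prop)
    refine ih himage (hf.map_mem (hhit a ha).outAngle_mem) (forall_mem_image.2 fun s hs => ?_)
      (mem_image_of_mem _ ha) (mem_image_of_mem _ hb) hnext
    rw [← hmap s hs]
    exact (h s hs).2

lemma nonGrazing_antitone : Antitone (P.nonGrazing f η) := by
  refine antitone_nat_of_succ_le fun n => ?_
  induction n with
  | zero => exact subset_univ _
  | succ n ih => exact fun x hx => ⟨hx.1, ih hx.2⟩

lemma mem_nonGrazing_neg_one (n : ℕ) (x : ℝ × ℝ) : x ∈ P.nonGrazing f (-1) n := by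
  induction n generalizing x with
  | zero => trivial
  | succ n ih => exact ⟨Real.neg_one_le_cos _, ih _⟩

lemma exists_mem_firstSingular {n : ℕ} {x : ℝ × ℝ} (h : x ∈ P.singularSetIter f n) :
    ∃ m < n, x ∉ P.singularSetIter f m ∧ (P.billiardMap f)^[m] x ∈ P.singularSet := by
  classical
  obtain ⟨k, hk, hx⟩ := mem_singularSetIter.1 h
  have hex : ∃ k, (P.billiardMap f)^[k] x ∈ P.singularSet := ⟨k, hx⟩
  refine ⟨Nat.find hex, (Nat.find_min' hex hx).trans_lt hk, fun hsing => ?_, Nat.find_spec hex⟩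
  obtain ⟨m, hm, hx'⟩ := mem_singularSetIter.1 hsing
  exact Nat.find_min hex hm hx'

/-- A half-open interval of length two with integer endpoints consists of two translates of each
side and of `2 * d` corners. -/
lemma encard_le_of_encard_openSide_le {S : Set ℝ} {u : ℤ} (hS : S ⊆ Ico (u : ℝ) (u + 2)) {B : ℕ}
    (h : ∀ (i : Fin d) (k : Fin 2),
      {s | s ∈ P.openSide i ∧ s + (u + (k : ℕ) : ℤ) ∈ S}.encard ≤ B) :
    S.encard ≤ (2 * d * (B + 1) : ℕ) := by
  let T (p : Fin d × Fin 2) : Set ℝ := (fun s : ℝ => s + (u + (p.2 : ℕ) : ℤ)) ''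
    insert (P.corner p.1.castSucc) {s | s ∈ P.openSide p.1 ∧ s + (u + (p.2 : ℕ) : ℤ) ∈ S}
  have hcover : S ⊆ ⋃ p, T p := fun s hs => by
    obtain ⟨i, hle, hlt⟩ := P.exists_mem_Ico ⟨Int.fract_nonneg s, Int.fract_lt_one s⟩
    have hfloor : u ≤ ⌊s⌋ ∧ ⌊s⌋ < u + 2 :=
      ⟨Int.le_floor.2 (hS hs).1, Int.floor_lt.2 (by exact_mod_cast (hS hs).2)⟩
    obtain ⟨k, hk⟩ : ∃ k : Fin 2, u + (k : ℕ) = ⌊s⌋ :=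
      ⟨⟨(⌊s⌋ - u).toNat, by omega⟩, by simp only; omega⟩
    refine mem_iUnion.2 ⟨(i, k), Int.fract s,
      hle.eq_or_lt.imp Eq.symm fun hlt' => ⟨⟨hlt', hlt⟩, ?_⟩, ?_⟩ <;>
      simp only [hk, Int.fract_add_floor, hs]
  have hcard (p : Fin d × Fin 2) : (T p).encard ≤ (B + 1 : ℕ) :=
    (encard_image_le _ _).trans ((encard_insert_le _ _).trans (add_le_add_left (h p.1 p.2) 1))
  calc S.encard ≤ (⋃ p, T p).encard := encard_le_encard hcover
    _ ≤ ∑ p, (T p).encard := encard_iUnion_le_of_fintype T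
    _ ≤ ∑ _ : Fin d × Fin 2, ((B + 1 : ℕ) : ℕ∞) := Finset.sum_le_sum fun p _ => hcard p
    _ = (2 * d * (B + 1) : ℕ) := by simp [mul_comm 2 d, mul_add]

end PolygonalTable

/-! ### The step expansion -/

lemma encard_sep_exists_lt_le {α : Type*} (I : Set α) (p : ℕ → α → Prop) (n : ℕ) :
    {s ∈ I | ∃ m < n, p m s}.encard ≤ ∑ m ∈ Finset.range n, {s ∈ I | p m s}.encard := by
  refine (encard_le_encard ?_).trans (Finset.set_encard_biUnion_le _ _)
  rintro s ⟨hs, m, hm, hp⟩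
  exact mem_biUnion (Finset.mem_range.2 hm) ⟨hs, hp⟩

lemma eventually_mul_add_one_lt_mul_pow_div {σ C : ℝ} (hσ : 1 < σ) (hC : 0 < C) (K : ℕ) {r : ℕ}
    (hr : r ≠ 0) : ∀ᶠ n : ℕ in atTop, ((n * K + 1 : ℕ) : ℝ) < C * σ ^ (n / r) := by
  have hq : ∀ᶠ q : ℕ in atTop, ((q * (2 * r * K + 1) : ℕ) : ℝ) < C * σ ^ q := by
    have hlim := tendsto_pow_const_div_const_pow_of_one_lt 1 hσ
    filter_upwards [hlim.eventually_lt_const (show 0 < C / (2 * r * K + 1) by positivity)]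
      with q hlt
    rw [div_lt_div_iff₀ (by positivity) (by positivity), pow_one] at hlt
    exact_mod_cast hlt
  filter_upwards [(Nat.tendsto_div_const_atTop hr).eventually hq, eventually_ge_atTop r]
    with n hn hrn
  refine lt_of_le_of_lt (Nat.cast_le.2 ?_) hn
  have hdiv : 1 ≤ n / r := (Nat.one_le_div_iff (Nat.pos_of_ne_zero hr)).2 hrn
  have hle : n ≤ 2 * r * (n / r) := by
    nlinarith [Nat.lt_mul_div_succ n (Nat.pos_of_ne_zero hr)]
  nlinarith [Nat.mul_le_mul_right K hle]

namespace PolygonalTable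

variable {d : ℕ} {P : PolygonalTable d} {f : ℝ → ℝ} {l η ϑ : ℝ}

lemma exists_nhds_encard_firstSingular_le (hf : IsAngleContraction f l) (hη : 0 < η) (m : ℕ)
    (s₀ : ℝ) {θ₀ : ℝ} (hθ₀ : θ₀ ∈ Ioo (-(π / 2)) (π / 2)) :
    ∃ U ∈ 𝓝 (s₀, θ₀), ∀ θ,
      {s | (s, θ) ∈ U ∩ P.firstSingular f η m}.encard ≤ (2 * d * (d + 1) : ℕ) := by
  choose V hV hcard using fun (i : Fin d) (k : ℤ) =>
    exists_nhds_encard_openSide_firstSingular_le (P := P) hf hη m i (s₀ - k) hθ₀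
  set u := ⌈s₀⌉ - 1 with hu
  have hs₀ : s₀ ∈ Ioo (u : ℝ) (u + 2) := by
    rw [hu]
    push_cast
    exact ⟨by linarith [Int.ceil_lt_add_one s₀], by linarith [Int.le_ceil s₀]⟩
  have hshift (k : ℤ) : Tendsto (fun x : ℝ × ℝ => (x.1 - k, x.2)) (𝓝 (s₀, θ₀)) (𝓝 (s₀ - k, θ₀)) :=
    Continuous.tendsto' (by fun_prop) _ _ rfl
  refine ⟨{x | x.1 ∈ Ioo (u : ℝ) (u + 2) ∧
    ∀ (i : Fin d) (k : Fin 2), (x.1 - (u + (k : ℕ) : ℤ), x.2) ∈ V i (u + (k : ℕ))}, ?_, fun θ => ?_⟩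
  · exact Eventually.and (continuous_fst.tendsto (s₀, θ₀) (isOpen_Ioo.mem_nhds hs₀))
      (eventually_all.2 fun i => eventually_all.2 fun k => hshift _ (hV i _))
  · refine encard_le_of_encard_openSide_le (P := P) (u := u)
      (fun s hs => Ioo_subset_Ico_self hs.1.1) fun i k =>
      (encard_le_encard fun s hs => ?_).trans (hcard i (u + (k : ℕ)) θ)
    obtain ⟨hside, ⟨-, hmem⟩, hsing⟩ := hs
    refine ⟨hside, ?_, (add_intCast_mem_firstSingular _).1 hsing⟩
    simpa only [add_sub_cancel_right] using hmem i k

lemma eventually_encard_firstSingular_le (hf : IsAngleContraction f l) (hη : 0 < η) (m : ℕ)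
    (hϑ : ϑ < π / 2) :
    ∀ᶠ δ in 𝓝[>] (0 : ℝ), ∀ a b θ : ℝ, b - a ≤ δ → |θ| ≤ ϑ →
      {s ∈ Ioo a b | (s, θ) ∈ P.firstSingular f η m}.encard ≤ (2 * d * (d + 1) : ℕ) := by
  choose! U hU hcard using fun (s θ : ℝ) (hθ : |θ| ≤ ϑ) =>
    exists_nhds_encard_firstSingular_le (P := P) hf hη m s (abs_lt.1 (hθ.trans_lt hϑ))
  obtain ⟨ε, hε, hball⟩ := Metric.uniformity_basis_dist.lebesgue_number_lemma_nhds'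
    (K := Icc (0 : ℝ) 1 ×ˢ Icc (-ϑ) ϑ) (U := fun y _ => U y.1 y.2)
    (isCompact_Icc.prod isCompact_Icc) fun y hy => hU _ _ (abs_le.2 hy.2)
  filter_upwards [Ioc_mem_nhdsGT hε] with δ hδ a b θ hab hθ
  obtain ⟨y, hy⟩ := hball (Int.fract a, θ)
    ⟨⟨Int.fract_nonneg a, (Int.fract_lt_one a).le⟩, abs_le.1 hθ⟩
  refine le_trans ?_ (hcard (y : ℝ × ℝ).1 (y : ℝ × ℝ).2 (abs_le.2 y.2.2) θ)
  refine encard_le_encard_of_injOn (f := fun s => s - ⌊a⌋) ?_ sub_left_injective.injOn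
  rintro s ⟨hs, hsing⟩
  refine ⟨hy ?_, ?_⟩
  · change dist ((Int.fract a, θ) : ℝ × ℝ) (s - ⌊a⌋, θ) < ε
    rw [Prod.dist_eq, dist_self, max_lt_iff, Real.dist_eq, Int.fract]
    exact ⟨abs_lt.2 ⟨by linarith [hs.1, hs.2, hδ.2], by linarith [hs.1]⟩, hε⟩
  · rwa [← add_intCast_mem_firstSingular ⌊a⌋, sub_add_cancel]

lemma eventually_encard_exists_firstSingular_le (hf : IsAngleContraction f l) (hη : 0 < η) (n : ℕ)
    (hϑ : ϑ < π / 2) :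
    ∀ᶠ δ in 𝓝[>] (0 : ℝ), ∀ a b θ : ℝ, b - a ≤ δ → |θ| ≤ ϑ →
      {s ∈ Ioo a b | ∃ m < n, (s, θ) ∈ P.firstSingular f η m}.encard ≤
        (n * (2 * d * (d + 1)) : ℕ) := by
  have hall : ∀ᶠ δ in 𝓝[>] (0 : ℝ), ∀ m ∈ Finset.range n, ∀ a b θ : ℝ, b - a ≤ δ → |θ| ≤ ϑ →
      {s ∈ Ioo a b | (s, θ) ∈ P.firstSingular f η m}.encard ≤ (2 * d * (d + 1) : ℕ) :=
    (eventually_all_finset _).2 fun m _ => eventually_encard_firstSingular_le hf hη m hϑ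
  filter_upwards [hall] with δ hδ a b θ hab hθ
  calc {s ∈ Ioo a b | ∃ m < n, (s, θ) ∈ P.firstSingular f η m}.encard
      ≤ ∑ m ∈ Finset.range n, {s ∈ Ioo a b | (s, θ) ∈ P.firstSingular f η m}.encard :=
        encard_sep_exists_lt_le _ _ n
    _ ≤ ∑ _ ∈ Finset.range n, ((2 * d * (d + 1) : ℕ) : ℕ∞) :=
        Finset.sum_le_sum fun m hm => hδ m hm a b θ hab hθ
    _ = (n * (2 * d * (d + 1)) : ℕ) := by simp

lemma exists_encard_singularSetIter_le (hf : IsAngleContraction f l) (n : ℕ) :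
    ∃ B : ℕ, ∀ a b θ : ℝ, b - a ≤ 1 → θ ∈ Ioo (-(π / 2)) (π / 2) →
      {s ∈ Ioo a b | (s, θ) ∈ P.singularSetIter f n}.encard ≤ B := by
  refine ⟨∑ m ∈ Finset.range n, 2 * d * (d ^ (m + 1) + 1), fun a b θ hab hθ => ?_⟩
  have hIco : Ioo a b ⊆ Ico (⌊a⌋ : ℝ) (⌊a⌋ + 2) := fun s hs =>
    ⟨(Int.floor_le a).trans hs.1.le, by linarith [hs.2, Int.lt_floor_add_one a]⟩
  have hcard (m : ℕ) : {s ∈ Ioo a b | (s, θ) ∈ P.firstSingular f (-1) m}.encard ≤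
      (2 * d * (d ^ (m + 1) + 1) : ℕ) := by
    refine encard_le_of_encard_openSide_le (P := P) (fun s hs => hIco hs.1) fun i k =>
      le_trans (encard_le_encard fun s hs => ?_)
        (encard_openSide_firstSingular_le (P := P) (η := -1) hf m i hθ)
    exact ⟨hs.1, (add_intCast_mem_firstSingular _).1 hs.2.2⟩
  calc {s ∈ Ioo a b | (s, θ) ∈ P.singularSetIter f n}.encard
      ≤ {s ∈ Ioo a b | ∃ m < n, (s, θ) ∈ P.firstSingular f (-1) m}.encard := by
        refine encard_le_encard fun s hs => ⟨hs.1, ?_⟩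
        obtain ⟨m, hm, hfree, hsing⟩ := exists_mem_firstSingular hs.2
        exact ⟨m, hm, hfree, hsing, mem_nonGrazing_neg_one m _⟩
    _ ≤ ∑ m ∈ Finset.range n, {s ∈ Ioo a b | (s, θ) ∈ P.firstSingular f (-1) m}.encard :=
        encard_sep_exists_lt_le _ _ n
    _ ≤ (∑ m ∈ Finset.range n, 2 * d * (d ^ (m + 1) + 1) : ℕ) := by
        push_cast
        exact Finset.sum_le_sum fun m _ => mod_cast hcard m

lemma finite_singularSetIter (hf : IsAngleContraction f l) (n : ℕ) {a b θ : ℝ} (hab : b - a ≤ 1)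
    (hθ : θ ∈ Ioo (-(π / 2)) (π / 2)) :
    {s ∈ Ioo a b | (s, θ) ∈ P.singularSetIter f n}.Finite := by
  obtain ⟨B, hB⟩ := exists_encard_singularSetIter_le (P := P) hf n
  exact finite_of_encard_le_coe (hB a b θ hab hθ)

lemma encard_componentsOf_le_encard_singularSetIter (hf : IsAngleContraction f l) (n : ℕ)
    {a b θ : ℝ} (hab : b - a ≤ 1) (hθ : θ ∈ Ioo (-(π / 2)) (π / 2)) :
    (componentsOf (Ioo a b ×ˢ {θ} \ P.singularSetIter f n)).encard ≤
      {s ∈ Ioo a b | (s, θ) ∈ P.singularSetIter f n}.encard + 1 := by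
  refine encard_le_of_subset_componentsOf subset_rfl (finite_singularSetIter hf n hab hθ)
    fun γ hγ => ?_
  obtain ⟨⟨x, t⟩, hx⟩ := nonempty_of_mem_componentsOf hγ
  obtain ⟨⟨hxab, rfl⟩, -⟩ := subset_of_mem_componentsOf hγ hx
  exact ⟨x, hx, fun r hr hsing _ => ⟨⟨hxab.1.trans hr.1, hr.2⟩, hsing⟩⟩

/-- A component with a nongrazing vector ends at a nongrazing singularity, since all its vectors
collide under the same angles. -/
lemma encard_nonGrazing_componentsOf_le (hf : IsAngleContraction f l) (n : ℕ)
    {a b θ : ℝ} (hab : b - a ≤ 1) (hθ : θ ∈ Ioo (-(π / 2)) (π / 2)) :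
    {γ ∈ componentsOf (Ioo a b ×ˢ {θ} \ P.singularSetIter f n) |
      (γ ∩ P.nonGrazing f η n).Nonempty}.encard ≤
      {s ∈ Ioo a b | ∃ m < n, (s, θ) ∈ P.firstSingular f η m}.encard + 1 := by
  refine encard_le_of_subset_componentsOf (fun γ hγ => hγ.1) (finite_singularSetIter hf n hab hθ) ?_
  rintro γ ⟨hγ, ⟨x, t⟩, hx, hng⟩
  obtain ⟨⟨hxab, rfl⟩, -⟩ := subset_of_mem_componentsOf hγ hx
  refine ⟨x, hx, fun r hr hsing hfree => ⟨⟨hxab.1.trans hr.1, hr.2⟩, ?_⟩⟩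
  obtain ⟨m, hm, hrm, hrsing⟩ := exists_mem_firstSingular hsing
  refine ⟨m, hm, hrm, hrsing, ?_⟩
  refine nonGrazing_of_isPreconnected hf (K := Icc x r) isPreconnected_Icc hθ (fun s hs => ?_)
    (left_mem_Icc.2 hr.1.le) (right_mem_Icc.2 hr.1.le) (nonGrazing_antitone hm.le hng)
  obtain rfl | hlt := hs.2.eq_or_lt
  · exact hrm
  · exact fun hsm => hfree s ⟨hs.1, hlt⟩ (singularSetIter_mono hm.le hsm)

lemma tsum_inv_leastExpansion_le {n : ℕ} {D : Set (Set (ℝ × ℝ))} {E : ENNReal}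
    (hE : ∀ γ ∈ D, ∀ x ∈ γ, E ≤ P.expansion f n x) :
    ∑' γ : D, (P.leastExpansion f n γ)⁻¹ ≤ D.encard / E :=
  calc ∑' γ : D, (P.leastExpansion f n γ)⁻¹ ≤ ∑' _ : D, E⁻¹ :=
        ENNReal.tsum_le_tsum fun γ => ENNReal.inv_le_inv.2 (le_iInf₂ (hE γ γ.2))
    _ = D.encard / E := by rw [ENNReal.tsum_set_const, div_eq_mul_inv]

lemma ofReal_cos_mul_le_expansion (hf : IsAngleContraction f l) {n : ℕ} (hn : n ≠ 0) {s θ G : ℝ}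
    (hθ : |θ| ≤ ϑ) (hϑ : ϑ < π / 2) (h : (s, θ) ∉ P.singularSetIter f n)
    (hG : G ≤ P.growth f n (s - ⌊s⌋, θ)) :
    ENNReal.ofReal (Real.cos ϑ * G) ≤ P.expansion f n (s, θ) := by
  have hreg := sub_floor_mem_regular hn (abs_lt.1 (hθ.trans_lt hϑ)) h
  have hcosϑ : 0 ≤ Real.cos ϑ :=
    Real.cos_nonneg_of_neg_pi_div_two_le_of_le (by linarith [abs_nonneg θ, Real.pi_pos]) hϑ.le
  have hcos : Real.cos ϑ ≤ Real.cos θ := by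
    rw [← Real.cos_abs θ]
    exact Real.cos_le_cos_of_nonneg_of_le_pi (abs_nonneg θ) (by linarith [Real.pi_pos]) hθ
  rw [← sub_add_cancel s (⌊s⌋ : ℝ), expansion_add_intCast hn, expansion_eq hf hreg]
  refine ENNReal.ofReal_le_ofReal ?_
  calc Real.cos ϑ * G ≤ Real.cos ϑ * P.growth f n (s - ⌊s⌋, θ) := by gcongr
    _ ≤ Real.cos θ * P.growth f n (s - ⌊s⌋, θ) :=
      mul_le_mul_of_nonneg_right hcos (zero_le_one.trans (one_le_growth hf hreg))

lemma eventually_tsum_nonGrazing_componentsOf_le (hf : IsAngleContraction f l) (hη : 0 < η) {n : ℕ}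
    (hn : n ≠ 0) (hϑ : ϑ < π / 2) {G : ℝ} (hG : ∀ x ∈ P.regular f n, G ≤ P.growth f n x) :
    ∀ᶠ δ in 𝓝[>] (0 : ℝ), ∀ Γ ∈ hCurves ϑ δ,
      ∑' γ : {γ ∈ componentsOf (Γ \ P.singularSetIter f n) | (γ ∩ P.nonGrazing f η n).Nonempty},
        (P.leastExpansion f n γ)⁻¹ ≤
          (n * (2 * d * (d + 1)) + 1 : ℕ) / ENNReal.ofReal (Real.cos ϑ * G) := by
  filter_upwards [eventually_encard_exists_firstSingular_le (P := P) hf hη n hϑ,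
    Ioc_mem_nhdsGT one_pos] with δ hcount hδ
  rintro _ ⟨a, b, θ, -, hab, hθ, rfl⟩
  have hangle := abs_lt.1 (hθ.trans_lt hϑ)
  refine (tsum_inv_leastExpansion_le (E := ENNReal.ofReal (Real.cos ϑ * G)) ?_).trans ?_
  · rintro γ ⟨hγ, -⟩ ⟨s, t⟩ hs
    obtain ⟨⟨-, rfl⟩, hsing⟩ := subset_of_mem_componentsOf hγ hs
    exact ofReal_cos_mul_le_expansion hf hn hθ hϑ hsing
      (hG _ (sub_floor_mem_regular hn hangle hsing))
  · gcongr
    have hcard := (encard_nonGrazing_componentsOf_le hf n (hab.trans hδ.2) hangle).trans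
      (add_le_add_left (hcount a b θ hab hθ) 1)
    exact_mod_cast hcard

/-- The number of grazing components is bounded, while their expansion can be made arbitrarily
large. -/
lemma exists_tsum_grazing_componentsOf_le (hf : IsAngleContraction f l) {n : ℕ} (hn : n ≠ 0)
    (hϑ : ϑ ∈ Ico 0 (π / 2)) {ε : ℝ} (hε : 0 < ε) :
    ∃ η > 0, ∀ δ ≤ 1, ∀ Γ ∈ hCurves ϑ δ,
      ∑' γ : ({γ ∈ componentsOf (Γ \ P.singularSetIter f n) | Disjoint γ (P.nonGrazing f η n)} :
        Set (Set (ℝ × ℝ))), (P.leastExpansion f n γ)⁻¹ ≤ ENNReal.ofReal ε := by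
  obtain ⟨B, hB⟩ := exists_encard_singularSetIter_le (P := P) hf n
  have hcosϑ : 0 < Real.cos ϑ :=
    Real.cos_pos_of_mem_Ioo ⟨by linarith [hϑ.1, Real.pi_pos], hϑ.2⟩
  have hcosl : 0 < Real.cos (l * (π / 2)) := by
    refine Real.cos_pos_of_mem_Ioo ⟨?_, ?_⟩ <;> nlinarith [hf.nonneg, hf.lt_one, Real.pi_pos]
  set c := Real.cos (l * (π / 2))
  set η := c * Real.cos ϑ * ε / (B + 1 : ℕ) with hη
  have hη0 : 0 < η := by positivity
  have hfactor : Real.cos ϑ * (c / η) = (B + 1 : ℕ) / ε := by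
    rw [hη]
    field_simp
  refine ⟨η, hη0, fun δ hδ => ?_⟩
  rintro _ ⟨a, b, θ, -, hab, hθ, rfl⟩
  have hangle := abs_lt.1 (hθ.trans_lt hϑ.2)
  have hcard := (encard_componentsOf_le_encard_singularSetIter (P := P) hf n (hab.trans hδ)
    hangle).trans (add_le_add_left (hB a b θ (hab.trans hδ) hangle) 1)
  refine (tsum_inv_leastExpansion_le (E := ENNReal.ofReal ((B + 1 : ℕ) / ε)) ?_).trans ?_
  · rintro γ ⟨hγ, hgraze⟩ ⟨s, t⟩ hs
    obtain ⟨⟨-, rfl⟩, hsing⟩ := subset_of_mem_componentsOf hγ hs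
    rw [← hfactor]
    refine ofReal_cos_mul_le_expansion hf hn hθ hϑ.2 hsing
      (growth_ge_of_notMem_nonGrazing hf hη0 (sub_floor_mem_regular hn hangle hsing) fun hng => ?_)
    rw [← add_intCast_mem_nonGrazing ⌊s⌋, sub_add_cancel] at hng
    exact disjoint_left.1 hgraze hs hng
  · refine ENNReal.div_le_of_le_mul ?_
    rw [← ENNReal.ofReal_mul hε.le, mul_div_cancel₀ _ hε.ne', ENNReal.ofReal_natCast]
    exact_mod_cast (encard_le_encard (sep_subset _ _)).trans hcard

lemma stepExpansion_mono : Monotone (P.stepExpansion f) := by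
  refine fun ϑ₁ ϑ₂ h n => liminf_le_liminf (Eventually.of_forall fun δ => ?_)
  refine biSup_mono fun Γ => ?_
  rintro ⟨a, b, θ, hlt, hab, hθ, rfl⟩
  exact ⟨a, b, θ, hlt, hab, hθ.trans h, rfl⟩

lemma stepExpansion_le (hf : IsAngleContraction f l) {n : ℕ} (hn : n ≠ 0)
    (hϑ : ϑ ∈ Ico 0 (π / 2)) {G : ℝ} (hG : ∀ x ∈ P.regular f n, G ≤ P.growth f n x) :
    P.stepExpansion f ϑ n ≤
      (n * (2 * d * (d + 1)) + 1 : ℕ) / ENNReal.ofReal (Real.cos ϑ * G) := by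
  refine ENNReal.le_of_forall_pos_le_add fun ε hε _ => ?_
  obtain ⟨η, hη, hgrazing⟩ := exists_tsum_grazing_componentsOf_le (P := P) hf hn hϑ hε
  refine liminf_le_of_frequently_le' (Eventually.frequently ?_)
  filter_upwards [eventually_tsum_nonGrazing_componentsOf_le hf hη hn hϑ.2 hG,
    Ioc_mem_nhdsGT one_pos] with δ hnonGrazing hδ
  refine iSup₂_le fun Γ hΓ => ?_
  set D := componentsOf (Γ \ P.singularSetIter f n)
  have hsplit : {γ ∈ D | (γ ∩ P.nonGrazing f η n).Nonempty} ∪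
      {γ ∈ D | Disjoint γ (P.nonGrazing f η n)} = D := by
    ext γ
    simp only [disjoint_iff_inter_eq_empty, ← not_nonempty_iff_eq_empty, mem_union, mem_ofPred_eq]
    tauto
  rw [← hsplit]
  refine (ENNReal.tsum_union_le (fun γ => (P.leastExpansion f n γ)⁻¹) _ _).trans
    (add_le_add (hnonGrazing Γ hΓ) ((hgrazing δ hδ.2 Γ hΓ).trans_eq ENNReal.ofReal_coe_nnreal))

end PolygonalTable

end

theorem mainTheorem3_general {d : ℕ} (P : PolygonalTable d) {f : ℝ → ℝ} {l : ℝ}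
    (hf : IsAngleContraction f l) (hP : P.NoParallelSidesFacing) {ϑ : ℝ} (hϑ : ϑ < Real.pi / 2) :
    ∃ n₀ : ℕ, ∀ n ≥ n₀, P.stepExpansion f ϑ n < 1 := by
  obtain ⟨σ, hσ, hgrowth⟩ := PolygonalTable.exists_pow_le_growth hf hP
  have hϑ' : max ϑ 0 ∈ Ico 0 (Real.pi / 2) :=
    ⟨le_max_right _ _, max_lt hϑ (by positivity)⟩
  have hcos : 0 < Real.cos (max ϑ 0) :=
    Real.cos_pos_of_mem_Ioo ⟨by linarith [hϑ'.1, Real.pi_pos], hϑ'.2⟩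
  refine eventually_atTop.1 ?_
  filter_upwards [eventually_mul_add_one_lt_mul_pow_div hσ hcos (2 * d * (d + 1)) three_ne_zero,
    eventually_ne_atTop 0] with n hlt hn
  calc P.stepExpansion f ϑ n ≤ P.stepExpansion f (max ϑ 0) n :=
        PolygonalTable.stepExpansion_mono (le_max_left ϑ 0) n
    _ ≤ (n * (2 * d * (d + 1)) + 1 : ℕ) / ENNReal.ofReal (Real.cos (max ϑ 0) * σ ^ (n / 3)) :=
        PolygonalTable.stepExpansion_le hf hn hϑ' (hgrowth n)
    _ < 1 := ENNReal.div_lt_of_lt_mul (by rwa [one_mul, ENNReal.natCast_lt_ofReal])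

theorem mainTheorem3 {d : ℕ} (P : PolygonalTable d) (f : ℝ → ℝ) (hf : IsContractingLaw f)
    (hP : P.NoParallelSidesFacing) (ϑ : ℝ) (hϑ : ϑ < Real.pi / 2) :
    ∃ n₀ : ℕ, ∀ n ≥ n₀, P.stepExpansion f ϑ n < 1 :=
  have ⟨_, hl⟩ := hf.exists_isAngleContraction
  mainTheorem3_general P hl hP hϑ
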